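/- **Setting.** Let $(\Omega,\mathcal F)$ be a measurable space and $\mathscr H$ a linear space of real $\mathcal F$-measurable functions such that $\varphi(X_1,\dots,X_n)\in\mathscr H$ for all $X_1,\dots,X_n\in\mathscr H$ and $\varphi\in C_{l,Lip}(\mathbb R^n)$, i.e. $|\varphi(x)-\varphi(y)|\le C(1+|x|^m+|y|^m)|x-y|$ for some $C>0$, $m\in\mathbb N$. Let $\hat{\mathbb E}:\mathscr H\to[-\infty,\infty]$ be a sub-linear expectation: monotone, $\hat{\mathbb E}[c]=c$ for constants, $\hat{\mathbb E}[X+Y]\le\hat{\mathbb E}[X]+\hat{\mathbb E}[Y]$ whenever the right side is not of the form $\infty-\infty$, and $\hat{\mathbb E}[\lambda X]=\lambda\hat{\mathbb E}[X]$ for $\lambda\ge 0$ (with $0\cdot\infty=0$). Write $\mathscr H_b$ for the bounded elements of $\mathscr H$, $C_{b,Lip}$ for the bounded Lipschitz functions, and $\log x=\ln\max(e,x)$. Condition (CC) holds with a family $\mathscr P$ of probability measures on $(\Omega,\sigma(\mathscr H))$: $\hat{\mathbb E}[X]=\sup_{P\in\mathscr P}\int X\,dP$ for $X\in\mathscr H_b$,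 and for all $Z_1,Z_2,\ldots\in\mathscr H_b$ and $P_1,P_2,\ldots\in\mathscr P$ there are a subsequence $(n_k)$ and $P\in\mathscr P$ with $\int\varphi(Z_1,\dots,Z_d)\,dP_{n_k}\to\int\varphi(Z_1,\dots,Z_d)\,dP$ for all $d\ge1$, $\varphi\in C_{b,Lip}(\mathbb R^d)$. Let $\mathbb V:\mathcal F\to[0,1]$ be a capacity (monotone, $\mathbb V(\emptyset)=0$, $\mathbb V(\Omega)=1$) such that $\hat{\mathbb E}[f]\le\mathbb V(A)\le\hat{\mathbb E}[g]$ whenever $f\le I_A\le g$, $f,g\in\mathscr H$, $A\in\mathcal F$. Put $C_{\mathbb V}[X]=\int_0^\infty\mathbb V(X\ge t)\,dt+\int_{-\infty}^0[\mathbb V(X\ge t)-1]\,dt$ and $$\mathbb V^{\mathscr P}(A)=\sup_{P\in\mathscr P}P(A),\qquad \mathbb C^*(A)=\inf\Big\{\lim_{n}\hat{\mathbb E}\Big[\sum_{i=1}^n g_i\Big]: I_A\le\sum_{n=1}^\infty g_n,\ 0\le g_n\in\mathscr H\Big\},$$ $$\hat{\mathbb V}^*(A)=\inf\Big\{\sum_{n=1}^\infty\hat{\mathbb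 V}(A_n): A\subset\bigcup_{n=1}^\infty A_n,\ A_n\in\mathcal F\Big\},\qquad \hat{\mathbb V}(A)=\inf\{\hat{\mathbb E}[\xi]: I_A\le\xi\in\mathscr H\}.$$ Let $Y_1,Y_2,\ldots\in\mathscr H$ be independent and identically distributed under $\hat{\mathbb E}$: $\hat{\mathbb E}[\varphi(Y_i)]=\hat{\mathbb E}[\varphi(Y_1)]$ for all $\varphi\in C_{b,Lip}(\mathbb R)$ and $i\ge 1$; and for every $i\ge1$, with $X=(Y_1,\dots,Y_i)$, $\hat{\mathbb E}[\varphi(X,Y_{i+1})]=\hat{\mathbb E}\big[\hat{\mathbb E}[\varphi(x,Y_{i+1})]|_{x=X}\big]$ for all $\varphi\in C_{l,Lip}(\mathbb R^{i}\times\mathbb R)$ such that $\overline\varphi(x)=\hat{\mathbb E}[|\varphi(x,Y_{i+1})|]<\infty$ for all $x$ and $\hat{\mathbb E}[\overline\varphi(X)]<\infty$ (where the functions of $X$ to which the outer $\hat{\mathbb E}$ is applied are in $\mathscr H$). Put $\breve{\mathbb E}[X]=\lim_{c\to\infty}\hat{\mathbb E}[(-c)\vee(X\wedge c)]$ when the limit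 exists, $\overline\sigma=\sqrt{\breve{\mathbb E}[Y_1^2]}\in[0,\infty]$ (this limit always exists), and $d_n=\sqrt{2n\log\log n}$. Consider the conditions $$\text{(M)}\ \ C_{\mathbb V}\Big[\frac{Y_1^2}{\log\log|Y_1|}\Big]<\infty,\qquad\text{(Z)}\ \ \breve{\mathbb E}[Y_1]=\breve{\mathbb E}[-Y_1]=0\ \text{(the limits exist and vanish)}.$$ **Theorem.** Let $V$ be any one of $\mathbb V^{\mathscr P}$, $\mathbb C^*$, $\hat{\mathbb V}^*$. (a) If (M) and (Z) hold, then $$V\Big(\limsup_{n\to\infty}\frac{|\sum_{i=1}^nY_i|}{d_n}>\overline\sigma\Big)=0\qquad\text{and}\qquad V\Big(C\Big\{\frac{\sum_{i=1}^nY_i}{d_n}\Big\}=[-\overline\sigma,\overline\sigma]\Big)=1,$$ where $C\{x_n\}$ is the set of cluster points of $(x_n)$ in $[-\infty,\infty]$ (and $\overline\sigma=\infty$ is allowed). (b) Conversely, if $V\big(\limsup_{n\to\infty}|\sum_{i=1}^nY_i|/d_n=+\infty\big)<1$, then (M) and (Z) hold and $\overline\sigma<\infty$. -/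

import Mathlib

open MeasureTheory Filter Topology Set
open scoped ENNReal NNReal

/-- `C_{l,Lip}`: locally Lipschitz functions with polynomial growth of the Lipschitz constant.
On `ℝⁿ = Fin n → ℝ` the choice of the norm is immaterial, all norms being equivalent. -/
def IsCLLip {F : Type*} [SeminormedAddCommGroup F] (φ : F → ℝ) : Prop :=
  ∃ C : ℝ, 0 < C ∧ ∃ m : ℕ, ∀ x y : F,
    |φ x - φ y| ≤ C * (1 + ‖x‖ ^ m + ‖y‖ ^ m) * ‖x - y‖

/-- `C_{b,Lip}`: bounded Lipschitz functions. -/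
def IsCBLip {F : Type*} [SeminormedAddCommGroup F] (φ : F → ℝ) : Prop :=
  (∃ K : ℝ≥0, LipschitzWith K φ) ∧ ∃ M : ℝ, ∀ x, |φ x| ≤ M

/-- A sub-linear expectation space `(Ω, H, E)` over the measurable space `Ω`.
The sub-linear expectation is a map `H → [-∞, ∞]`; it is represented by a function on all of
`Ω → ℝ` whose values outside `H` are arbitrary and are never used. -/
structure SublinearExpectationSpace (Ω : Type*) [MeasurableSpace Ω] where
  /-- the linear space of random variables -/
  H : Submodule ℝ (Ω → ℝ)
  measurable_of_mem : ∀ X ∈ H, Measurable X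
  comp_mem : ∀ (n : ℕ) (X : Fin n → Ω → ℝ) (φ : (Fin n → ℝ) → ℝ),
    (∀ i, X i ∈ H) → IsCLLip φ → (fun ω => φ (fun i => X i ω)) ∈ H
  /-- the sub-linear expectation -/
  E : (Ω → ℝ) → EReal
  mono : ∀ X ∈ H, ∀ Y ∈ H, Y ≤ X → E Y ≤ E X
  const : ∀ c : ℝ, E (fun _ => c) = (c : EReal)
  subadd : ∀ X ∈ H, ∀ Y ∈ H, ¬ (E X = ⊤ ∧ E Y = ⊥) → ¬ (E X = ⊥ ∧ E Y = ⊤) →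
    E (X + Y) ≤ E X + E Y
  pos_homog : ∀ X ∈ H, ∀ l : ℝ, 0 ≤ l → E (l • X) = (l : EReal) * E X

/-- A capacity on the measurable subsets of `Ω`; its values on other sets are not used. -/
structure IsCapacity {Ω : Type*} [MeasurableSpace Ω] (V : Set Ω → ℝ≥0∞) : Prop where
  empty : V ∅ = 0
  univ : V Set.univ = 1
  mono : ∀ A B, MeasurableSet A → MeasurableSet B → A ⊆ B → V A ≤ V B

/-- The Choquet expectation
`C_V[X] = ∫₀^∞ V(X ≥ t) dt + ∫_{-∞}^0 (V(X ≥ t) - 1) dt`, as an extended real number. -/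
noncomputable def choquet {Ω : Type*} (V : Set Ω → ℝ≥0∞) (X : Ω → ℝ) : EReal :=
  ((∫⁻ t in Ioi (0 : ℝ), V {ω | t ≤ X ω} : ℝ≥0∞) : EReal)
    - ((∫⁻ t in Iio (0 : ℝ), (1 - V {ω | t ≤ X ω}) : ℝ≥0∞) : EReal)

/-- The convention `log x = ln (max (e, x))`. -/
noncomputable def logE (x : ℝ) : ℝ := Real.log (max (Real.exp 1) x)

/-- The normalization `√(2 n log log n)`. -/
noncomputable def lilNorm (n : ℕ) : ℝ := Real.sqrt (2 * n * logE (logE n))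

/-- The set of cluster points, in `[-∞, ∞]`, of a sequence of real numbers. -/
def clusterSet (x : ℕ → ℝ) : Set EReal :=
  {a | MapClusterPt a atTop (fun n => ((x n : ℝ) : EReal))}

/-- The two-sided truncation `(-c) ∨ (X ∧ c)`. -/
def truncRV {Ω : Type*} (c : ℝ) (X : Ω → ℝ) : Ω → ℝ := fun ω => max (-c) (min (X ω) c)

namespace SublinearExpectationSpace

variable {Ω : Type*} [MeasurableSpace Ω] (S : SublinearExpectationSpace Ω)

/-- The σ-field `σ(H)` generated by the random variables. -/
@[reducible] def sigmaH : MeasurableSpace Ω :=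
  ⨆ X : S.H, MeasurableSpace.comap (X : Ω → ℝ) inferInstance

/-- The bounded random variables `H_b`. -/
def Hb : Set (Ω → ℝ) := {X | X ∈ S.H ∧ ∃ M : ℝ, ∀ ω, |X ω| ≤ M}

/-- A sequence of random variables is identically distributed. -/
def IdentDist (Y : ℕ → Ω → ℝ) : Prop :=
  ∀ (i : ℕ) (φ : ℝ → ℝ), IsCBLip φ → S.E (fun ω => φ (Y i ω)) = S.E (fun ω => φ (Y 0 ω))

/-- The random vector `Y` is independent to the random vector `X`:
`E[φ(X, Y)] = E[E[φ(x, Y)]|_{x = X}]` for every `φ ∈ C_{l,Lip}` for which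
`φ'(x) := E[|φ(x, Y)|]` is finite for all `x` and `E[φ'(X)]` is finite.  As `E` is only defined on
`H`, this is asked for whenever the two functions of `X` that occur here are in `H`. -/
def IndepTo {m n : ℕ} (Y : Fin n → Ω → ℝ) (X : Fin m → Ω → ℝ) : Prop :=
  ∀ φ : (Fin m → ℝ) × (Fin n → ℝ) → ℝ, IsCLLip φ →
    (∀ x, S.E (fun ω => |φ (x, fun j => Y j ω)|) < ⊤) →
    (fun ω => (S.E (fun ω' => |φ (fun i => X i ω, fun j => Y j ω')|)).toReal) ∈ S.H →
    S.E (fun ω => (S.E (fun ω' => |φ (fun i => X i ω, fun j => Y j ω')|)).toReal) < ⊤ →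
    (fun ω => (S.E (fun ω' => φ (fun i => X i ω, fun j => Y j ω'))).toReal) ∈ S.H →
    S.E (fun ω => φ (fun i => X i ω, fun j => Y j ω)) =
      S.E (fun ω => (S.E (fun ω' => φ (fun i => X i ω, fun j => Y j ω'))).toReal)

/-- A sequence `Y 0, Y 1, …` of random variables is independent: each `Y k`, `k ≥ 1`, is
independent to `(Y 0, …, Y (k - 1))`. -/
def IndepSeq (Y : ℕ → Ω → ℝ) : Prop :=
  ∀ k : ℕ, 1 ≤ k → S.IndepTo (fun _ : Fin 1 => Y k) (fun i : Fin k => Y i)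

/-- `E[f] ≤ V(A) ≤ E[g]` whenever `f ≤ I_A ≤ g`, with `f, g ∈ H` and `A` measurable. -/
def Dominates (V : Set Ω → ℝ≥0∞) : Prop :=
  ∀ A : Set Ω, MeasurableSet A → ∀ f ∈ S.H, ∀ g ∈ S.H,
    f ≤ A.indicator 1 → A.indicator 1 ≤ g → S.E f ≤ (V A : EReal) ∧ (V A : EReal) ≤ S.E g

/-- The largest capacity `inf {E[ξ] : I_A ≤ ξ ∈ H}`. -/
noncomputable def upCap (A : Set Ω) : ℝ≥0∞ :=
  ⨅ ξ ∈ {ξ : Ω → ℝ | ξ ∈ S.H ∧ A.indicator 1 ≤ ξ}, (S.E ξ).toENNReal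

/-- The countably sub-additive extension
`inf {∑ n, upCap (A n) : A ⊆ ⋃ n, A n}` of `upCap`, the sets `A n` being measurable. -/
noncomputable def outCap (A : Set Ω) : ℝ≥0∞ :=
  ⨅ B ∈ {B : ℕ → Set Ω | (∀ n, MeasurableSet (B n)) ∧ A ⊆ ⋃ n, B n}, ∑' n, S.upCap (B n)

/-- The capacity `inf {lim_n E[∑_{i ≤ n} g i] : I_A ≤ ∑ n, g n, 0 ≤ g n ∈ H}`.  The sequence whose
limit is taken is nondecreasing, so that the limit is a supremum; the series is formed
in `[0, ∞]`. -/
noncomputable def starCap (A : Set Ω) : ℝ≥0∞ :=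
  ⨅ g ∈ {g : ℕ → Ω → ℝ | (∀ n, g n ∈ S.H ∧ 0 ≤ g n) ∧
      ∀ ω ∈ A, 1 ≤ ∑' n, ENNReal.ofReal (g n ω)},
    ⨆ n : ℕ, (S.E (∑ i ∈ Finset.range n, g i)).toENNReal

/-- The upper envelope `sup_{P ∈ Pfam} P(A)`, for `A ∈ σ(H)`. -/
noncomputable def envCap (Pfam : Set (@Measure Ω S.sigmaH)) (A : Set Ω) : ℝ≥0∞ :=
  ⨆ P ∈ Pfam, P A

/-- Condition (CC): on `H_b` the sub-linear expectation is the upper expectation of `Pfam`, a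
countable-dimensionally weakly compact family of probability measures on `(Ω, σ(H))`. -/
structure CC (Pfam : Set (@Measure Ω S.sigmaH)) : Prop where
  prob : ∀ P ∈ Pfam, IsProbabilityMeasure P
  repr : ∀ X ∈ S.Hb, S.E X = ⨆ P ∈ Pfam, ((∫ ω, X ω ∂P : ℝ) : EReal)
  compact : ∀ Y : ℕ → Ω → ℝ, (∀ i, Y i ∈ S.Hb) →
    ∀ Q : ℕ → @Measure Ω S.sigmaH, (∀ n, Q n ∈ Pfam) →
      ∃ k : ℕ → ℕ, StrictMono k ∧ ∃ P ∈ Pfam, ∀ d : ℕ, 1 ≤ d → ∀ φ : (Fin d → ℝ) → ℝ, IsCBLip φ →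
        Tendsto (fun j => ∫ ω, φ (fun i => Y i ω) ∂(Q (k j))) atTop
          (𝓝 (∫ ω, φ (fun i => Y i ω) ∂P))

/-- The truncated expectation `lim_{c → ∞} E[(-c) ∨ (X ∧ c)]` exists and equals `l`. -/
def HasTruncE (X : Ω → ℝ) (l : EReal) : Prop :=
  Tendsto (fun c : ℝ => S.E (truncRV c X)) atTop (𝓝 l)

/-- The truncated expectation `lim_{c → ∞} E[(-c) ∨ (X ∧ c)]`, for `X` for which it exists. -/
noncomputable def truncE (X : Ω → ℝ) : EReal :=
  limUnder atTop (fun c : ℝ => S.E (truncRV c X))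

/-- `σ̄ ∈ [0, ∞]`, the square root of the truncated expectation of `X²`. -/
noncomputable def sigmaBar (X : Ω → ℝ) : ℝ≥0∞ :=
  (S.truncE (fun ω => X ω ^ 2)).toENNReal ^ (1 / 2 : ℝ)

theorem comp_mem_one {X : Ω → ℝ} (hX : X ∈ S.H) {φ : ℝ → ℝ} (hφ : IsCLLip φ) :
    (fun ω => φ (X ω)) ∈ S.H := by
  obtain ⟨C, hC, m, h⟩ := hφ
  refine S.comp_mem 1 (fun _ => X) (fun x => φ (x 0)) (fun _ => hX) ⟨C, hC, m, fun x y => ?_⟩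
  refine (h (x 0) (y 0)).trans ?_
  have h1 := norm_le_pi_norm x 0
  have h2 := norm_le_pi_norm y 0
  have h3 := norm_le_pi_norm (x - y) 0
  simp only [Pi.sub_apply] at h3
  gcongr

theorem truncRV_sq_mem {X : Ω → ℝ} (hX : X ∈ S.H) {c : ℝ} (hc : 0 ≤ c) :
    truncRV c (fun ω => X ω ^ 2) ∈ S.H := by
  refine S.comp_mem_one hX (φ := fun x => max (-c) (min (x ^ 2) c)) ⟨1, one_pos, 1, fun x y => ?_⟩
  have e : ∀ z : ℝ, max (-c) (min (z ^ 2) c) = min (z ^ 2) c := fun z =>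
    max_eq_right (le_min (by nlinarith [sq_nonneg z]) (by linarith))
  simp only [e]
  refine (abs_min_sub_min_le_max _ _ _ _).trans ?_
  simp only [sub_self, abs_zero, pow_one, one_mul, Real.norm_eq_abs]
  rw [max_eq_left (abs_nonneg _), show x ^ 2 - y ^ 2 = (x + y) * (x - y) by ring, abs_mul]
  gcongr
  linarith [abs_add_le x y]

/-- The limit that defines `σ̄²` always exists, in `[0, ∞]`. -/
theorem hasTruncE_sq {X : Ω → ℝ} (hX : X ∈ S.H) :
    S.HasTruncE (fun ω => X ω ^ 2) ((S.sigmaBar X ^ 2 : ℝ≥0∞) : EReal) := by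
  set f : ℝ → EReal := fun c => S.E (truncRV c (fun ω => X ω ^ 2)) with hf
  have hmono : ∀ a b : ℝ, 0 ≤ a → a ≤ b → f a ≤ f b := by
    intro a b ha hab
    refine S.mono _ (S.truncRV_sq_mem hX (ha.trans hab)) _ (S.truncRV_sq_mem hX ha) ?_
    intro ω
    simp only [truncRV]
    refine max_le ?_ (le_max_of_le_right (min_le_min_left _ hab))
    exact le_max_of_le_right (le_min (by nlinarith [sq_nonneg (X ω)]) (by linarith))
  have hlim : Tendsto f atTop (𝓝 (⨆ c : ℝ, f (max c 0))) := by
    have h1 : Monotone (fun c : ℝ => f (max c 0)) := fun a b hab =>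
      hmono _ _ (le_max_right _ _) (max_le_max_right 0 hab)
    refine (tendsto_atTop_iSup h1).congr' ?_
    filter_upwards [eventually_ge_atTop (0 : ℝ)] with c hc
    rw [max_eq_left hc]
  have heq : S.truncE (fun ω => X ω ^ 2) = ⨆ c : ℝ, f (max c 0) := hlim.limUnder_eq
  have hpos : 0 ≤ ⨆ c : ℝ, f (max c 0) := by
    refine le_trans ?_ (le_iSup (fun c : ℝ => f (max c 0)) 0)
    have h0 : (0 : EReal) = S.E (fun _ => (0 : ℝ)) := by rw [S.const]; rfl
    rw [h0]
    refine S.mono _ (S.truncRV_sq_mem hX (le_max_right _ _)) _ S.H.zero_mem ?_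
    intro ω
    simp only [truncRV]
    exact le_max_of_le_right (le_min (sq_nonneg _) (by simp))
  have hsq : ((S.sigmaBar X ^ 2 : ℝ≥0∞) : EReal) = ⨆ c : ℝ, f (max c 0) := by
    rw [sigmaBar, heq, ← ENNReal.rpow_natCast, ← ENNReal.rpow_mul]
    norm_num
    exact EReal.coe_toENNReal hpos
  rw [hsq]
  exact hlim

/-- The moment condition `C_V[X² / log log |X|] < ∞`. -/
def MomentCond (V : Set Ω → ℝ≥0∞) (X : Ω → ℝ) : Prop :=
  choquet V (fun ω => X ω ^ 2 / logE (logE |X ω|)) < ⊤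

/-- The mean-zero condition: the truncated expectations of `X` and of `-X` exist and vanish. -/
def MeanZero (X : Ω → ℝ) : Prop := S.HasTruncE X 0 ∧ S.HasTruncE (-X) 0

end SublinearExpectationSpace

/-- The normalized partial sums `(Y 0 + ⋯ + Y (n - 1)) / √(2 n log log n)`. -/
noncomputable def lilRatio {Ω : Type*} (Y : ℕ → Ω → ℝ) (ω : Ω) (n : ℕ) : ℝ :=
  (∑ i ∈ Finset.range n, Y i ω) / lilNorm n

/-! The proof replaces the sub-linear law of `Y 0` by the set `M = marginalLaws (Y 0)` of the
probability laws on `ℝ` that it dominates. By (CC) the expectation of a bounded Lipschitz function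
of `Y 0` is the supremum of its integrals over `M`. The three capacities satisfy `envCap ≤ starCap ≤
outCap`, so an event is shown to be null for the largest of them, or to have full capacity for the
smallest.

Upper half. Under every law of the sequence coming from (CC), the conditional law of a coordinate
given the past is dominated by `M` (`condDominated_of_mem_pathLaws`), so stopped exponential
supermartingales give a maximal inequality that is uniform in the law. If `σ̄ < ∞`, a truncation
argument bounds the probability that the walk reaches `s * lilNorm m` before time `m`, for `s > σ̄`
(`CenteredFamily.block_bound`). By (M) the bounds are summable along geometric `m`. Being uniform,
they pass to `upCap` through Lipschitz functions (`upCap_le_of_pathLaws`), and a countable cover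
makes `outCap` of the limsup event vanish (`outCap_frequently_eq_zero`). If `σ̄ = ∞` there is
nothing to prove.

Lower half. Any product of members of `M` is dominated by the distribution of `Y`
(`integral_infinitePi_le`), and the compactness in (CC) turns this into domination by `envCap` on
all Borel sets (`measure_le_envCap`). An event that is almost sure under a single product law
therefore has full capacity, and it remains to choose that law. Within a block of length `m`, a
chain of about `log log m` favourable sub-blocks brings the sum above `K * lilNorm m` with
probability at least a multiple of `exp (-θ log log m)`, `θ < 1`, as soon as the variance exceeds `K
^ 2` (`exists_block_bound`). Along blocks that grow like `(j!) ^ 4` these probabilities form a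
divergent series, while the past is negligible. Distributing the blocks among countably many classes
serves all rational `K < σ̄` and both signs at once (`exists_ae_frequently_of_lt`). Since the
normalized walk moves by vanishing steps, it clusters at everything in between
(`clusterSet_eq_Icc`).

Converse. If (M) fails, some product law has single jumps beyond every multiple of `lilNorm n`
infinitely often; if a member of `M` has nonzero mean, its i.i.d. product grows linearly; if `σ̄ =
∞`, the lower half reaches every level. In each case the limsup is almost surely infinite under a
product law, so the event has capacity one. -/

/-! ### Stability of bounded Lipschitz functions. -/

namespace IsCBLip

variable {F : Type*} [SeminormedAddCommGroup F] {φ ψ : F → ℝ}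

theorem of_bounds {C M : ℝ} (h1 : ∀ x y, |φ x - φ y| ≤ C * ‖x - y‖) (h2 : ∀ x, |φ x| ≤ M) :
    IsCBLip φ := by
  refine ⟨⟨C.toNNReal, LipschitzWith.of_dist_le_mul fun x y => ?_⟩, M, h2⟩
  rw [Real.dist_eq, dist_eq_norm]
  exact (h1 x y).trans (by gcongr; exact Real.le_coe_toNNReal C)

theorem exists_bounds (h : IsCBLip φ) : ∃ C M : ℝ, 0 ≤ C ∧ 0 ≤ M ∧
    (∀ x y, |φ x - φ y| ≤ C * ‖x - y‖) ∧ ∀ x, |φ x| ≤ M := by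
  obtain ⟨⟨K, hK⟩, M, hM⟩ := h
  refine ⟨K, M, K.2, (abs_nonneg _).trans (hM 0), fun x y => ?_, hM⟩
  have := hK.dist_le_mul x y
  rwa [Real.dist_eq, dist_eq_norm] at this

theorem continuous (h : IsCBLip φ) : Continuous φ := by
  obtain ⟨⟨K, hK⟩, _⟩ := h
  exact hK.continuous

theorem isCLLip (h : IsCBLip φ) : IsCLLip φ := by
  obtain ⟨C, M, hC, hM, h1, h2⟩ := h.exists_bounds
  refine ⟨C + 1, by linarith, 0, fun x y => (h1 x y).trans ?_⟩
  have := norm_nonneg (x - y)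
  simp only [pow_zero]
  nlinarith

theorem const (c : ℝ) : IsCBLip (fun _ : F => c) :=
  of_bounds (C := 0) (M := |c|) (by simp) (by simp)

theorem sub_const (h : IsCBLip φ) (c : ℝ) : IsCBLip (fun x => φ x - c) := by
  obtain ⟨C, M, hC, hM, h1, h2⟩ := h.exists_bounds
  refine of_bounds (C := C) (M := M + |c|) (fun x y => ?_) fun x => ?_
  · simpa using h1 x y
  · exact (abs_sub _ _).trans (by gcongr; exact h2 x)

theorem abs (h : IsCBLip φ) : IsCBLip (fun x => |φ x|) := by
  obtain ⟨C, M, hC, hM, h1, h2⟩ := h.exists_bounds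
  exact of_bounds (C := C) (M := M) (fun x y => (abs_abs_sub_abs_le_abs_sub _ _).trans (h1 x y))
    fun x => by simpa using h2 x

theorem mul (hφ : IsCBLip φ) (hψ : IsCBLip ψ) : IsCBLip (fun x => φ x * ψ x) := by
  obtain ⟨C, M, hC, hM, h1, h2⟩ := hφ.exists_bounds
  obtain ⟨C', M', hC', hM', h1', h2'⟩ := hψ.exists_bounds
  refine of_bounds (C := M * C' + C * M') (M := M * M') (fun x y => ?_) fun x => ?_
  · rw [show φ x * ψ x - φ y * ψ y = φ x * (ψ x - ψ y) + (φ x - φ y) * ψ y by ring]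
    refine (abs_add_le _ _).trans ?_
    rw [abs_mul, abs_mul, add_mul]
    refine add_le_add ?_ ?_
    · calc _ ≤ M * (C' * ‖x - y‖) := by gcongr; exacts [h2 x, h1' x y]
        _ = _ := by ring
    · calc _ ≤ (C * ‖x - y‖) * M' := by gcongr; exacts [h1 x y, h2' y]
        _ = _ := by ring
  · rw [abs_mul]
    gcongr
    exacts [h2 x, h2' x]

theorem comp_lipschitz {G : Type*} [SeminormedAddCommGroup G] (h : IsCBLip φ) {g : G → F}
    {K : ℝ} (hg : ∀ x y, ‖g x - g y‖ ≤ K * ‖x - y‖) : IsCBLip (fun x => φ (g x)) := by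
  obtain ⟨C, M, hC, hM, h1, h2⟩ := h.exists_bounds
  refine of_bounds (C := C * K) (M := M) (fun x y => (h1 _ _).trans ?_) fun _ => h2 _
  rw [mul_assoc]
  gcongr
  exact hg x y

theorem truncate (c : ℝ) : IsCBLip (fun x : ℝ => max (-c) (min x c)) := by
  refine of_bounds (C := 1) (M := |c|) (fun x y => ?_) fun x => ?_
  · refine (abs_max_sub_max_le_max _ _ _ _).trans ?_
    rw [sub_self, abs_zero, max_eq_right (abs_nonneg _), one_mul]
    refine (abs_min_sub_min_le_max _ _ _ _).trans ?_
    simp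
  · rw [abs_le]
    exact ⟨(neg_abs_le_neg c).trans (le_max_left _ _),
      max_le (neg_le_abs c) ((min_le_right _ _).trans (le_abs_self c))⟩

end IsCBLip

/-! ### The sub-linear expectation on bounded variables. -/

namespace SublinearExpectationSpace

variable {Ω : Type*} [MeasurableSpace Ω] (S : SublinearExpectationSpace Ω)

theorem const_mem (c : ℝ) : (fun _ : Ω => c) ∈ S.H :=
  S.comp_mem 0 (fun i => i.elim0) (fun _ => c) (fun i => i.elim0) (IsCBLip.const c).isCLLip

theorem comp_mem_Hb {n : ℕ} {X : Fin n → Ω → ℝ} (hX : ∀ i, X i ∈ S.H) {φ : (Fin n → ℝ) → ℝ}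
    (hφ : IsCBLip φ) : (fun ω => φ (fun i => X i ω)) ∈ S.Hb :=
  ⟨S.comp_mem n X φ hX hφ.isCLLip, hφ.2.imp fun _ h _ => h _⟩

theorem comp_mem_Hb_one {X : Ω → ℝ} (hX : X ∈ S.H) {φ : ℝ → ℝ} (hφ : IsCBLip φ) :
    (fun ω => φ (X ω)) ∈ S.Hb :=
  ⟨S.comp_mem_one hX hφ.isCLLip, hφ.2.imp fun _ h _ => h _⟩

theorem E_le_of_le {X : Ω → ℝ} (hX : X ∈ S.H) {c : ℝ} (h : ∀ ω, X ω ≤ c) : S.E X ≤ c := by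
  rw [← S.const c]
  exact S.mono _ (S.const_mem c) _ hX h

theorem le_E_of_le {X : Ω → ℝ} (hX : X ∈ S.H) {c : ℝ} (h : ∀ ω, c ≤ X ω) : c ≤ S.E X := by
  rw [← S.const c]
  exact S.mono _ hX _ (S.const_mem c) h

theorem E_nonneg {X : Ω → ℝ} (hX : X ∈ S.H) (h : 0 ≤ X) : 0 ≤ S.E X := by
  simpa using S.le_E_of_le hX (c := 0) h

theorem coe_toReal_E {X : Ω → ℝ} (hX : X ∈ S.Hb) : ((S.E X).toReal : EReal) = S.E X := by
  obtain ⟨hX, M, hM⟩ := hX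
  refine EReal.coe_toReal (fun h => ?_) fun h => ?_
  · have := S.E_le_of_le hX fun ω => (abs_le.1 (hM ω)).2
    rw [h] at this
    simp at this
  · have := S.le_E_of_le hX fun ω => (abs_le.1 (hM ω)).1
    rw [h] at this
    exact absurd this (by simp)

theorem Hb_add {X Y : Ω → ℝ} (hX : X ∈ S.Hb) (hY : Y ∈ S.Hb) : X + Y ∈ S.Hb := by
  obtain ⟨hX, M, hM⟩ := hX
  obtain ⟨hY, N, hN⟩ := hY
  exact ⟨S.H.add_mem hX hY, M + N, fun ω => (abs_add_le _ _).trans (add_le_add (hM ω) (hN ω))⟩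

theorem toReal_E_mono {X Y : Ω → ℝ} (hX : X ∈ S.Hb) (hY : Y ∈ S.Hb) (h : X ≤ Y) :
    (S.E X).toReal ≤ (S.E Y).toReal := by
  rw [← EReal.coe_le_coe_iff, S.coe_toReal_E hX, S.coe_toReal_E hY]
  exact S.mono _ hY.1 _ hX.1 h

theorem toReal_E_add_le {X Y : Ω → ℝ} (hX : X ∈ S.Hb) (hY : Y ∈ S.Hb) :
    (S.E (X + Y)).toReal ≤ (S.E X).toReal + (S.E Y).toReal := by
  rw [← EReal.coe_le_coe_iff, EReal.coe_add, S.coe_toReal_E hX, S.coe_toReal_E hY,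
    S.coe_toReal_E (S.Hb_add hX hY)]
  refine S.subadd _ hX.1 _ hY.1 ?_ ?_
  · rw [← S.coe_toReal_E hX]; simp
  · rw [← S.coe_toReal_E hX]; simp

theorem toReal_E_const (c : ℝ) : (S.E (fun _ => c)).toReal = c := by simp [S.const]

theorem Hb_const (c : ℝ) : (fun _ : Ω => c) ∈ S.Hb := ⟨S.const_mem c, |c|, fun _ => le_rfl⟩

theorem toReal_E_le_add {X Y : Ω → ℝ} (hX : X ∈ S.Hb) (hY : Y ∈ S.Hb) {c : ℝ}
    (h : ∀ ω, X ω ≤ Y ω + c) : (S.E X).toReal ≤ (S.E Y).toReal + c := by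
  have h1 := S.toReal_E_add_le hY (S.Hb_const c)
  rw [S.toReal_E_const] at h1
  exact (S.toReal_E_mono hX (S.Hb_add hY (S.Hb_const c)) h).trans h1

theorem toReal_E_smul {X : Ω → ℝ} (hX : X ∈ S.Hb) {l : ℝ} (hl : 0 ≤ l) :
    (S.E (fun ω => l * X ω)).toReal = l * (S.E X).toReal := by
  have := S.pos_homog X hX.1 l hl
  rw [← S.coe_toReal_E hX, ← EReal.coe_mul] at this
  change (S.E (l • X)).toReal = _
  rw [this, EReal.toReal_coe]

theorem toReal_E_sub_const {X : Ω → ℝ} (hX : X ∈ S.Hb) (c : ℝ) :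
    (S.E (fun ω => X ω - c)).toReal = (S.E X).toReal - c := by
  have h2 : (fun ω => X ω - c) ∈ S.Hb := by
    have e : (fun ω => X ω - c) = X + fun _ => -c := by funext ω; simp [sub_eq_add_neg]
    rw [e]
    exact S.Hb_add hX (S.Hb_const (-c))
  have h1 := S.toReal_E_le_add h2 hX (c := -c) (fun ω => by simp [sub_eq_add_neg])
  have h3 := S.toReal_E_le_add hX h2 (c := c) (fun ω => by simp)
  linarith

theorem measurable_sigmaH {X : Ω → ℝ} (hX : X ∈ S.H) : Measurable[S.sigmaH] X := by
  rw [measurable_iff_comap_le]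
  exact le_iSup (fun X : S.H => MeasurableSpace.comap (X : Ω → ℝ) inferInstance) ⟨X, hX⟩

/-- Changing the frozen variable from `x` to `y` moves the integrand by at most `C * ‖x - y‖`,
uniformly in `ω`, so the partial expectation keeps the Lipschitz constant. This discharges the
membership conditions in `IndepTo`. -/
theorem comp_mem_of_prod_CBLip {m : ℕ} {Z : Ω → ℝ} (hZ : Z ∈ S.H)
    {φ : (Fin m → ℝ) × (Fin 1 → ℝ) → ℝ} (hφ : IsCBLip φ) :
    (∀ x, (fun ω => φ (x, fun _ => Z ω)) ∈ S.Hb) ∧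
    IsCBLip (fun x => (S.E (fun ω' => φ (x, fun _ => Z ω'))).toReal) := by
  have h1 : ∀ x, (fun ω => φ (x, fun _ => Z ω)) ∈ S.Hb := fun x => by
    refine S.comp_mem_Hb (X := fun _ : Fin 1 => Z) (fun _ => hZ) (φ := fun y => φ (x, y)) ?_
    refine hφ.comp_lipschitz (g := fun y => (x, y)) (K := 1) fun y z => ?_
    simp [Prod.norm_def]
  refine ⟨h1, ?_⟩
  obtain ⟨C, M, hC, hM, h3, h4⟩ := hφ.exists_bounds
  have key : ∀ x y, (S.E (fun ω' => φ (x, fun _ => Z ω'))).toReal ≤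
      (S.E (fun ω' => φ (y, fun _ => Z ω'))).toReal + C * ‖x - y‖ := fun x y => by
    refine S.toReal_E_le_add (h1 x) (h1 y) fun ω => ?_
    have := h3 (x, fun _ => Z ω) (y, fun _ => Z ω)
    simp only [Prod.mk_sub_mk, sub_self, Prod.norm_def, norm_zero] at this
    rw [max_eq_left (norm_nonneg _)] at this
    linarith [(abs_le.1 this).2]
  refine IsCBLip.of_bounds (C := C) (M := M) (fun x y => ?_) fun x => ?_
  · rw [abs_le]
    have h5 := key y x
    rw [norm_sub_rev] at h5
    constructor <;> linarith [key x y]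
  · have h5 := S.toReal_E_mono (h1 x) (S.Hb_const M) fun _ => (abs_le.1 (h4 _)).2
    have h6 := S.toReal_E_mono (S.Hb_const (-M)) (h1 x) fun _ => (abs_le.1 (h4 _)).1
    rw [S.toReal_E_const] at h5 h6
    exact abs_le.2 ⟨h6, h5⟩

/-- Independence for bounded Lipschitz functions, without side conditions. -/
theorem IndepTo.apply_CBLip {m : ℕ} {X : Fin m → Ω → ℝ} {Z : Ω → ℝ}
    (h : S.IndepTo (fun _ : Fin 1 => Z) X) (hX : ∀ i, X i ∈ S.H) (hZ : Z ∈ S.H)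
    {φ : (Fin m → ℝ) × (Fin 1 → ℝ) → ℝ} (hφ : IsCBLip φ) :
    S.E (fun ω => φ (fun i => X i ω, fun _ => Z ω)) =
      S.E (fun ω => (S.E (fun ω' => φ (fun i => X i ω, fun _ => Z ω'))).toReal) := by
  have h1 := S.comp_mem_of_prod_CBLip hZ hφ
  have h2 := S.comp_mem_of_prod_CBLip hZ hφ.abs
  refine h φ hφ.isCLLip (fun x => ?_) (S.comp_mem_Hb hX h2.2).1 ?_ (S.comp_mem_Hb hX h1.2).1
  · rw [← S.coe_toReal_E (h2.1 x)]
    exact EReal.coe_lt_top _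
  · rw [← S.coe_toReal_E (S.comp_mem_Hb hX h2.2)]
    exact EReal.coe_lt_top _

end SublinearExpectationSpace

/-! ### Laws on sequence space and conditional domination. -/

/-- The first `d` coordinates of a sequence. -/
def firstCoords (d : ℕ) (x : ℕ → ℝ) : Fin d → ℝ := fun i => x i

@[fun_prop]
theorem measurable_firstCoords (d : ℕ) : Measurable (firstCoords d) := by
  unfold firstCoords
  fun_prop

/-- Under `Q`, the conditional law of each coordinate given the previous ones is dominated by
the upper envelope of `M`. -/
def CondDominated (M : Set (Measure ℝ)) (Q : Measure (ℕ → ℝ)) : Prop :=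
  ∀ (k : ℕ) (ψ : (Fin k → ℝ) → ℝ≥0∞) (φ : ℝ → ℝ) (c : ℝ≥0), Measurable ψ → IsCBLip φ → 0 ≤ φ →
    (∀ μ ∈ M, ∫⁻ x, ENNReal.ofReal (φ x) ∂μ ≤ c) →
    ∫⁻ x, ψ (firstCoords k x) * ENNReal.ofReal (φ (x k)) ∂Q ≤ c * ∫⁻ x, ψ (firstCoords k x) ∂Q

/-- Indicators need not lie in `H`; the thickened indicator is the Lipschitz function used in their
place. -/
theorem exists_isCBLip_between {F : Type*} [SeminormedAddCommGroup F] (C : Set F) {δ : ℝ}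
    (hδ : 0 < δ) : ∃ g : F → ℝ, IsCBLip g ∧ (∀ x, 0 ≤ g x ∧ g x ≤ 1) ∧ (∀ x ∈ C, g x = 1) ∧
      ∀ x ∉ Metric.thickening δ C, g x = 0 := by
  have h01 : ∀ x, 0 ≤ (thickenedIndicator hδ C x : ℝ) ∧ (thickenedIndicator hδ C x : ℝ) ≤ 1 :=
    fun x => ⟨NNReal.coe_nonneg _, by exact_mod_cast thickenedIndicator_le_one hδ C x⟩
  refine ⟨fun x => (thickenedIndicator hδ C x : ℝ), ⟨⟨_, (LipschitzWith.of_dist_le_mul (K := 1) (f := fun x : ℝ≥0 => (x : ℝ)) fun x y => by simp [NNReal.dist_eq, Real.dist_eq]).comp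
    (lipschitzWith_thickenedIndicator hδ C)⟩, 1, fun x => ?_⟩, h01, fun x hx => ?_, fun x hx => ?_⟩
  · rw [abs_of_nonneg (h01 x).1]
    exact (h01 x).2
  · beta_reduce
    rw [thickenedIndicator_one hδ C hx]
    simp
  · beta_reduce
    rw [thickenedIndicator_zero hδ C hx]
    simp

/-- A finite measure that is dominated by another one on Lipschitz functions is dominated. -/
theorem measure_le_of_forall_lipschitz {F : Type*} [SeminormedAddCommGroup F] [MeasurableSpace F]
    [BorelSpace F] {μ ν : Measure F} [IsFiniteMeasure μ] [IsFiniteMeasure ν]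
    (h : ∀ ψ : F → ℝ, IsCBLip ψ → 0 ≤ ψ →
      ∫⁻ x, ENNReal.ofReal (ψ x) ∂μ ≤ ∫⁻ x, ENNReal.ofReal (ψ x) ∂ν) : μ ≤ ν := by
  -- For a closed set, Lipschitz functions supported in shrinking thickenings give the comparison;
  -- inner regularity by closed sets does the rest.
  have hclosed : ∀ C : Set F, IsClosed C → μ C ≤ ν C := by
    intro C hC
    have key : ∀ n : ℕ, μ C ≤ ν (Metric.thickening (1 / ((n : ℝ) + 1)) C) := by
      intro n
      obtain ⟨g, hg, hg01, hgC, hgn⟩ :=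
        exists_isCBLip_between C (δ := 1 / ((n : ℝ) + 1)) (by positivity)
      calc μ C = ∫⁻ x, C.indicator 1 x ∂μ := by
            rw [lintegral_indicator_one hC.measurableSet]
        _ ≤ ∫⁻ x, ENNReal.ofReal (g x) ∂μ := by
            refine lintegral_mono fun x => ?_
            by_cases hx : x ∈ C
            · simp [hx, hgC x hx]
            · simp [hx]
        _ ≤ ∫⁻ x, ENNReal.ofReal (g x) ∂ν := h g hg fun x => (hg01 x).1
        _ ≤ ∫⁻ x, (Metric.thickening (1 / ((n : ℝ) + 1)) C).indicator 1 x ∂ν := by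
            refine lintegral_mono fun x => ?_
            by_cases hx : x ∈ Metric.thickening (1 / ((n : ℝ) + 1)) C
            · rw [indicator_of_mem hx]
              simpa using (hg01 x).2
            · rw [hgn x hx]
              simp
        _ = _ := lintegral_indicator_one Metric.isOpen_thickening.measurableSet
    have hlim : Tendsto (fun n : ℕ => ν (Metric.thickening (1 / ((n : ℝ) + 1)) C)) atTop
        (𝓝 (ν C)) := by
      have := tendsto_measure_thickening_of_isClosed (μ := ν) (s := C)
        ⟨1, one_pos, measure_ne_top _ _⟩ hC
      refine this.comp ?_
      rw [tendsto_nhdsWithin_iff]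
      exact ⟨tendsto_one_div_add_atTop_nhds_zero_nat, Eventually.of_forall fun n => by
        simp only [mem_Ioi]; positivity⟩
    exact ge_of_tendsto' hlim key
  refine Measure.le_iff.2 fun s hs => ?_
  rw [hs.measure_eq_iSup_isClosed_of_ne_top (measure_ne_top μ s)]
  exact iSup₂_le fun K hK => iSup_le fun hKc => (hclosed K hKc).trans (measure_mono hK)

namespace SublinearExpectationSpace

variable {Ω : Type*} [MeasurableSpace Ω] (S : SublinearExpectationSpace Ω)

/-- The laws on `ℝ` that are dominated by the distribution of `X`. -/
def marginalLaws (X : Ω → ℝ) : Set (Measure ℝ) :=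
  {μ | IsProbabilityMeasure μ ∧
    ∀ φ, IsCBLip φ → ∫ x, φ x ∂μ ≤ (S.E (fun ω => φ (X ω))).toReal}

/-- The laws of the sequence `Y` under the measures of the family. -/
def pathLaws (Pfam : Set (@Measure Ω S.sigmaH)) (Y : ℕ → Ω → ℝ) : Set (Measure (ℕ → ℝ)) :=
  {Q | ∃ P ∈ Pfam, Q = @Measure.map Ω _ S.sigmaH _ (fun ω i => Y i ω) P}

theorem measurable_path {Y : ℕ → Ω → ℝ} (hY : ∀ n, Y n ∈ S.H) :
    @Measurable _ _ S.sigmaH _ (fun ω i => Y i ω) :=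
  @measurable_pi_lambda _ _ _ S.sigmaH _ _ fun i => S.measurable_sigmaH (hY i)

variable {S} {Pfam : Set (@Measure Ω S.sigmaH)} (hCC : S.CC Pfam) {Y : ℕ → Ω → ℝ}
  (hY : ∀ n, Y n ∈ S.H)
include hCC hY

theorem isProbabilityMeasure_of_mem_pathLaws {Q : Measure (ℕ → ℝ)} (hQ : Q ∈ S.pathLaws Pfam Y) :
    IsProbabilityMeasure Q := by
  obtain ⟨P, hP, rfl⟩ := hQ
  have := hCC.prob P hP
  exact @Measure.isProbabilityMeasure_map _ _ S.sigmaH _ P this _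
    (S.measurable_path hY).aemeasurable

omit hCC in
theorem integral_map_path {P : @Measure Ω S.sigmaH} {d : ℕ} {φ : (Fin d → ℝ) → ℝ}
    (hφ : IsCBLip φ) :
    ∫ x, φ (firstCoords d x) ∂(@Measure.map Ω _ S.sigmaH _ (fun ω i => Y i ω) P) =
      ∫ ω, φ (fun i => Y i ω) ∂P :=
  @integral_map Ω ℝ _ _ S.sigmaH P _ _ _ (S.measurable_path hY).aemeasurable _
    (hφ.continuous.measurable.comp (measurable_firstCoords d)).aestronglyMeasurable

theorem integral_le_of_mem_pathLaws {Q : Measure (ℕ → ℝ)} (hQ : Q ∈ S.pathLaws Pfam Y) {d : ℕ}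
    {φ : (Fin d → ℝ) → ℝ} (hφ : IsCBLip φ) :
    ∫ x, φ (firstCoords d x) ∂Q ≤ (S.E (fun ω => φ (fun i => Y i ω))).toReal := by
  obtain ⟨P, hP, rfl⟩ := hQ
  have hb : (fun ω => φ (fun i : Fin d => Y i ω)) ∈ S.Hb := S.comp_mem_Hb (fun i => hY i) hφ
  rw [integral_map_path hY hφ, ← EReal.coe_le_coe_iff, S.coe_toReal_E hb, hCC.repr _ hb]
  exact le_iSup₂ (f := fun P (_ : P ∈ Pfam) => ((∫ ω, φ (fun i : Fin d => Y i ω) ∂P : ℝ) : EReal))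
    P hP

theorem exists_mem_pathLaws_lt_integral {d : ℕ} {φ : (Fin d → ℝ) → ℝ} (hφ : IsCBLip φ) {a : ℝ}
    (ha : a < (S.E (fun ω => φ (fun i => Y i ω))).toReal) :
    ∃ Q ∈ S.pathLaws Pfam Y, a < ∫ x, φ (firstCoords d x) ∂Q := by
  have hb : (fun ω => φ (fun i : Fin d => Y i ω)) ∈ S.Hb := S.comp_mem_Hb (fun i => hY i) hφ
  rw [← EReal.coe_lt_coe_iff, S.coe_toReal_E hb, hCC.repr _ hb] at ha
  simp only [lt_iSup_iff] at ha
  obtain ⟨P, hP, h⟩ := ha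
  refine ⟨_, ⟨P, hP, rfl⟩, ?_⟩
  rw [integral_map_path hY hφ]
  exact EReal.coe_lt_coe_iff.1 h

theorem map_eval_mem_marginalLaws {Q : Measure (ℕ → ℝ)} (hQ : Q ∈ S.pathLaws Pfam Y) :
    Q.map (fun x => x 0) ∈ S.marginalLaws (Y 0) := by
  have := isProbabilityMeasure_of_mem_pathLaws hCC hY hQ
  refine ⟨Measure.isProbabilityMeasure_map (measurable_pi_apply 0).aemeasurable, fun φ hφ => ?_⟩
  rw [integral_map (measurable_pi_apply 0).aemeasurable
    hφ.continuous.aestronglyMeasurable]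
  exact integral_le_of_mem_pathLaws hCC hY hQ (d := 1) (φ := fun x => φ (x 0))
    (hφ.comp_lipschitz (g := fun x : Fin 1 → ℝ => x 0) (K := 1) fun x y => by
      simpa using norm_le_pi_norm (x - y) 0)

/-- By (CC) some path law comes as close to the expectation as desired, and its first marginal is a
member of `marginalLaws (Y 0)`. -/
theorem toReal_E_le_of_marginalLaws {φ : ℝ → ℝ} (hφ : IsCBLip φ) {c : ℝ}
    (h : ∀ μ ∈ S.marginalLaws (Y 0), ∫ x, φ x ∂μ ≤ c) :
    (S.E (fun ω => φ (Y 0 ω))).toReal ≤ c := by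
  by_contra! hlt
  obtain ⟨Q, hQ, h1⟩ := exists_mem_pathLaws_lt_integral hCC hY (d := 1) (φ := fun x => φ (x 0))
    (hφ.comp_lipschitz (g := fun x : Fin 1 → ℝ => x 0) (K := 1) fun x y => by
      simpa using norm_le_pi_norm (x - y) 0) hlt
  have h2 := h _ (map_eval_mem_marginalLaws hCC hY hQ)
  rw [integral_map (measurable_pi_apply 0).aemeasurable hφ.continuous.aestronglyMeasurable] at h2
  exact absurd (h1.trans_le h2) (lt_irrefl _)

variable (hind : S.IndepSeq Y) (hid : S.IdentDist Y)
include hind hid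

/-- Independence is applied to `ψ * (φ - c)` with `c` the expectation of `φ`. As `ψ ≥ 0`, positive
homogeneity makes the inner expectation `ψ` times zero; the whole expectation vanishes and dominates
the integral under `Q`. -/
theorem integral_mul_le_of_mem_pathLaws {Q : Measure (ℕ → ℝ)} (hQ : Q ∈ S.pathLaws Pfam Y) {k : ℕ}
    {ψ : (Fin k → ℝ) → ℝ} (hψ : IsCBLip ψ) {φ : ℝ → ℝ} (hφ : IsCBLip φ) (h0 : 0 ≤ ψ) :
    ∫ x, ψ (firstCoords k x) * φ (x k) ∂Q ≤
      (S.E (fun ω => φ (Y 0 ω))).toReal * ∫ x, ψ (firstCoords k x) ∂Q := by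
  have := isProbabilityMeasure_of_mem_pathLaws hCC hY hQ
  set c := (S.E (fun ω => φ (Y 0 ω))).toReal with hc
  have hφk : (S.E (fun ω => φ (Y k ω))).toReal = c := by rw [hid k φ hφ]
  have hbk := S.comp_mem_Hb_one (hY k) hφ
  have hbk' := S.comp_mem_Hb_one (hY k) (hφ.sub_const c)
  let Φ : (Fin (k + 1) → ℝ) → ℝ := fun x => ψ (fun i => x i.castSucc) * (φ (x (Fin.last k)) - c)
  have hΦ : IsCBLip Φ := by
    refine (hψ.comp_lipschitz (g := fun (x : Fin (k + 1) → ℝ) (i : Fin k) => x i.castSucc)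
      (K := 1) fun x y => ?_).mul ((hφ.sub_const c).comp_lipschitz
        (g := fun x : Fin (k + 1) → ℝ => x (Fin.last k)) (K := 1) fun x y => ?_)
    · rw [one_mul, pi_norm_le_iff_of_nonneg (norm_nonneg _)]
      exact fun i => norm_le_pi_norm (x - y) i.castSucc
    · simpa using norm_le_pi_norm (x - y) (Fin.last k)
  have hE : (S.E (fun ω => Φ (fun i => Y i ω))).toReal = 0 := by
    rcases Nat.eq_zero_or_pos k with rfl | hk
    · have : (fun ω => Φ (fun i => Y i ω)) =
          fun ω => ψ (fun i => i.elim0) * (φ (Y 0 ω) - c) := by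
        funext ω
        simp only [Φ]
        congr 2
        exact Subsingleton.elim _ _
      rw [this, S.toReal_E_smul (S.comp_mem_Hb_one (hY 0) (hφ.sub_const c)) (h0 _),
        S.toReal_E_sub_const hbk, hφk]
      simp
    · have hΨ : IsCBLip (fun z : (Fin k → ℝ) × (Fin 1 → ℝ) => ψ z.1 * (φ (z.2 0) - c)) := by
        refine (hψ.comp_lipschitz (g := Prod.fst) (K := 1) fun x y => ?_).mul
          ((hφ.sub_const c).comp_lipschitz
          (g := fun z : (Fin k → ℝ) × (Fin 1 → ℝ) => z.2 0) (K := 1) fun x y => ?_)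
        · simp [Prod.norm_def]
        · rw [one_mul, Prod.norm_def]
          exact (norm_le_pi_norm (x.2 - y.2) 0).trans (le_max_right _ _)
      have h1 := (hind k hk).apply_CBLip S (fun i => hY i) (hY k) hΨ
      have h2 : (fun ω => Φ (fun i => Y i ω)) = fun ω =>
          ψ (fun i : Fin k => Y i ω) * (φ (Y k ω) - c) := by
        funext ω
        simp [Φ]
      rw [h2, h1]
      have h3 : ∀ x : Fin k → ℝ, (S.E (fun ω' => ψ x * (φ (Y k ω') - c))).toReal = 0 := fun x => by
        rw [S.toReal_E_smul hbk' (h0 x), S.toReal_E_sub_const hbk, hφk, sub_self, mul_zero]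
      simp only [h3]
      exact S.toReal_E_const 0
  have h4 := integral_le_of_mem_pathLaws hCC hY hQ hΦ
  rw [hE] at h4
  have h5 : ∀ x : ℕ → ℝ, Φ (firstCoords (k + 1) x) =
      ψ (firstCoords k x) * φ (x k) - c * ψ (firstCoords k x) := fun x => by
    have : (fun i : Fin k => firstCoords (k + 1) x i.castSucc) = firstCoords k x := rfl
    simp only [Φ, this]
    simp only [firstCoords, Fin.val_last]
    ring
  simp only [h5] at h4
  obtain ⟨_, M, _, _, _, hM⟩ := hψ.exists_bounds
  obtain ⟨_, M', _, hM0', _, hM'⟩ := hφ.exists_bounds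
  have hm1 : Measurable fun x : ℕ → ℝ => ψ (firstCoords k x) :=
    hψ.continuous.measurable.comp (measurable_firstCoords k)
  have hm2 : Measurable fun x : ℕ → ℝ => φ (x k) :=
    hφ.continuous.measurable.comp (by fun_prop)
  have hi1 : Integrable (fun x : ℕ → ℝ => ψ (firstCoords k x)) Q :=
    .of_bound hm1.aestronglyMeasurable M (Eventually.of_forall fun _ => hM _)
  have hi2 : Integrable (fun x : ℕ → ℝ => ψ (firstCoords k x) * φ (x k)) Q :=
    hi1.mul_bdd hm2.aestronglyMeasurable (c := M') (Eventually.of_forall fun _ => hM' _)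
  rw [integral_sub hi2 (hi1.const_mul c), integral_const_mul] at h4
  linarith

/-- As functions of `ψ`, both sides are integrals against finite measures on `Fin k → ℝ`. Comparing
these on Lipschitz `ψ` suffices, and then all measurable `ψ` are covered. -/
theorem condDominated_of_mem_pathLaws {Q : Measure (ℕ → ℝ)} (hQ : Q ∈ S.pathLaws Pfam Y) :
    CondDominated (S.marginalLaws (Y 0)) Q := by
  intro k ψ φ c hψ hφ h0 hc
  have := isProbabilityMeasure_of_mem_pathLaws hCC hY hQ
  have hm2 : Measurable fun x : ℕ → ℝ => φ (x k) := hφ.continuous.measurable.comp (by fun_prop)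
  obtain ⟨_, M', _, hM0', _, hM'⟩ := hφ.exists_bounds
  have hφi : ∀ (μ : Measure ℝ) [IsProbabilityMeasure μ], Integrable φ μ := fun μ _ =>
    .of_bound hφ.continuous.aestronglyMeasurable M' (Eventually.of_forall fun _ => hM' _)
  have hcE : (S.E (fun ω => φ (Y 0 ω))).toReal ≤ c := by
    refine toReal_E_le_of_marginalLaws hCC hY hφ fun μ hμ => ?_
    have := hμ.1
    have h1 := hc μ hμ
    rw [← ofReal_integral_eq_lintegral_ofReal (hφi μ) (Eventually.of_forall h0)] at h1
    exact (ENNReal.ofReal_le_coe).1 h1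
  set ν₁ : Measure (Fin k → ℝ) :=
    (Q.withDensity fun x => ENNReal.ofReal (φ (x k))).map (firstCoords k) with hν₁
  set ν₂ : Measure (Fin k → ℝ) := (c : ℝ≥0∞) • Q.map (firstCoords k) with hν₂
  have hf1 : IsFiniteMeasure (Q.withDensity fun x => ENNReal.ofReal (φ (x k))) := by
    refine isFiniteMeasure_withDensity_ofReal ?_
    exact (Integrable.of_bound hm2.aestronglyMeasurable M'
      (Eventually.of_forall fun _ => hM' _)).hasFiniteIntegral
  have hf1' : IsFiniteMeasure ν₁ := by rw [hν₁]; infer_instance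
  have hf2 : IsFiniteMeasure ν₂ := by
    rw [hν₂]
    exact Measure.smul_finite _ (by simp)
  have e1 : ∀ g : (Fin k → ℝ) → ℝ≥0∞, Measurable g → ∫⁻ x, g x ∂ν₁ =
      ∫⁻ x, g (firstCoords k x) * ENNReal.ofReal (φ (x k)) ∂Q := fun g hg => by
    rw [hν₁, lintegral_map hg (measurable_firstCoords k),
      lintegral_withDensity_eq_lintegral_mul _ hm2.ennreal_ofReal
        (g := fun x => g (firstCoords k x)) (hg.comp (measurable_firstCoords k))]
    simp [mul_comm]
  have e2 : ∀ g : (Fin k → ℝ) → ℝ≥0∞, Measurable g → ∫⁻ x, g x ∂ν₂ =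
      c * ∫⁻ x, g (firstCoords k x) ∂Q := fun g hg => by
    rw [hν₂, lintegral_smul_measure, lintegral_map hg (measurable_firstCoords k)]
    rfl
  have hle : ν₁ ≤ ν₂ := by
    refine measure_le_of_forall_lipschitz fun g hg hg0 => ?_
    have hgm := hg.continuous.measurable
    rw [e1 _ hgm.ennreal_ofReal, e2 _ hgm.ennreal_ofReal]
    have h1 := integral_mul_le_of_mem_pathLaws hCC hY hind hid hQ hg hφ hg0
    obtain ⟨_, M, _, _, _, hM⟩ := hg.exists_bounds
    have hm1 : Measurable fun x : ℕ → ℝ => g (firstCoords k x) :=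
      hgm.comp (measurable_firstCoords k)
    have hi1 : Integrable (fun x : ℕ → ℝ => g (firstCoords k x)) Q :=
      .of_bound hm1.aestronglyMeasurable M (Eventually.of_forall fun _ => hM _)
    have hi2 : Integrable (fun x : ℕ → ℝ => g (firstCoords k x) * φ (x k)) Q :=
      hi1.mul_bdd hm2.aestronglyMeasurable (c := M') (Eventually.of_forall fun _ => hM' _)
    simp only [← ENNReal.ofReal_mul (hg0 _)]
    rw [← ofReal_integral_eq_lintegral_ofReal hi1 (Eventually.of_forall fun _ => hg0 _),
      ← ofReal_integral_eq_lintegral_ofReal hi2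
        (Eventually.of_forall fun x => mul_nonneg (hg0 _) (h0 _)),
      ← ENNReal.ofReal_coe_nnreal, ← ENNReal.ofReal_mul (p := (c : ℝ)) c.2]
    refine ENNReal.ofReal_le_ofReal (h1.trans ?_)
    exact mul_le_mul_of_nonneg_right hcE (integral_nonneg fun _ => hg0 _)
  rw [← e1 ψ hψ, ← e2 ψ hψ]
  exact lintegral_mono' hle le_rfl

end SublinearExpectationSpace

/-! ### Product measures of marginal laws. -/

theorem indepFun_firstCoords {Ω : Type*} [MeasurableSpace Ω] {P : Measure Ω} {X : ℕ → Ω → ℝ}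
    (h : ProbabilityTheory.iIndepFun X P) (hX : ∀ i, Measurable (X i)) (d : ℕ) :
    ProbabilityTheory.IndepFun (fun ω (i : Fin d) => X i ω) (X d) P := by
  have h1 := h.indepFun_finset (Finset.range d) {d} (by simp) hX
  exact h1.comp (φ := fun (y : Finset.range d → ℝ) (i : Fin d) => y ⟨i, by simp⟩)
    (ψ := fun y : ({d} : Finset ℕ) → ℝ => y ⟨d, by simp⟩) (by fun_prop) (by fun_prop)

theorem norm_snoc_sub_snoc_le {d : ℕ} (x y : Fin d → ℝ) (a b : ℝ) :
    ‖(Fin.snoc x a : Fin (d + 1) → ℝ) - (Fin.snoc y b : Fin (d + 1) → ℝ)‖ ≤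
      max ‖x - y‖ |a - b| := by
  rw [pi_norm_le_iff_of_nonneg (le_max_of_le_left (norm_nonneg _))]
  refine Fin.lastCases ?_ fun i => ?_
  · simp
  · simp only [Pi.sub_apply, Fin.snoc_castSucc]
    exact (norm_le_pi_norm (x - y) i).trans (le_max_left _ _)

namespace SublinearExpectationSpace

variable {Ω : Type*} [MeasurableSpace Ω] {S : SublinearExpectationSpace Ω}

section product

variable {Y : ℕ → Ω → ℝ} (hY : ∀ n, Y n ∈ S.H) (hind : S.IndepSeq Y) (hid : S.IdentDist Y)
include hY hind

theorem E_snoc {d : ℕ} {φ : (Fin (d + 1) → ℝ) → ℝ} (hφ : IsCBLip φ) :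
    S.E (fun ω => φ (fun i => Y i ω)) = S.E (fun ω =>
      (S.E (fun ω' => φ (Fin.snoc (fun i : Fin d => Y i ω) (Y d ω')))).toReal) ∧
    IsCBLip (fun x : Fin d → ℝ => (S.E (fun ω' => φ (Fin.snoc x (Y d ω')))).toReal) := by
  have hφ' : IsCBLip (fun z : (Fin d → ℝ) × (Fin 1 → ℝ) => φ (Fin.snoc z.1 (z.2 0))) := by
    refine hφ.comp_lipschitz
      (g := fun z : (Fin d → ℝ) × (Fin 1 → ℝ) => (Fin.snoc z.1 (z.2 0) : Fin (d + 1) → ℝ))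
      (K := 1) fun x y => ?_
    refine (norm_snoc_sub_snoc_le _ _ _ _).trans ?_
    rw [one_mul, Prod.norm_def]
    exact max_le_max le_rfl (norm_le_pi_norm (x.2 - y.2) 0)
  have hs : ∀ ω : Ω, (fun i : Fin (d + 1) => Y i ω) = Fin.snoc (fun i : Fin d => Y i ω) (Y d ω) :=
    fun ω => by
      funext i
      refine Fin.lastCases ?_ (fun i => ?_) i <;> simp
  refine ⟨?_, (S.comp_mem_of_prod_CBLip (hY d) hφ').2⟩
  simp only [hs]
  -- Independence is only assumed from the second variable on. For `d = 0` there is no past, and the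
  -- outer expectation is that of a constant.
  rcases Nat.eq_zero_or_pos d with rfl | hd
  · have : ∀ ω : Ω, (fun i : Fin 0 => Y i ω) = fun i => i.elim0 := fun ω => Subsingleton.elim _ _
    simp only [this]
    have hb : (fun ω' => φ (Fin.snoc (fun i : Fin 0 => i.elim0) (Y 0 ω'))) ∈ S.Hb :=
      S.comp_mem_Hb_one (hY 0) (φ := fun y => φ (Fin.snoc (fun i : Fin 0 => i.elim0) y))
        (hφ.comp_lipschitz (K := 1) fun x y => by
          refine (norm_snoc_sub_snoc_le _ _ _ _).trans ?_
          rw [sub_self, norm_zero, one_mul, max_eq_right (abs_nonneg _), Real.norm_eq_abs])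
    rw [S.const, S.coe_toReal_E hb]
  · exact (hind d hd).apply_CBLip S (fun i => hY i) (hY d) hφ'

include hid in
/-- Product measures of marginal laws are dominated by the distribution of the sequence. -/
theorem integral_infinitePi_le {μ : ℕ → Measure ℝ} (hμ : ∀ i, μ i ∈ S.marginalLaws (Y 0))
    [∀ i, IsProbabilityMeasure (μ i)] {d : ℕ} {φ : (Fin d → ℝ) → ℝ} (hφ : IsCBLip φ) :
    ∫ x, φ (firstCoords d x) ∂(Measure.infinitePi μ) ≤
      (S.E (fun ω => φ (fun i => Y i ω))).toReal := by
  induction d with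
  | zero =>
    have h1 : ∀ x, φ x = φ default := fun x => congrArg φ (Subsingleton.elim _ _)
    simp [h1, S.toReal_E_const]
  | succ d ih =>
    obtain ⟨h1, h2⟩ := E_snoc hY hind hφ
    obtain ⟨C, M, hC, hM, hL, hB⟩ := hφ.exists_bounds
    have hsec : ∀ x : Fin d → ℝ, IsCBLip (fun y : ℝ => φ (Fin.snoc x y)) := fun x =>
      hφ.comp_lipschitz (K := 1) fun y z => by
        refine (norm_snoc_sub_snoc_le _ _ _ _).trans ?_
        simp
    have hint : ∀ x : Fin d → ℝ, Integrable (fun y : ℝ => φ (Fin.snoc x y)) (μ d) := fun x =>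
      .of_bound (hsec x).continuous.aestronglyMeasurable M (Eventually.of_forall fun _ => hB _)
    have hΦ : IsCBLip (fun x : Fin d → ℝ => ∫ y, φ (Fin.snoc x y) ∂(μ d)) := by
      refine IsCBLip.of_bounds (C := C) (M := M) (fun x y => ?_) fun x => ?_
      · rw [← integral_sub (hint x) (hint y)]
        have h3 : ∀ z, ‖φ (Fin.snoc x z) - φ (Fin.snoc y z)‖ ≤ C * ‖x - y‖ := fun z => by
          refine (hL _ _).trans (mul_le_mul_of_nonneg_left ?_ hC)
          refine (norm_snoc_sub_snoc_le _ _ _ _).trans ?_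
          simp
        simpa using norm_integral_le_of_norm_le_const (μ := μ d) (Eventually.of_forall h3)
      · simpa using norm_integral_le_of_norm_le_const (μ := μ d)
          (f := fun y => φ (Fin.snoc x y)) (C := M) (Eventually.of_forall fun z => hB (Fin.snoc x z))
    have hindQ : ProbabilityTheory.IndepFun (firstCoords d) (fun x : ℕ → ℝ => x d)
        (Measure.infinitePi μ) :=
      indepFun_firstCoords (X := fun i (x : ℕ → ℝ) => x i)
        (ProbabilityTheory.iIndepFun_infinitePi (X := fun _ x => x) (fun _ => measurable_id))
        (fun i => measurable_pi_apply i) d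
    have hprod := (ProbabilityTheory.indepFun_iff_map_prod_eq_prod_map_map
      (measurable_firstCoords d).aemeasurable (measurable_pi_apply d).aemeasurable).1 hindQ
    have hsn : Measurable fun z : (Fin d → ℝ) × ℝ => (Fin.snoc z.1 z.2 : Fin (d + 1) → ℝ) := by
      refine measurable_pi_lambda _ (Fin.lastCases ?_ fun i => ?_)
      · simpa using measurable_snd
      · simp only [Fin.snoc_castSucc]
        fun_prop
    have hmeas : Measurable fun z : (Fin d → ℝ) × ℝ => φ (Fin.snoc z.1 z.2) :=
      hφ.continuous.measurable.comp hsn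
    have heval : Measure.map (fun x : ℕ → ℝ => x d) (Measure.infinitePi μ) = μ d :=
      Measure.infinitePi_map_eval μ d
    rw [heval] at hprod
    have hpm : IsProbabilityMeasure (Measure.map (firstCoords d) (Measure.infinitePi μ)) :=
      Measure.isProbabilityMeasure_map (measurable_firstCoords d).aemeasurable
    have h4 : ∫ x, φ (firstCoords (d + 1) x) ∂(Measure.infinitePi μ) =
        ∫ x, (∫ y, φ (Fin.snoc (firstCoords d x) y) ∂(μ d)) ∂(Measure.infinitePi μ) := by
      have h5 : ∀ x : ℕ → ℝ, firstCoords (d + 1) x = Fin.snoc (firstCoords d x) (x d) := fun x => by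
        funext i
        refine Fin.lastCases ?_ (fun i => ?_) i <;> simp [firstCoords]
      simp only [h5]
      rw [← integral_map (φ := fun x : ℕ → ℝ => (firstCoords d x, x d))
        (f := fun z : (Fin d → ℝ) × ℝ => φ (Fin.snoc z.1 z.2))
        ((measurable_firstCoords d).prodMk (measurable_pi_apply d)).aemeasurable
        hmeas.aestronglyMeasurable, hprod, integral_prod]
      · rw [integral_map (measurable_firstCoords d).aemeasurable
          hΦ.continuous.aestronglyMeasurable]
      · exact .of_bound hmeas.aestronglyMeasurable M (Eventually.of_forall fun _ => hB _)
    -- Fubini on the left, the iterated expectation on the right: the inductive hypothesis handles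
    -- the function with its last coordinate integrated out, and `μ d` is then compared with the
    -- expectation for each fixed past.
    rw [h4, h1]
    refine (ih hΦ).trans (S.toReal_E_mono (S.comp_mem_Hb (fun i => hY i) hΦ)
      (S.comp_mem_Hb (fun i => hY i) h2) fun ω => ?_)
    refine ((hμ d).2 _ (hsec _)).trans_eq ?_
    rw [hid d _ (hsec _)]

end product

/-! ### From path laws to capacities. -/

section capacitability

variable {Pfam : Set (@Measure Ω S.sigmaH)} (hCC : S.CC Pfam) {Y : ℕ → Ω → ℝ}
  (hY : ∀ n, Y n ∈ S.H)
include hCC hY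

omit hCC in
theorem le_envCap_of_mem_pathLaws {Q : Measure (ℕ → ℝ)} (hQ : Q ∈ S.pathLaws Pfam Y)
    {A : Set (ℕ → ℝ)} (hA : MeasurableSet A) : Q A ≤ S.envCap Pfam {ω | (fun i => Y i ω) ∈ A} := by
  obtain ⟨P, hP, rfl⟩ := hQ
  rw [@Measure.map_apply _ _ S.sigmaH _ P _ (S.measurable_path hY) _ hA]
  exact le_iSup₂ (f := fun (P : @Measure Ω S.sigmaH) (_ : P ∈ Pfam) =>
    P {ω | (fun i => Y i ω) ∈ A}) P hP

/-- A limit of path laws along which countably many test functions converge. -/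
theorem exists_pathLaws_limit (φ : (n : ℕ) → (Fin n → ℝ) → ℝ) (hφ : ∀ n, IsCBLip (φ n))
    (h01 : ∀ n x, 0 ≤ φ n x ∧ φ n x ≤ 1) {Q : ℕ → Measure (ℕ → ℝ)}
    (hQ : ∀ n, Q n ∈ S.pathLaws Pfam Y) :
    ∃ k : ℕ → ℕ, StrictMono k ∧ ∃ Q' ∈ S.pathLaws Pfam Y, ∀ n,
      Tendsto (fun j => ∫ x, φ n (firstCoords n x) ∂(Q (k j))) atTop
        (𝓝 (∫ x, φ n (firstCoords n x) ∂Q')) := by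
  choose P hP hPQ using hQ
  -- The variables given to (CC) are the values of the test functions: (CC) requires bounded
  -- variables, which the `Y i` need not be.
  obtain ⟨k, hk, P', hP', hlim⟩ := hCC.compact (fun n ω => φ n (fun i => Y i ω))
    (fun n => S.comp_mem_Hb (fun i => hY i) (hφ n)) P hP
  refine ⟨k, hk, _, ⟨P', hP', rfl⟩, fun n => ?_⟩
  -- The value of `φ n` is the last of `n + 1` coordinates; truncation at one makes this coordinate
  -- a bounded function and changes nothing, since `0 ≤ φ n ≤ 1`.
  have h1 := hlim (n + 1) (by omega) (fun z => max (-1) (min (z (Fin.last n)) 1))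
    ((IsCBLip.truncate 1).comp_lipschitz (g := fun z : Fin (n + 1) → ℝ => z (Fin.last n)) (K := 1)
      fun x y => by simpa using norm_le_pi_norm (x - y) (Fin.last n))
  have h2 : ∀ ω : Ω, max (-1) (min (φ n (fun i => Y i ω)) 1) = φ n (fun i => Y i ω) := fun ω => by
    rw [min_eq_left (h01 _ _).2, max_eq_right (by linarith [(h01 n (fun i => Y i ω)).1])]
  simp only [Fin.val_last, h2] at h1
  simpa only [hPQ, integral_map_path hY (hφ n)] using h1

/-- A law dominated by the distribution of `Y` is dominated by the upper envelope. -/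
theorem measure_le_envCap {Q : Measure (ℕ → ℝ)} [IsProbabilityMeasure Q]
    (hdomQ : ∀ (d : ℕ) (φ : (Fin d → ℝ) → ℝ), IsCBLip φ →
      ∫ x, φ (firstCoords d x) ∂Q ≤ (S.E (fun ω => φ (fun i => Y i ω))).toReal)
    {A : Set (ℕ → ℝ)} (hA : MeasurableSet A) : Q A ≤ S.envCap Pfam {ω | (fun i => Y i ω) ∈ A} := by
  rw [hA.measure_eq_iSup_isClosed_of_ne_top (measure_ne_top Q A)]
  refine iSup₂_le fun F hFA => iSup_le fun hF => ?_
  suffices h : ∃ Q' ∈ S.pathLaws Pfam Y, Q F ≤ Q' F by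
    obtain ⟨Q', hQ', h⟩ := h
    exact (h.trans (measure_mono hFA)).trans (le_envCap_of_mem_pathLaws hY hQ' hA)
  rcases F.eq_empty_or_nonempty with rfl | hne
  · have h0 : (0 : ℝ) < (S.E (fun ω => (fun _ : Fin 0 → ℝ => (1 : ℝ)) (fun i => Y i ω))).toReal := by
      simp [S.toReal_E_const]
    obtain ⟨Q', hQ', -⟩ := exists_mem_pathLaws_lt_integral hCC hY (d := 0) (IsCBLip.const 1) h0
    exact ⟨Q', hQ', by simp⟩
  -- These distances increase with the number of coordinates, so the functions `φ n` below decrease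
  -- along every sequence. They equal one on `F` and, because `F` is closed for the product
  -- topology, are eventually zero off `F`.
  let D : ∀ n, (Fin n → ℝ) → ℝ := fun n y => Metric.infDist y (firstCoords n '' F)
  have hD0 : ∀ n y, 0 ≤ D n y := fun n y => Metric.infDist_nonneg
  have hDL : ∀ n x y, |D n x - D n y| ≤ ‖x - y‖ := fun n x y => by
    have := (Metric.lipschitz_infDist_pt (firstCoords n '' F)).dist_le_mul x y
    simpa [Real.dist_eq, dist_eq_norm] using this
  let φ : (n : ℕ) → (Fin n → ℝ) → ℝ := fun n y => max 0 (1 - n * D n y)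
  have h01 : ∀ n y, 0 ≤ φ n y ∧ φ n y ≤ 1 := fun n y =>
    ⟨le_max_left _ _, max_le zero_le_one (sub_le_self _ (mul_nonneg n.cast_nonneg (hD0 n y)))⟩
  have hφ : ∀ n, IsCBLip (φ n) := fun n => by
    refine IsCBLip.of_bounds (C := n) (M := 1) (fun x y => ?_) fun y => ?_
    · refine (abs_max_sub_max_le_max _ _ _ _).trans ?_
      rw [sub_self, abs_zero, max_eq_right (abs_nonneg _), show 1 - n * D n x - (1 - n * D n y) = -(n * (D n x - D n y)) by ring, abs_neg, abs_mul,
        Nat.abs_cast]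
      gcongr
      exact hDL n x y
    · rw [abs_of_nonneg (h01 n y).1]
      exact (h01 n y).2
  have hDmono : ∀ (x : ℕ → ℝ) {n m : ℕ}, n ≤ m → D n (firstCoords n x) ≤ D m (firstCoords m x) := by
    intro x n m hnm
    refine (Metric.le_infDist (hne.image _)).2 ?_
    rintro _ ⟨y, hy, rfl⟩
    refine (Metric.infDist_le_dist_of_mem (mem_image_of_mem _ hy)).trans ?_
    rw [dist_pi_le_iff dist_nonneg]
    exact fun i => dist_le_pi_dist (firstCoords m x) (firstCoords m y) ⟨i, i.2.trans_le hnm⟩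
  have hφanti : ∀ (x : ℕ → ℝ) {n m : ℕ}, n ≤ m →
      φ m (firstCoords m x) ≤ φ n (firstCoords n x) := by
    intro x n m hnm
    refine max_le_max le_rfl (sub_le_sub_left ?_ _)
    have := hDmono x hnm
    have := hD0 n (firstCoords n x)
    gcongr
  have hφF : ∀ n, ∀ x ∈ F, φ n (firstCoords n x) = 1 := fun n x hx => by
    have : D n (firstCoords n x) = 0 := Metric.infDist_zero_of_mem (mem_image_of_mem _ hx)
    simp [φ, this]
  have hφlim : ∀ x ∉ F, ∀ᶠ n in atTop, φ n (firstCoords n x) = 0 := by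
    intro x hx
    obtain ⟨I, u, hu, huF⟩ := isOpen_pi_iff.1 hF.isOpen_compl x hx
    obtain ⟨d, hd⟩ : ∃ d, ∀ i ∈ I, i < d :=
      ⟨I.sup id + 1, fun i hi => Nat.lt_succ_of_le (Finset.le_sup (f := id) hi)⟩
    obtain ⟨ε, hε, hεu⟩ : ∃ ε > 0, ∀ i ∈ I, Metric.ball (x i) ε ⊆ u i := by
      choose! e he heu using fun i hi => Metric.isOpen_iff.1 (hu i hi).1 (x i) (hu i hi).2
      rcases I.eq_empty_or_nonempty with rfl | hI
      · exact ⟨1, one_pos, by simp⟩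
      · refine ⟨I.inf' hI e, (Finset.lt_inf'_iff hI).2 fun i hi => he i hi, fun i hi => ?_⟩
        exact (Metric.ball_subset_ball (Finset.inf'_le e hi)).trans (heu i hi)
    have hDd : ε ≤ D d (firstCoords d x) := by
      refine (Metric.le_infDist (hne.image _)).2 ?_
      rintro _ ⟨y, hy, rfl⟩
      by_contra! hlt
      refine huF (a := y) (fun i hi => hεu i hi ?_) hy
      rw [Metric.mem_ball, dist_comm]
      exact (dist_le_pi_dist (firstCoords d x) (firstCoords d y) ⟨i, hd i hi⟩).trans_lt hlt
    obtain ⟨N, hN⟩ := exists_nat_gt (1 / ε)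
    filter_upwards [eventually_ge_atTop (max d N)] with n hn
    have h1 : ε ≤ D n (firstCoords n x) := hDd.trans (hDmono x ((le_max_left _ _).trans hn))
    have h2 : 1 / ε < n := hN.trans_le (by exact_mod_cast (le_max_right _ _).trans hn)
    rw [div_lt_iff₀ hε] at h2
    refine max_eq_left ?_
    have : (n : ℝ) * ε ≤ n * D n (firstCoords n x) := by gcongr
    linarith
  have hm : ∀ n, Measurable fun x : ℕ → ℝ => φ n (firstCoords n x) := fun n =>
    (hφ n).continuous.measurable.comp (measurable_firstCoords n)
  have hi : ∀ (R : Measure (ℕ → ℝ)) [IsProbabilityMeasure R] n,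
      Integrable (fun x : ℕ → ℝ => φ n (firstCoords n x)) R := fun R _ n =>
    .of_bound (hm n).aestronglyMeasurable 1 (Eventually.of_forall fun x => by
      rw [Real.norm_eq_abs, abs_of_nonneg (h01 n _).1]; exact (h01 n _).2)
  have hQφ : ∀ n, Q.real F ≤ ∫ x, φ n (firstCoords n x) ∂Q := fun n => by
    rw [← integral_indicator_one hF.measurableSet]
    refine integral_mono ((integrable_const (1 : ℝ)).indicator hF.measurableSet) (hi Q n)
      fun x => ?_
    by_cases hx : x ∈ F
    · simp [hx, hφF n x hx]
    · simpa [hx] using (h01 n _).1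
  have hsel : ∀ n : ℕ, ∃ R ∈ S.pathLaws Pfam Y,
      Q.real F - 1 / ((n : ℝ) + 1) < ∫ x, φ n (firstCoords n x) ∂(R) := fun n => by
    refine exists_mem_pathLaws_lt_integral hCC hY (hφ n) ?_
    have : (0 : ℝ) < 1 / ((n : ℝ) + 1) := by positivity
    linarith [hQφ n, hdomQ n _ (hφ n)]
  choose R hR hRlt using hsel
  -- Each `R n` is nearly optimal for `φ n`. Since the `φ n` decrease, a fixed `φ n` has almost the
  -- required integral under all later `R`, and hence under the limit `Q'`; then `n` tends to
  -- infinity.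
  obtain ⟨k, hk, Q', hQ', hlim⟩ := exists_pathLaws_limit hCC hY φ hφ h01 hR
  have hpR : ∀ n, IsProbabilityMeasure (R n) := fun n =>
    isProbabilityMeasure_of_mem_pathLaws hCC hY (hR n)
  have hpQ' := isProbabilityMeasure_of_mem_pathLaws hCC hY hQ'
  refine ⟨Q', hQ', ?_⟩
  have h1 : ∀ n, Q.real F ≤ ∫ x, φ n (firstCoords n x) ∂Q' := by
    intro n
    have hl : Tendsto (fun j => Q.real F - 1 / ((k j : ℝ) + 1)) atTop (𝓝 (Q.real F - 0)) :=
      tendsto_const_nhds.sub (tendsto_one_div_add_atTop_nhds_zero_nat.comp hk.tendsto_atTop)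
    rw [sub_zero] at hl
    refine le_of_tendsto_of_tendsto hl (hlim n) ?_
    filter_upwards [eventually_ge_atTop n] with j hj
    refine (hRlt (k j)).le.trans (integral_mono (hi _ _) (hi _ _) fun x => ?_)
    exact hφanti x (hj.trans (hk.id_le j))
  have h2 : Tendsto (fun n => ∫ x, φ n (firstCoords n x) ∂Q') atTop
      (𝓝 (∫ x, F.indicator 1 x ∂Q')) := by
    refine tendsto_integral_of_dominated_convergence (fun _ => 1)
      (fun n => (hm n).aestronglyMeasurable) (integrable_const _)
      (fun n => Eventually.of_forall fun x => ?_) (Eventually.of_forall fun x => ?_)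
    · rw [Real.norm_eq_abs, abs_of_nonneg (h01 n _).1]; exact (h01 n _).2
    · by_cases hx : x ∈ F
      · simp [hx, hφF _ x hx]
      · simp only [hx, not_false_eq_true, indicator_of_notMem]
        exact tendsto_const_nhds.congr' ((hφlim x hx).mono fun n hn => hn.symm)
  rw [integral_indicator_one hF.measurableSet] at h2
  have h3 := ge_of_tendsto' h2 h1
  exact (ENNReal.toReal_le_toReal (measure_ne_top _ _) (measure_ne_top _ _)).1 h3

/-- A Lipschitz function between the indicators of `A` and of its thickening competes in the infimum
that defines `upCap`, and by (CC) its expectation is a supremum over path laws. -/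
theorem upCap_le_of_pathLaws {m : ℕ} {A : Set (Fin m → ℝ)} {δ : ℝ} (hδ : 0 < δ) {c : ℝ}
    (hc : 0 ≤ c) (h : ∀ Q ∈ S.pathLaws Pfam Y,
      Q {x | firstCoords m x ∈ Metric.thickening δ A} ≤ ENNReal.ofReal c) :
    S.upCap {ω | (fun i : Fin m => Y i ω) ∈ A} ≤ ENNReal.ofReal c := by
  obtain ⟨g, hg, hg01, hgA, hgn⟩ := exists_isCBLip_between A hδ
  have hb := S.comp_mem_Hb (X := fun i : Fin m => Y i) (fun i => hY i) hg
  refine (iInf₂_le (fun ω => g (fun i : Fin m => Y i ω)) ⟨hb.1, ?_⟩).trans ?_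
  · rw [← S.coe_toReal_E hb, EReal.toENNReal_of_ne_top (EReal.coe_ne_top _), EReal.toReal_coe]
    refine ENNReal.ofReal_le_ofReal ?_
    by_contra! hlt
    obtain ⟨Q, hQ, h1⟩ := exists_mem_pathLaws_lt_integral hCC hY hg hlt
    have := isProbabilityMeasure_of_mem_pathLaws hCC hY hQ
    have hT : MeasurableSet {x : ℕ → ℝ | firstCoords m x ∈ Metric.thickening δ A} :=
      measurable_firstCoords m Metric.isOpen_thickening.measurableSet
    have h2 : ∫ x, g (firstCoords m x) ∂Q ≤ c := by
      calc _ ≤ ∫ x, {x : ℕ → ℝ | firstCoords m x ∈ Metric.thickening δ A}.indicator 1 x ∂Q := by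
            refine integral_mono (.of_bound (hg.continuous.measurable.comp
              (measurable_firstCoords m)).aestronglyMeasurable 1 (Eventually.of_forall fun x => ?_))
              ((integrable_const (1 : ℝ)).indicator hT) fun x => ?_
            · rw [Real.norm_eq_abs, abs_of_nonneg (hg01 _).1]
              exact (hg01 _).2
            · by_cases hx : firstCoords m x ∈ Metric.thickening δ A
              · rw [indicator_of_mem (by exact hx)]
                exact (hg01 _).2
              · rw [indicator_of_notMem (by exact hx)]
                exact (hgn _ hx).le
        _ = Q.real _ := integral_indicator_one hT
        _ ≤ c := ENNReal.toReal_le_of_le_ofReal hc (h Q hQ)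
    linarith
  · intro ω
    by_cases hω : ω ∈ {ω | (fun i : Fin m => Y i ω) ∈ A}
    · rw [indicator_of_mem hω]
      exact (hgA _ hω).ge
    · rw [indicator_of_notMem hω]
      exact (hg01 _).1

end capacitability

end SublinearExpectationSpace

/-! ### The order of the three capacities. -/

/-- Markov's inequality for the series, and monotone convergence both in the number of terms and in
the truncation level `k`. The truncation is there because (CC) represents the expectation on bounded
variables only. -/
theorem measure_le_iSup_of_integral_min_le {Ω : Type*} [MeasurableSpace Ω] {P : Measure Ω}
    [IsProbabilityMeasure P] {g : ℕ → Ω → ℝ} (hm : ∀ n, Measurable (g n)) (h0 : ∀ n, 0 ≤ g n)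
    {A : Set Ω} (hA : ∀ ω ∈ A, 1 ≤ ∑' n, ENNReal.ofReal (g n ω)) {c : ℕ → ℝ≥0∞}
    (h : ∀ n k : ℕ, ENNReal.ofReal (∫ ω, min ((∑ i ∈ Finset.range n, g i) ω) k ∂P) ≤ c n) :
    P A ≤ ⨆ n, c n := by
  have hpart : ∀ n : ℕ, ∫⁻ ω, ∑ i ∈ Finset.range n, ENNReal.ofReal (g i ω) ∂P ≤ c n := by
    intro n
    have hn := h n
    set X := ∑ i ∈ Finset.range n, g i with hX
    have hX0 : 0 ≤ X := Finset.sum_nonneg fun i _ => h0 i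
    have hXm : Measurable X := by
      rw [hX]
      fun_prop
    have e1 : ∀ ω, ∑ i ∈ Finset.range n, ENNReal.ofReal (g i ω) = ENNReal.ofReal (X ω) := fun ω => by
      rw [hX, Finset.sum_apply, ENNReal.ofReal_sum_of_nonneg fun i _ => h0 i ω]
    simp only [e1]
    have e2 : ∀ ω, ENNReal.ofReal (X ω) = ⨆ k : ℕ, ENNReal.ofReal (min (X ω) k) := fun ω => by
      refine le_antisymm ?_ (iSup_le fun k => ENNReal.ofReal_le_ofReal (min_le_left _ _))
      obtain ⟨k, hk⟩ := exists_nat_ge (X ω)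
      exact le_iSup_of_le k (by rw [min_eq_left hk])
    simp only [e2]
    rw [lintegral_iSup (fun k => (hXm.min measurable_const).ennreal_ofReal)
      fun a b hab ω => ENNReal.ofReal_le_ofReal (min_le_min le_rfl (by exact_mod_cast hab))]
    refine iSup_le fun k => ?_
    have hmin0 : ∀ ω, 0 ≤ min (X ω) k := fun ω => le_min (hX0 ω) k.cast_nonneg
    rw [← ofReal_integral_eq_lintegral_ofReal (.of_bound
      (hXm.min measurable_const).aestronglyMeasurable k (Eventually.of_forall fun ω => by
        rw [Real.norm_eq_abs, abs_of_nonneg (hmin0 ω)]; exact min_le_right _ _))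
      (Eventually.of_forall hmin0)]
    exact hn k
  calc P A ≤ P {ω | 1 ≤ ∑' n, ENNReal.ofReal (g n ω)} := measure_mono fun ω hω => hA ω hω
    _ ≤ ∫⁻ ω, ∑' n, ENNReal.ofReal (g n ω) ∂P := by
        have := mul_meas_ge_le_lintegral (μ := P)
          (f := fun ω => ∑' n, ENNReal.ofReal (g n ω))
          (Measurable.tsum fun n => (hm n).ennreal_ofReal) 1
        exact (one_mul _).symm.le.trans this
    _ = ∫⁻ ω, ⨆ n, ∑ i ∈ Finset.range n, ENNReal.ofReal (g i ω) ∂P := by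
        simp only [ENNReal.tsum_eq_iSup_nat]
    _ = ⨆ n, ∫⁻ ω, ∑ i ∈ Finset.range n, ENNReal.ofReal (g i ω) ∂P := by
        refine lintegral_iSup (fun n => Finset.measurable_sum _ fun i _ => (hm i).ennreal_ofReal) ?_
        exact fun a b hab ω => Finset.sum_le_sum_of_subset (Finset.range_mono hab)
    _ ≤ _ := iSup_mono hpart

namespace SublinearExpectationSpace

variable {Ω : Type*} [MeasurableSpace Ω] {S : SublinearExpectationSpace Ω}

theorem upCap_empty : S.upCap ∅ = 0 := by
  refine le_antisymm ((iInf₂_le (fun _ => (0 : ℝ)) ⟨S.const_mem 0, by simp⟩).trans ?_) bot_le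
  rw [S.const]
  simp

theorem upCap_univ_le : S.upCap univ ≤ 1 := by
  refine (iInf₂_le (fun _ => (1 : ℝ)) ⟨S.const_mem 1, by simp; rfl⟩).trans ?_
  rw [S.const, EReal.toENNReal_of_ne_top (EReal.coe_ne_top _), EReal.toReal_coe, ENNReal.ofReal_one]

theorem outCap_le_one (A : Set Ω) : S.outCap A ≤ 1 := by
  let B : ℕ → Set Ω := fun n => if n = 0 then univ else ∅
  have hB : ∀ n, MeasurableSet (B n) := fun n => by
    by_cases hn : n = 0 <;> simp [B, hn]
  refine le_trans (iInf₂_le B ⟨hB, fun ω _ => mem_iUnion.2 ⟨0, by simp [B]⟩⟩) ?_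
  rw [tsum_eq_single 0 fun n hn => by simp [B, hn, upCap_empty]]
  simpa [B] using upCap_univ_le

theorem outCap_eq_zero_of_subset {A : Set Ω}
    (h : ∀ ε : ℝ≥0∞, 0 < ε → ∃ B : ℕ → Set Ω, (∀ n, MeasurableSet (B n)) ∧ A ⊆ ⋃ n, B n ∧
      ∑' n, S.upCap (B n) ≤ ε) : S.outCap A = 0 := by
  refine le_antisymm (le_of_forall_pos_le_add fun ε hε => ?_) bot_le
  obtain ⟨B, hB, hA, hs⟩ := h ε hε
  rw [zero_add]
  exact (iInf₂_le B ⟨hB, hA⟩).trans hs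

theorem exists_cover_of_outCap_eq_zero {A : Set Ω} (h : S.outCap A = 0) {ε : ℝ≥0∞} (hε : 0 < ε) :
    ∃ B : ℕ → Set Ω, (∀ n, MeasurableSet (B n)) ∧ A ⊆ ⋃ n, B n ∧ ∑' n, S.upCap (B n) ≤ ε := by
  have h1 : S.outCap A < ε := h ▸ hε
  simp only [outCap, iInf_lt_iff] at h1
  obtain ⟨B, hB, h1⟩ := h1
  exact ⟨B, hB.1, hB.2, h1.le⟩

theorem outCap_iUnion_eq_zero {A : ℕ → Set Ω} (h : ∀ n, S.outCap (A n) = 0) :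
    S.outCap (⋃ n, A n) = 0 := by
  refine outCap_eq_zero_of_subset fun ε hε => ?_
  obtain ⟨e, he, hes⟩ := ENNReal.exists_pos_sum_of_countable' hε.ne' ℕ
  choose B hB hA hs using fun n => exists_cover_of_outCap_eq_zero (h n) (he n)
  refine ⟨fun k => B k.unpair.1 k.unpair.2, fun k => hB _ _, fun ω hω => ?_, ?_⟩
  · obtain ⟨n, hn⟩ := mem_iUnion.1 hω
    obtain ⟨m, hm⟩ := mem_iUnion.1 (hA n hn)
    exact mem_iUnion.2 ⟨Nat.pair n m, by simpa using hm⟩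
  · calc ∑' k : ℕ, S.upCap (B k.unpair.1 k.unpair.2)
        = ∑' p : ℕ × ℕ, S.upCap (B p.1 p.2) :=
          Nat.pairEquiv.symm.tsum_eq fun p : ℕ × ℕ => S.upCap (B p.1 p.2)
      _ = ∑' n, ∑' m, S.upCap (B n m) :=
          ENNReal.tsum_prod (f := fun n m => S.upCap (B n m))
      _ ≤ ∑' n, e n := ENNReal.tsum_le_tsum hs
      _ ≤ ε := hes.le

theorem outCap_mono {A B : Set Ω} (h : A ⊆ B) : S.outCap A ≤ S.outCap B :=
  le_iInf₂ fun C hC => iInf₂_le C ⟨hC.1, h.trans hC.2⟩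

theorem E_sum_toENNReal_le {ξ : ℕ → Ω → ℝ} (hξ : ∀ n, ξ n ∈ S.H) (h0 : ∀ n, 0 ≤ ξ n) (n : ℕ) :
    (S.E (∑ i ∈ Finset.range n, ξ i)).toENNReal ≤
      ∑ i ∈ Finset.range n, (S.E (ξ i)).toENNReal := by
  induction n with
  | zero =>
    have : S.E (0 : Ω → ℝ) = 0 := S.const 0
    simp [this]
  | succ n ih =>
    rw [Finset.sum_range_succ, Finset.sum_range_succ]
    have hm : ∑ i ∈ Finset.range n, ξ i ∈ S.H := S.H.sum_mem fun i _ => hξ i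
    have h1 := S.E_nonneg hm (Finset.sum_nonneg fun i _ => h0 i)
    have h2 := S.E_nonneg (hξ n) (h0 n)
    have hb : ∀ {a : EReal}, 0 ≤ a → a ≠ ⊥ := fun h => ne_bot_of_le_ne_bot EReal.zero_ne_bot h
    refine (EReal.toENNReal_le_toENNReal (S.subadd _ hm _ (hξ n) (fun h => hb h2 h.2)
      fun h => hb h1 h.1)).trans ?_
    rw [EReal.toENNReal_add h1 h2]
    gcongr

/-- Nearly optimal majorants of the sets of a cover form an admissible series for `starCap`. -/
theorem starCap_le_outCap (A : Set Ω) : S.starCap A ≤ S.outCap A := by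
  refine le_iInf₂ fun B hB => ENNReal.le_of_forall_pos_le_add fun ε hε hfin => ?_
  obtain ⟨e, he, hes⟩ := ENNReal.exists_pos_sum_of_countable' (ENNReal.coe_pos.2 hε).ne' ℕ
  have hsel : ∀ n, ∃ ξ ∈ S.H, (B n).indicator 1 ≤ ξ ∧
      (S.E ξ).toENNReal ≤ S.upCap (B n) + e n := fun n => by
    have h1 : S.upCap (B n) < S.upCap (B n) + e n :=
      ENNReal.lt_add_right (ENNReal.ne_top_of_tsum_ne_top hfin.ne n) (he n).ne'
    conv_lhs at h1 => rw [upCap]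
    simp only [iInf_lt_iff] at h1
    obtain ⟨ξ, hξ, h2⟩ := h1
    exact ⟨ξ, hξ.1, hξ.2, h2.le⟩
  choose ξ hξ hBξ hE using hsel
  have h0 : ∀ n, 0 ≤ ξ n := fun n ω =>
    le_trans (indicator_nonneg (fun _ _ => zero_le_one) ω) (hBξ n ω)
  have hcov : ∀ ω ∈ A, 1 ≤ ∑' n, ENNReal.ofReal (ξ n ω) := fun ω hω => by
    obtain ⟨n, hn⟩ := mem_iUnion.1 (hB.2 hω)
    refine le_trans ?_ (ENNReal.le_tsum n)
    have := hBξ n ω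
    rw [indicator_of_mem hn] at this
    exact ENNReal.one_le_ofReal.2 this
  refine (iInf₂_le ξ ⟨fun n => ⟨hξ n, h0 n⟩, hcov⟩).trans (iSup_le fun n => ?_)
  calc _ ≤ ∑ i ∈ Finset.range n, (S.E (ξ i)).toENNReal := E_sum_toENNReal_le hξ h0 n
      _ ≤ ∑ i ∈ Finset.range n, (S.upCap (B i) + e i) := Finset.sum_le_sum fun i _ => hE i
      _ ≤ ∑' i, (S.upCap (B i) + e i) := ENNReal.sum_le_tsum _
      _ = ∑' i, S.upCap (B i) + ∑' i, e i := ENNReal.tsum_add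
      _ ≤ _ := by gcongr

theorem envCap_le_starCap {Pfam : Set (@Measure Ω S.sigmaH)} (hCC : S.CC Pfam) (A : Set Ω) :
    S.envCap Pfam A ≤ S.starCap A := by
  refine iSup₂_le fun P hP => le_iInf₂ fun g hg => ?_
  have hPp := hCC.prob P hP
  refine @measure_le_iSup_of_integral_min_le Ω S.sigmaH P hPp g
    (fun n => S.measurable_sigmaH (hg.1 n).1) (fun n => (hg.1 n).2) A hg.2 _ fun n k => ?_
  set X := ∑ i ∈ Finset.range n, g i with hX
  have hXH : X ∈ S.H := S.H.sum_mem fun i _ => (hg.1 i).1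
  have hX0 : 0 ≤ X := Finset.sum_nonneg fun i _ => (hg.1 i).2
  have hb : (fun ω => min (X ω) k) ∈ S.Hb := by
    have := S.comp_mem_Hb_one hXH (IsCBLip.truncate k)
    have e : (fun ω => max (-(k : ℝ)) (min (X ω) k)) = fun ω => min (X ω) k := by
      funext ω
      refine max_eq_right (le_min ?_ ?_)
      · exact (neg_nonpos.2 k.cast_nonneg).trans (hX0 ω)
      · exact (neg_nonpos.2 k.cast_nonneg).trans k.cast_nonneg
    rwa [e] at this
  have h1 : ((∫ ω, min (X ω) k ∂P : ℝ) : EReal) ≤ S.E X := by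
    refine le_trans ?_ (S.mono _ hXH _ hb.1 fun ω => min_le_left _ _)
    rw [hCC.repr _ hb]
    exact le_iSup₂ (f := fun (P : @Measure Ω S.sigmaH) (_ : P ∈ Pfam) =>
      ((∫ ω, min (X ω) k ∂P : ℝ) : EReal)) P hP
  have h2 := EReal.toENNReal_le_toENNReal h1
  rwa [EReal.toENNReal_of_ne_top (EReal.coe_ne_top _), EReal.toReal_coe] at h2

section choices

variable {Pfam : Set (@Measure Ω S.sigmaH)} (hCC : S.CC Pfam) {V : Set Ω → ℝ≥0∞}
  (hV : V = S.envCap Pfam ∨ V = S.starCap ∨ V = S.outCap)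
include hCC hV

theorem envCap_le_of_mem (A : Set Ω) : S.envCap Pfam A ≤ V A := by
  rcases hV with rfl | rfl | rfl
  · exact le_rfl
  · exact envCap_le_starCap hCC A
  · exact (envCap_le_starCap hCC A).trans (starCap_le_outCap A)

theorem le_outCap_of_mem (A : Set Ω) : V A ≤ S.outCap A := by
  rcases hV with rfl | rfl | rfl
  · exact (envCap_le_starCap hCC A).trans (starCap_le_outCap A)
  · exact starCap_le_outCap A
  · exact le_rfl

end choices

end SublinearExpectationSpace

/-! ### The iterated logarithm and the scale `√(2 t log log t)`. -/

/-- The iterated logarithm, with the convention of `logE`. -/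
noncomputable def llog (x : ℝ) : ℝ := logE (logE x)

/-- The normalization `√(2 t log log t)` for real arguments. -/
noncomputable def lilScale (t : ℝ) : ℝ := Real.sqrt (2 * t * llog t)

theorem lilNorm_eq (n : ℕ) : lilNorm n = lilScale n := rfl

theorem one_le_logE (x : ℝ) : 1 ≤ logE x := by
  rw [logE, Real.le_log_iff_exp_le (lt_max_of_lt_left (Real.exp_pos 1))]
  exact le_max_left _ _

theorem logE_mono : Monotone logE := fun _ _ h =>
  Real.log_le_log (lt_max_of_lt_left (Real.exp_pos 1)) (max_le_max le_rfl h)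

theorem logE_mul_le (x : ℝ) {c : ℝ} (hc : 1 ≤ c) : logE (c * x) ≤ logE x + Real.log c := by
  have h0 : 0 < max (Real.exp 1) x := lt_max_of_lt_left (Real.exp_pos 1)
  rw [logE, logE, add_comm, ← Real.log_mul (by linarith) h0.ne']
  refine Real.log_le_log (lt_max_of_lt_left (Real.exp_pos 1)) (max_le ?_ ?_)
  · nlinarith [le_max_left (Real.exp 1) x]
  · exact mul_le_mul_of_nonneg_left (le_max_right _ _) (by linarith)

theorem logE_add_le (x : ℝ) {b : ℝ} (hb : 0 ≤ b) : logE (x + b) ≤ logE x + b := by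
  have h0 : 0 < max (Real.exp 1) x := lt_max_of_lt_left (Real.exp_pos 1)
  have h1 : (1 : ℝ) ≤ max (Real.exp 1) x := le_max_of_le_left (Real.one_le_exp zero_le_one)
  rw [logE, logE, Real.log_le_iff_le_exp (lt_max_of_lt_left (Real.exp_pos 1)), Real.exp_add,
    Real.exp_log h0]
  have h2 := Real.add_one_le_exp b
  refine max_le ?_ ?_
  · nlinarith [le_max_left (Real.exp 1) x]
  · nlinarith [le_max_right (Real.exp 1) x]

theorem logE_le_max (x : ℝ) : logE x ≤ max 1 x := by
  have h0 : 0 < max (Real.exp 1) x := lt_max_of_lt_left (Real.exp_pos 1)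
  rw [logE, Real.log_le_iff_le_exp h0]
  refine max_le (Real.exp_le_exp.2 (le_max_left _ _)) ?_
  have := Real.add_one_le_exp (max 1 x)
  linarith [le_max_right 1 x]

theorem logE_of_ge {x : ℝ} (hx : Real.exp 1 ≤ x) : logE x = Real.log x := by
  rw [logE, max_eq_right hx]

theorem tendsto_logE : Tendsto logE atTop atTop := by
  refine Real.tendsto_log_atTop.congr' ?_
  filter_upwards [eventually_ge_atTop (Real.exp 1)] with x hx
  rw [logE_of_ge hx]

theorem one_le_llog (x : ℝ) : 1 ≤ llog x := one_le_logE _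

theorem llog_pos (x : ℝ) : 0 < llog x := zero_lt_one.trans_le (one_le_llog x)

theorem llog_mono : Monotone llog := logE_mono.comp logE_mono

theorem tendsto_llog : Tendsto llog atTop atTop := tendsto_logE.comp tendsto_logE

theorem llog_le_max (x : ℝ) : llog x ≤ max 1 x :=
  (logE_le_max _).trans (max_le (le_max_left _ _) (logE_le_max x))

theorem llog_mul_le_add (x : ℝ) {c : ℝ} (hc : 1 ≤ c) : llog (c * x) ≤ llog x + Real.log c :=
  (logE_mono (logE_mul_le x hc)).trans (logE_add_le _ (Real.log_nonneg hc))

theorem llog_mul_le (x : ℝ) {c : ℝ} (hc : 1 ≤ c) : llog (c * x) ≤ c * llog x := by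
  have h1 := llog_mul_le_add x hc
  have h2 := Real.log_le_sub_one_of_pos (show 0 < c by linarith)
  nlinarith [one_le_llog x]

/-- The inner logarithm at most doubles, and the outer one turns the factor two into the summand
`log 2`, which is below one and hence below `llog`. -/
theorem llog_le_two_mul_sqrt {x : ℝ} (hx : 0 ≤ x) : llog x ≤ 2 * llog (Real.sqrt x) := by
  have h1 : logE x ≤ 2 * logE (Real.sqrt x) := by
    have h0 : 0 < max (Real.exp 1) (Real.sqrt x) := lt_max_of_lt_left (Real.exp_pos 1)
    rw [logE, logE, ← Real.log_rpow h0]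
    refine Real.log_le_log (lt_max_of_lt_left (Real.exp_pos 1)) (max_le ?_ ?_)
    · have h2 : Real.exp 1 ≤ Real.exp 1 ^ (2 : ℝ) := by
        have := Real.one_le_exp zero_le_one
        rw [Real.rpow_two]
        nlinarith
      exact h2.trans (Real.rpow_le_rpow (Real.exp_pos 1).le (le_max_left _ _) (by norm_num))
    · calc x = Real.sqrt x ^ (2 : ℝ) := by rw [Real.rpow_two, Real.sq_sqrt hx]
        _ ≤ _ := Real.rpow_le_rpow (Real.sqrt_nonneg _) (le_max_right _ _) (by norm_num)
  calc llog x ≤ logE (2 * logE (Real.sqrt x)) := logE_mono h1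
    _ ≤ logE (logE (Real.sqrt x)) + Real.log 2 := logE_mul_le _ (by norm_num)
    _ ≤ _ := by
      have := Real.log_two_lt_d9
      have := one_le_llog (Real.sqrt x)
      simp only [llog] at *
      linarith

theorem lilScale_nonneg (t : ℝ) : 0 ≤ lilScale t := Real.sqrt_nonneg _

theorem lilScale_mono {s t : ℝ} (hs : 0 ≤ s) (h : s ≤ t) : lilScale s ≤ lilScale t := by
  have := llog_mono h
  have := llog_pos s
  unfold lilScale
  gcongr
  linarith

theorem lilScale_sq {t : ℝ} (ht : 0 ≤ t) : lilScale t ^ 2 = 2 * t * llog t := by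
  have := llog_pos t
  exact Real.sq_sqrt (by positivity)

theorem lilScale_pos {t : ℝ} (ht : 0 < t) : 0 < lilScale t := by
  have := llog_pos t
  exact Real.sqrt_pos.2 (by positivity)

theorem sqrt_mul_lilScale_le {K t : ℝ} (hK : 1 ≤ K) (ht : 0 ≤ t) :
    Real.sqrt K * lilScale t ≤ lilScale (K * t) := by
  have h1 : llog t ≤ llog (K * t) := llog_mono (le_mul_of_one_le_left ht hK)
  have h2 := llog_pos t
  rw [lilScale, lilScale, ← Real.sqrt_mul (by linarith)]
  refine Real.sqrt_le_sqrt ?_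
  calc K * (2 * t * llog t) = 2 * (K * t) * llog t := by ring
    _ ≤ _ := by gcongr

/-- Since `llog ≥ 1`, the hypothesis gives `|x| ≥ √t`, and therefore `llog |x|` is at least half of
`llog t`. Together with `le_sq_div_llog` this translates (M) into tails at the levels `lilScale t`.
-/
theorem sq_div_llog_ge {x t : ℝ} (ht : 0 < t) (h : t ≤ x ^ 2 / llog |x|) :
    lilScale t / 2 ≤ |x| := by
  rw [le_div_iff₀ (llog_pos _)] at h
  have h1 : Real.sqrt t ≤ |x| := by
    refine Real.sqrt_le_iff.2 ⟨abs_nonneg _, ?_⟩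
    rw [sq_abs]
    nlinarith [one_le_llog |x|]
  have h2 : llog t ≤ 2 * llog |x| := (llog_le_two_mul_sqrt ht.le).trans (by
    have := llog_mono h1
    linarith)
  have h3 : (lilScale t / 2) ^ 2 ≤ |x| ^ 2 := by
    rw [div_pow, lilScale_sq ht.le, sq_abs]
    nlinarith
  exact (pow_le_pow_iff_left₀ (by have := lilScale_nonneg t; positivity) (abs_nonneg _) two_ne_zero).1 h3

/-- For `|x| ≤ t` the denominator is at most `llog t`; for `|x| ≥ t` the bound `llog |x| ≤ |x|`
already suffices. -/
theorem le_sq_div_llog {x t δ : ℝ} (ht : 1 ≤ t) (hδ : 0 < δ) (h : δ * lilScale t ≤ |x|) :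
    min (2 * δ ^ 2) 1 * t ≤ x ^ 2 / llog |x| := by
  rw [le_div_iff₀ (llog_pos _)]
  rcases le_total |x| t with hx | hx
  · have h1 : (δ * lilScale t) ^ 2 ≤ |x| ^ 2 :=
      pow_le_pow_left₀ (mul_nonneg hδ.le (lilScale_nonneg t)) h 2
    rw [mul_pow, lilScale_sq (by linarith), sq_abs] at h1
    calc _ ≤ 2 * δ ^ 2 * t * llog t := by
          have := llog_pos |x|
          gcongr
          · exact min_le_left _ _
          · exact llog_mono hx
      _ ≤ x ^ 2 := by linarith
  · have h1 := llog_le_max |x|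
    rw [max_eq_right (by linarith)] at h1
    have := llog_pos |x|
    calc _ ≤ 1 * |x| * |x| := by
          gcongr
          exact min_le_right _ _
      _ = x ^ 2 := by rw [one_mul, abs_mul_abs_self, sq]

/-! ### Series of tails along growing times. -/

/-- The upper envelope of the tail probabilities. -/
noncomputable def tailSup (M : Set (Measure ℝ)) (r : ℝ) : ℝ≥0∞ := ⨆ μ ∈ M, μ {x | r ≤ |x|}

theorem measure_le_tailSup {M : Set (Measure ℝ)} {μ : Measure ℝ} (hμ : μ ∈ M) (r : ℝ) :
    μ {x | r ≤ |x|} ≤ tailSup M r := le_iSup₂ (f := fun (μ : Measure ℝ) (_ : μ ∈ M) => μ {x | r ≤ |x|}) μ hμ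

theorem tailSup_anti (M : Set (Measure ℝ)) : Antitone (tailSup M) := fun _ _ h =>
  iSup₂_mono fun _ _ => measure_mono fun _ hx => le_trans h hx

theorem tailSup_le_one {M : Set (Measure ℝ)} (hM : ∀ μ ∈ M, IsProbabilityMeasure μ) (r : ℝ) :
    tailSup M r ≤ 1 := iSup₂_le fun μ hμ => by
  have := hM μ hμ
  exact prob_le_one

/-- The tail form of the moment condition. -/
def TailIntegrable (M : Set (Measure ℝ)) : Prop :=
  ∀ δ : ℝ, 0 < δ → ∫⁻ t in Ioi (0 : ℝ), tailSup M (δ * lilScale t) < ⊤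

theorem tsum_mul_le_lintegral {u : ℝ → ℝ≥0∞} (hu : AntitoneOn u (Ici 0)) {a : ℕ → ℝ}
    (ha : Monotone a) (h0 : 0 ≤ a 0) :
    ∑' j, ENNReal.ofReal (a (j + 1) - a j) * u (a (j + 1)) ≤ ∫⁻ t in Ioi (0 : ℝ), u t := by
  have hpos : ∀ j, 0 ≤ a j := fun j => h0.trans (ha (Nat.zero_le j))
  calc _ ≤ ∑' j, ∫⁻ t in Ioc (a j) (a (j + 1)), u t := by
        refine ENNReal.tsum_le_tsum fun j => ?_
        have : ∫⁻ _ in Ioc (a j) (a (j + 1)), u (a (j + 1)) ≤ ∫⁻ t in Ioc (a j) (a (j + 1)), u t :=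
          setLIntegral_mono' measurableSet_Ioc fun t ht =>
            hu ((hpos j).trans ht.1.le) (hpos _) ht.2
        rwa [setLIntegral_const, Real.volume_Ioc, mul_comm] at this
    _ = ∫⁻ t in ⋃ j, Ioc (a j) (a (j + 1)), u t :=
        (lintegral_iUnion (fun _ => measurableSet_Ioc) ha.pairwise_disjoint_on_Ioc_succ _).symm
    _ ≤ _ := lintegral_mono_set (iUnion_subset fun j t ht => (hpos j).trans_lt ht.1)

/-- Geometric growth makes `a (j + 1)` at most `ρ / (ρ - 1)` times the gap `a (j + 1) - a j`, so up
to finitely many terms the series is a lower Riemann sum. -/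
theorem tsum_mul_lt_top_of_growth {u : ℝ → ℝ≥0∞} (hu : AntitoneOn u (Ici 0))
    (hfin : ∀ t, u t ≠ ⊤)
    (hint : ∫⁻ t in Ioi (0 : ℝ), u t < ⊤) {a : ℕ → ℝ} (h0 : ∀ j, 0 ≤ a j) {ρ : ℝ} (hρ : 1 < ρ)
    (ha : ∀ᶠ j in atTop, ρ * a j ≤ a (j + 1)) : ∑' j, ENNReal.ofReal (a j) * u (a j) < ⊤ := by
  obtain ⟨N, hN⟩ := eventually_atTop.1 ha
  have hmono : Monotone fun j => a (N + j) := monotone_nat_of_le_succ fun j => by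
    have := hN (N + j) (by omega)
    have := h0 (N + j)
    rw [← add_assoc]
    nlinarith
  have h1 := tsum_mul_le_lintegral hu hmono (h0 _)
  have h2 : ∑' j, ENNReal.ofReal (a (j + (N + 1))) * u (a (j + (N + 1))) < ⊤ := by
    refine lt_of_le_of_lt ?_ (ENNReal.mul_lt_top (ENNReal.ofReal_lt_top (r := ρ / (ρ - 1)))
      (h1.trans_lt hint))
    rw [← ENNReal.tsum_mul_left]
    refine ENNReal.tsum_le_tsum fun j => ?_
    rw [← mul_assoc, ← ENNReal.ofReal_mul (div_nonneg (by linarith) (by linarith)),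
      show j + (N + 1) = N + (j + 1) by ring]
    gcongr
    have h3 := hN (N + j) (by omega)
    have hρ' : 0 < ρ - 1 := by linarith
    rw [← add_assoc, div_mul_eq_mul_div, le_div_iff₀ hρ']
    nlinarith
  have h4 := Summable.sum_add_tsum_nat_add' (f := fun j => ENNReal.ofReal (a j) * u (a j))
    (k := N + 1) ENNReal.summable
  rw [← h4]
  refine ENNReal.add_lt_top.2 ⟨ENNReal.sum_lt_top.2 fun j _ => ?_, h2⟩
  exact ENNReal.mul_lt_top ENNReal.ofReal_lt_top (hfin _).lt_top

theorem tailSup_lilScale_antitoneOn (M : Set (Measure ℝ)) {δ : ℝ} (hδ : 0 < δ) :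
    AntitoneOn (fun t => tailSup M (δ * lilScale t)) (Ici 0) := fun _ hs _ _ h =>
  tailSup_anti M (mul_le_mul_of_nonneg_left (lilScale_mono hs h) hδ.le)

section consequences

variable {M : Set (Measure ℝ)} (hM : ∀ μ ∈ M, IsProbabilityMeasure μ) (hT : TailIntegrable M)
include hT

theorem TailIntegrable.tsum_lilNorm_lt_top {δ : ℝ} (hδ : 0 < δ) :
    ∑' n : ℕ, tailSup M (δ * lilNorm (n + 1)) < ⊤ := by
  refine lt_of_le_of_lt ?_ (hT δ hδ)
  refine le_trans ?_ (tsum_mul_le_lintegral (tailSup_lilScale_antitoneOn M hδ)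
    (a := fun n : ℕ => (n : ℝ)) Nat.mono_cast (by simp))
  refine ENNReal.tsum_le_tsum fun n => ?_
  simp [lilNorm_eq]

include hM

theorem TailIntegrable.tsum_scale_lt_top {δ : ℝ} (hδ : 0 < δ) {m : ℕ → ℕ} {ρ : ℝ} (hρ : 1 < ρ)
    (hm : ∀ᶠ j in atTop, ρ * m j ≤ m (j + 1)) :
    ∑' j, (m j : ℝ≥0∞) * tailSup M (δ * lilNorm (m j)) < ⊤ := by
  have := tsum_mul_lt_top_of_growth (tailSup_lilScale_antitoneOn M hδ)
    (fun t => ((tailSup_le_one hM _).trans_lt ENNReal.one_lt_top).ne) (hT δ hδ)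
    (a := fun j => (m j : ℝ)) (fun j => Nat.cast_nonneg _) hρ hm
  simpa [lilNorm_eq] using this

/-- At the time `t = m / llog m ^ 2` one has `lilScale t ≤ 2 * √(m / llog m)`, so this is again a
Riemann sum of the tail integral. It is the reason why terms of this shape may be left over in the
estimates for blocks, both above and below. -/
theorem TailIntegrable.tsum_sqrt_scale_lt_top {η : ℝ} (hη : 0 < η) {m : ℕ → ℕ} {ρ : ℝ} (hρ : 1 < ρ)
    (hm : ∀ᶠ j in atTop, ρ * m j ≤ m (j + 1)) (hlim : Tendsto m atTop atTop) :
    ∑' j, ENNReal.ofReal (m j / llog (m j) ^ 2) *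
      tailSup M (η * Real.sqrt (m j / llog (m j))) < ⊤ := by
  have hη' : 0 < η / 2 := by positivity
  have hρ0 : 0 < ρ := by linarith
  refine lt_of_le_of_lt (ENNReal.tsum_le_tsum fun j => ?_)
    (tsum_mul_lt_top_of_growth (tailSup_lilScale_antitoneOn M hη')
    (fun t => ((tailSup_le_one hM _).trans_lt ENNReal.one_lt_top).ne) (hT _ hη')
    (a := fun j => (m j : ℝ) / llog (m j) ^ 2) (fun j => by positivity) (ρ := Real.sqrt ρ)
      (by rw [Real.lt_sqrt] <;> linarith) ?_)
  · refine mul_le_mul_right (tailSup_anti M ?_) _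
    have hl := llog_pos (m j)
    have hl1 := one_le_llog (m j)
    have h1 : llog (m j / llog (m j) ^ 2) ≤ llog (m j) :=
      llog_mono (div_le_self (Nat.cast_nonneg _) (one_le_pow₀ hl1))
    have h2 : lilScale (m j / llog (m j) ^ 2) ≤ 2 * Real.sqrt (m j / llog (m j)) := by
      rw [lilScale, show (2 : ℝ) = Real.sqrt 4 by
        rw [show (4 : ℝ) = 2 ^ 2 by norm_num]; simp, ← Real.sqrt_mul (by norm_num)]
      refine Real.sqrt_le_sqrt ?_
      rw [show Real.sqrt 4 = 2 by rw [show (4 : ℝ) = 2 ^ 2 by norm_num]; simp]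
      calc 2 * (m j / llog (m j) ^ 2) * llog (m j / llog (m j) ^ 2)
          ≤ 2 * (m j / llog (m j) ^ 2) * llog (m j) := by gcongr
        _ = 2 * (m j / llog (m j)) := by field_simp
        _ ≤ 4 * (m j / llog (m j)) := by gcongr; norm_num
    calc _ ≤ η / 2 * (2 * Real.sqrt (m j / llog (m j))) := by gcongr
      _ = _ := by ring
  · have h4 : ∀ᶠ j in atTop, 4 ≤ llog (m j) :=
      (tendsto_llog.comp (tendsto_natCast_atTop_atTop.comp hlim)).eventually_ge_atTop 4
    filter_upwards [hm, h4, hlim.eventually_gt_atTop 0] with j hj h4 hpos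
    have hmj : (0 : ℝ) < m j := by exact_mod_cast hpos
    set c : ℝ := m (j + 1) / m j with hc
    have hcρ : ρ ≤ c := (le_div_iff₀ hmj).2 hj
    have hc1 : 1 ≤ c := by linarith
    have hc0 : 0 < c := by linarith
    have hcm : (m (j + 1) : ℝ) = c * m j := by rw [hc]; field_simp
    -- Slow variation: once `llog (m j) ≥ 4`, the summand `log c` is absorbed by a factor `c ^ (1 /
    -- 4)`. Its square costs `√c`, and the times `m / llog m ^ 2` still grow at least by the factor
    -- `√ρ`.
    have h5 : llog (m (j + 1)) ≤ c ^ (1 / 4 : ℝ) * llog (m j) := by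
      rw [hcm]
      refine (llog_mul_le_add _ hc1).trans ?_
      have h6 : 1 + Real.log c / 4 ≤ c ^ (1 / 4 : ℝ) := by
        rw [Real.rpow_def_of_pos hc0]
        have := Real.add_one_le_exp (Real.log c * (1 / 4))
        linarith
      have h7 := Real.log_nonneg hc1
      nlinarith
    have h8 : llog (m (j + 1)) ^ 2 ≤ Real.sqrt c * llog (m j) ^ 2 := by
      refine (pow_le_pow_left₀ (llog_pos _).le h5 2).trans_eq ?_
      rw [mul_pow, ← Real.rpow_natCast, ← Real.rpow_mul hc0.le, Real.sqrt_eq_rpow]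
      norm_num
    have hl := llog_pos (m j)
    have hl' := llog_pos (m (j + 1))
    have hsc : 0 < Real.sqrt c := Real.sqrt_pos.2 hc0
    calc Real.sqrt ρ * (m j / llog (m j) ^ 2) ≤ Real.sqrt c * (m j / llog (m j) ^ 2) := by gcongr
      _ = c * m j / (Real.sqrt c * llog (m j) ^ 2) := by
          field_simp
          rw [Real.sq_sqrt hc0.le]
      _ ≤ m (j + 1) / llog (m (j + 1)) ^ 2 := by
          rw [hcm] at h8 ⊢
          gcongr
          rw [← hcm]
          positivity

omit hM hT in
theorem lintegral_sq_div_llog_le {μ : Measure ℝ} (hμ : μ ∈ M) :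
    ∫⁻ x, ENNReal.ofReal (x ^ 2 / llog |x|) ∂μ ≤
      ∫⁻ t in Ioi (0 : ℝ), tailSup M (1 / 2 * lilScale t) := by
  have hm : Measurable fun x : ℝ => x ^ 2 / llog |x| := by
    have : Measurable llog := llog_mono.measurable
    fun_prop
  rw [lintegral_eq_lintegral_meas_le μ (Eventually.of_forall fun x =>
    div_nonneg (sq_nonneg x) (llog_pos _).le) hm.aemeasurable]
  refine setLIntegral_mono' measurableSet_Ioi fun t ht => ?_
  refine (measure_mono fun x hx => ?_).trans (measure_le_tailSup hμ _)
  have := sq_div_llog_ge ht hx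
  show 1 / 2 * lilScale t ≤ |x|
  linarith

end consequences

/-! ### Truncation and the exponential maximal inequality. -/

/-- Truncation of a real number to `[-y, y]`. -/
noncomputable def clip (y x : ℝ) : ℝ := max (-y) (min x y)

theorem abs_clip_le {y : ℝ} (hy : 0 ≤ y) (x : ℝ) : |clip y x| ≤ y :=
  abs_le.2 ⟨le_max_left _ _, max_le (by linarith) (min_le_right _ _)⟩

theorem clip_of_abs_le {x y : ℝ} (h : |x| ≤ y) : clip y x = x := by
  rw [abs_le] at h
  rw [clip, min_eq_left h.2, max_eq_right h.1]

theorem abs_clip_le_abs {y : ℝ} (hy : 0 ≤ y) (x : ℝ) : |clip y x| ≤ |x| := by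
  rcases le_total |x| y with h | h
  · rw [clip_of_abs_le h]
  · exact (abs_clip_le hy x).trans h

theorem abs_sub_clip_le {y : ℝ} (hy : 0 ≤ y) (x : ℝ) : |x - clip y x| ≤ |x| := by
  unfold clip
  rcases le_total x y with h | h
  · rw [min_eq_left h]
    rcases le_total (-y) x with h' | h'
    · simp [max_eq_right h']
    · rw [max_eq_left h', abs_le]
      constructor <;> cases abs_cases x <;> linarith
  · rw [min_eq_right h, max_eq_right (by linarith), abs_le]
    constructor <;> cases abs_cases x <;> linarith

theorem isCBLip_clip (y : ℝ) : IsCBLip (clip y) := IsCBLip.truncate y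

@[fun_prop]
theorem measurable_clip (y : ℝ) : Measurable (clip y) := (isCBLip_clip y).continuous.measurable

theorem exp_le_quadratic (u : ℝ) : Real.exp u ≤ 1 + u + u ^ 2 / 2 * Real.exp |u| := by
  rcases le_total 0 u with hu | hu
  · rw [abs_of_nonneg hu]
    have hmono : MonotoneOn (fun v : ℝ => 1 + v + v ^ 2 / 2 * Real.exp v - Real.exp v) (Ici 0) := by
      refine monotoneOn_of_deriv_nonneg (convex_Ici 0) (by fun_prop) (by fun_prop) fun v hv => ?_
      rw [interior_Ici] at hv
      have hd : HasDerivAt (fun v : ℝ => 1 + v + v ^ 2 / 2 * Real.exp v - Real.exp v)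
          (1 + (v * Real.exp v + v ^ 2 / 2 * Real.exp v) - Real.exp v) v := by
        have h1 : HasDerivAt (fun v : ℝ => v ^ 2 / 2) v v := by
          simpa using (hasDerivAt_pow 2 v).div_const 2
        exact ((hasDerivAt_id v).const_add 1 |>.add (h1.mul (Real.hasDerivAt_exp v))).sub
          (Real.hasDerivAt_exp v)
      rw [hd.deriv]
      have h1 := Real.add_one_le_exp (-v)
      have h2 : Real.exp (-v) * Real.exp v = 1 := by rw [← Real.exp_add]; simp
      have h3 := Real.exp_pos v
      have hv' : 0 < v := hv
      nlinarith [mul_le_mul_of_nonneg_right h1 h3.le, mul_pos (pow_pos hv' 2) h3]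
    have := hmono (mem_Ici.2 le_rfl) (mem_Ici.2 hu) hu
    simp at this
    linarith
  · have hanti : Antitone fun v : ℝ => 1 + v + v ^ 2 / 2 - Real.exp v := by
      refine antitone_of_deriv_nonpos (by fun_prop) fun v => ?_
      have hd : HasDerivAt (fun v : ℝ => 1 + v + v ^ 2 / 2 - Real.exp v)
          (1 + v - Real.exp v) v := by
        have h1 : HasDerivAt (fun v : ℝ => v ^ 2 / 2) v v := by
          simpa using (hasDerivAt_pow 2 v).div_const 2
        exact ((hasDerivAt_id v).const_add 1 |>.add h1).sub (Real.hasDerivAt_exp v)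
      rw [hd.deriv]
      have := Real.add_one_le_exp v
      linarith
    have h1 := hanti hu
    simp only [] at h1
    norm_num at h1
    have h2 := Real.one_le_exp (abs_nonneg u)
    nlinarith [sq_nonneg u]

/-- Truncation keeps the exponent in a bounded range, where the exponential is Lipschitz; this makes
it an admissible test function in `CondDominated`. -/
theorem isCBLip_exp_clip {r y : ℝ} (hr : 0 ≤ r) (hy : 0 ≤ y) :
    IsCBLip (fun x => Real.exp (r * clip y x)) := by
  have hle : ∀ x, r * clip y x ≤ r * y := fun x =>
    mul_le_mul_of_nonneg_left (abs_le.1 (abs_clip_le hy x)).2 hr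
  have key : ∀ a b : ℝ, a ≤ r * y → Real.exp a - Real.exp b ≤ Real.exp (r * y) * |a - b| := by
    intro a b ha
    have h1 := Real.add_one_le_exp (b - a)
    have h2 : Real.exp (b - a) * Real.exp a = Real.exp b := by rw [← Real.exp_add]; congr 1; ring
    have h3 := Real.exp_le_exp.2 ha
    have h4 := Real.exp_pos a
    have h5 := le_abs_self (a - b)
    calc Real.exp a - Real.exp b ≤ Real.exp a * (a - b) := by nlinarith
      _ ≤ Real.exp a * |a - b| := by gcongr
      _ ≤ _ := by gcongr
  obtain ⟨C, _, hC, -, hL, -⟩ := (isCBLip_clip y).exists_bounds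
  refine IsCBLip.of_bounds (C := Real.exp (r * y) * (r * C)) (M := Real.exp (r * y))
    (fun x z => ?_) fun x => ?_
  · have h1 : |r * clip y x - r * clip y z| ≤ r * C * ‖x - z‖ := by
      rw [← mul_sub, abs_mul, abs_of_nonneg hr, mul_assoc]
      gcongr
      exact hL x z
    have h2 : |Real.exp (r * clip y x) - Real.exp (r * clip y z)| ≤
        Real.exp (r * y) * |r * clip y x - r * clip y z| := by
      rw [abs_sub_le_iff]
      refine ⟨key _ _ (hle x), ?_⟩
      rw [abs_sub_comm]
      exact key _ _ (hle z)
    calc _ ≤ _ := h2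
      _ ≤ Real.exp (r * y) * (r * C * ‖x - z‖) := by gcongr
      _ = _ := by ring
  · rw [abs_of_pos (Real.exp_pos _)]
    exact Real.exp_le_exp.2 (hle x)

/-- A Lipschitz approximation of the indicator of `{x | t ≤ |x|}`. -/
noncomputable def tailFun (t x : ℝ) : ℝ := max 0 (min (2 / t * |x| - 1) 1)

theorem tailFun_nonneg (t x : ℝ) : 0 ≤ tailFun t x := le_max_left _ _

section CondDominated

variable {M : Set (Measure ℝ)} {Q : Measure (ℕ → ℝ)} (hQ : CondDominated M Q)
include hQ

theorem CondDominated.lintegral_le {k : ℕ} {ψ : (ℕ → ℝ) → ℝ≥0∞} (hψ : Measurable ψ)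
    (hψk : ∀ x x' : ℕ → ℝ, (∀ i < k, x i = x' i) → ψ x = ψ x') {φ : ℝ → ℝ} (hφ : IsCBLip φ)
    (h0 : 0 ≤ φ) {c : ℝ≥0} (hc : ∀ μ ∈ M, ∫⁻ x, ENNReal.ofReal (φ x) ∂μ ≤ c) :
    ∫⁻ x, ψ x * ENNReal.ofReal (φ (x k)) ∂Q ≤ c * ∫⁻ x, ψ x ∂Q := by
  let e : (Fin k → ℝ) → ℕ → ℝ := fun y i => if h : i < k then y ⟨i, h⟩ else 0
  have he : Measurable e := measurable_pi_lambda _ fun i => by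
    by_cases h : i < k
    · simp only [e, h, dite_true]; fun_prop
    · simp only [e, h, dite_false]; fun_prop
  have hr : ∀ x, ψ (e (firstCoords k x)) = ψ x := fun x =>
    hψk _ _ fun i hi => by simp [e, hi, firstCoords]
  have := hQ k (fun y => ψ (e y)) φ c (hψ.comp he) hφ h0 hc
  simpa only [hr] using this

/-- The process `W` counts one after the first passage above `z`, and is `exp (r (S_n - z))` before
it. At the passage the exponential is at least one, so a single step multiplies the integral of `W`
by at most `c`; it starts from at most `exp (-r z)`. -/
theorem CondDominated.maximal_ineq {r y : ℝ} (hr : 0 ≤ r) (hy : 0 ≤ y) {c : ℝ≥0} (hc1 : 1 ≤ c)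
    (hc : ∀ μ ∈ M, ∫⁻ x, ENNReal.ofReal (Real.exp (r * clip y x)) ∂μ ≤ c)
    [IsProbabilityMeasure Q] (z : ℝ) (m : ℕ) :
    Q {x | ∃ n ≤ m, z ≤ ∑ i ∈ Finset.range n, clip y (x i)} ≤
      c ^ m * ENNReal.ofReal (Real.exp (-(r * z))) := by
  let Sn : ℕ → (ℕ → ℝ) → ℝ := fun n x => ∑ i ∈ Finset.range n, clip y (x i)
  let hit : ℕ → Set (ℕ → ℝ) := fun m => {x | ∃ n ≤ m, z ≤ Sn n x}
  have hSm : ∀ n, Measurable (Sn n) := fun n => by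
    simp only [Sn]
    exact Finset.measurable_sum _ fun i _ => (measurable_clip y).comp (measurable_pi_apply i)
  have hhit : ∀ m, MeasurableSet (hit m) := fun m => by
    have : hit m = ⋃ n ∈ Iic m, {x | z ≤ Sn n x} := by
      ext x; simp [hit]
    rw [this]
    exact MeasurableSet.biUnion (to_countable _) fun n _ =>
      measurableSet_le measurable_const (hSm n)
  have hSn_congr : ∀ {n k : ℕ}, n ≤ k → ∀ x x' : ℕ → ℝ, (∀ i < k, x i = x' i) →
      Sn n x = Sn n x' := fun {n k} hnk x x' h =>
    Finset.sum_congr rfl fun i hi => by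
      rw [h i ((Finset.mem_range.1 hi).trans_le hnk)]
  have hhit_congr : ∀ k (x x' : ℕ → ℝ), (∀ i < k, x i = x' i) → (x ∈ hit k ↔ x' ∈ hit k) :=
    fun k x x' h => exists_congr fun n => and_congr_right fun hn => by
      rw [hSn_congr hn x x' h]
  let G : ℕ → (ℕ → ℝ) → ℝ≥0∞ := fun n =>
    (hit n)ᶜ.indicator fun x => ENNReal.ofReal (Real.exp (r * (Sn n x - z)))
  have hGm : ∀ n, Measurable (G n) := fun n =>
    (((((hSm n).sub_const z).const_mul r).exp).ennreal_ofReal).indicator (hhit n).compl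
  have hG_congr : ∀ k (x x' : ℕ → ℝ), (∀ i < k, x i = x' i) → G k x = G k x' := by
    intro k x x' h
    simp only [G, indicator, mem_compl_iff, hhit_congr k x x' h, hSn_congr le_rfl x x' h]
  let W : ℕ → (ℕ → ℝ) → ℝ≥0∞ := fun n x => (hit n).indicator 1 x + G n x
  have hWint : ∀ n, ∫⁻ x, W n x ∂Q = Q (hit n) + ∫⁻ x, G n x ∂Q := fun n => by
    simp only [W]
    rw [lintegral_add_right _ (hGm n), lintegral_indicator_one (hhit n)]
  have hstep : ∀ n, ∫⁻ x, W (n + 1) x ∂Q ≤ c * ∫⁻ x, W n x ∂Q := by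
    intro n
    have hpt : ∀ x, W (n + 1) x ≤ (hit n).indicator 1 x +
        G n x * ENNReal.ofReal (Real.exp (r * clip y (x n))) := by
      intro x
      by_cases hx : x ∈ hit n
      · have hx' : x ∈ hit (n + 1) := by
          obtain ⟨k, hk, h⟩ := hx
          exact ⟨k, by omega, h⟩
        simp [W, G, hx, hx']
      · have h1 : G n x * ENNReal.ofReal (Real.exp (r * clip y (x n))) =
            ENNReal.ofReal (Real.exp (r * (Sn (n + 1) x - z))) := by
          simp only [G, indicator_of_mem (show x ∈ (hit n)ᶜ from hx)]
          rw [← ENNReal.ofReal_mul (Real.exp_pos _).le, ← Real.exp_add]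
          simp only [Sn, Finset.sum_range_succ]
          ring_nf
        rw [h1]
        by_cases hx' : x ∈ hit (n + 1)
        · obtain ⟨k, hk, h⟩ := hx'
          have hkn : k = n + 1 := by
            by_contra hne
            exact hx ⟨k, by omega, h⟩
          subst hkn
          have : x ∈ hit (n + 1) := ⟨n + 1, le_rfl, h⟩
          simp only [W, G, indicator_of_mem this, indicator_of_notMem hx,
            indicator_of_notMem (show x ∉ (hit (n + 1))ᶜ from fun hh => hh this), add_zero, zero_add,
            Pi.one_apply]
          rw [ENNReal.one_le_ofReal]
          exact Real.one_le_exp (mul_nonneg hr (by linarith))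
        · simp only [W, G, indicator_of_notMem hx, indicator_of_notMem hx', zero_add,
            indicator_of_mem (show x ∈ (hit (n + 1))ᶜ from hx')]
          exact le_rfl
    calc ∫⁻ x, W (n + 1) x ∂Q ≤ ∫⁻ x, ((hit n).indicator 1 x +
          G n x * ENNReal.ofReal (Real.exp (r * clip y (x n)))) ∂Q := lintegral_mono hpt
      _ = Q (hit n) + ∫⁻ x, G n x * ENNReal.ofReal (Real.exp (r * clip y (x n))) ∂Q := by
          rw [lintegral_add_left (measurable_one.indicator (hhit n)),
            lintegral_indicator_one (hhit n)]
      _ ≤ c * Q (hit n) + c * ∫⁻ x, G n x ∂Q := by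
          gcongr
          · exact le_mul_of_one_le_left bot_le (by exact_mod_cast hc1)
          · exact hQ.lintegral_le (hGm n) (hG_congr n) (isCBLip_exp_clip hr hy)
              (fun x => (Real.exp_pos _).le) hc
      _ = _ := by rw [hWint, mul_add]
  have hall : ∀ n, ∫⁻ x, W n x ∂Q ≤ c ^ n * ENNReal.ofReal (Real.exp (-(r * z))) := by
    intro n
    induction n with
    | zero =>
      have hpt : ∀ x, W 0 x ≤ ENNReal.ofReal (Real.exp (-(r * z))) := by
        intro x
        have hS0 : Sn 0 x = 0 := by simp [Sn]
        by_cases hx : x ∈ hit 0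
        · obtain ⟨k, hk, h⟩ := id hx
          obtain rfl : k = 0 := by omega
          rw [hS0] at h
          simp only [W, G, indicator_of_mem hx,
            indicator_of_notMem (show x ∉ (hit 0)ᶜ from fun hh => hh hx), add_zero, Pi.one_apply]
          rw [ENNReal.one_le_ofReal]
          exact Real.one_le_exp (by nlinarith)
        · simp only [W, G, indicator_of_notMem hx, zero_add,
            indicator_of_mem (show x ∈ (hit 0)ᶜ from hx), hS0]
          refine le_of_eq ?_
          congr 2
          ring
      calc _ ≤ ∫⁻ _, ENNReal.ofReal (Real.exp (-(r * z))) ∂Q := lintegral_mono hpt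
        _ = _ := by simp
    | succ n ih =>
      refine (hstep n).trans ?_
      rw [pow_succ', mul_assoc]
      gcongr
  calc Q (hit m) ≤ ∫⁻ x, W m x ∂Q := by rw [hWint]; exact le_self_add
    _ ≤ _ := hall m

omit hQ in
theorem isCBLip_tailFun {t : ℝ} (ht : 0 < t) : IsCBLip (tailFun t) := by
  unfold tailFun
  refine IsCBLip.of_bounds (C := 2 / t) (M := 1) (fun x y => ?_) fun x => ?_
  · refine (abs_max_sub_max_le_max _ _ _ _).trans ?_
    rw [sub_self, abs_zero, max_eq_right (abs_nonneg _)]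
    refine (abs_min_sub_min_le_max _ _ _ _).trans ?_
    rw [sub_self, abs_zero, max_eq_left (abs_nonneg _), sub_sub_sub_cancel_right, ← mul_sub,
      abs_mul, abs_of_pos (by positivity)]
    gcongr
    exact abs_abs_sub_abs_le_abs_sub x y
  · rw [abs_of_nonneg (le_max_left _ _)]
    exact max_le zero_le_one (min_le_right _ _)

end CondDominated

theorem le_tailFun {t : ℝ} (ht : 0 < t) (x : ℝ) :
    {x : ℝ | t ≤ |x|}.indicator 1 x ≤ ENNReal.ofReal (tailFun t x) := by
  by_cases hx : t ≤ |x|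
  · rw [indicator_of_mem (by exact hx)]
    have : 2 ≤ 2 / t * |x| := by
      rw [div_mul_eq_mul_div, le_div_iff₀ ht]
      linarith
    rw [tailFun, min_eq_right (by linarith), max_eq_right zero_le_one]
    simp
  · rw [indicator_of_notMem (by exact hx)]
    exact bot_le

theorem tailFun_le {t : ℝ} (ht : 0 < t) (x : ℝ) :
    ENNReal.ofReal (tailFun t x) ≤ {x : ℝ | t / 2 ≤ |x|}.indicator 1 x := by
  by_cases hx : t / 2 ≤ |x|
  · rw [indicator_of_mem (by exact hx), Pi.one_apply, ENNReal.ofReal_le_one]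
    exact max_le zero_le_one (min_le_right _ _)
  · have : 2 / t * |x| - 1 ≤ 0 := by
      rw [sub_nonpos, div_mul_eq_mul_div, div_le_one ht]
      linarith
    rw [tailFun, max_eq_left ((min_le_left _ _).trans this)]
    simp

theorem measurableSet_abs_ge (t : ℝ) : MeasurableSet {x : ℝ | t ≤ |x|} :=
  measurableSet_le measurable_const measurable_id.abs

section CondDominated

variable {M : Set (Measure ℝ)} (hM : ∀ μ ∈ M, IsProbabilityMeasure μ)
  {Q : Measure (ℕ → ℝ)} [IsProbabilityMeasure Q] (hQ : CondDominated M Q)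
include hM

/-- Halving the level is the price for a Lipschitz function in place of the indicator. (M) does not
see constant factors in the level. -/
theorem lintegral_tailFun_le {μ : Measure ℝ} (hμ : μ ∈ M) {t : ℝ} (ht : 0 < t) :
    ∫⁻ x, ENNReal.ofReal (tailFun t x) ∂μ ≤
      ((tailSup M (t / 2)).toNNReal : ℝ≥0∞) := by
  rw [ENNReal.coe_toNNReal ((tailSup_le_one hM _).trans_lt ENNReal.one_lt_top).ne]
  refine (lintegral_mono (tailFun_le ht)).trans ?_
  rw [lintegral_indicator_one (measurableSet_abs_ge _)]
  exact measure_le_tailSup hμ _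

include hQ

omit [IsProbabilityMeasure Q] in
theorem CondDominated.lintegral_indicator_tail_le {k : ℕ} {ψ : (ℕ → ℝ) → ℝ≥0∞} (hψ : Measurable ψ)
    (hψk : ∀ x x' : ℕ → ℝ, (∀ i < k, x i = x' i) → ψ x = ψ x') {t : ℝ} (ht : 0 < t) :
    ∫⁻ x, ψ x * {x : ℝ | t ≤ |x|}.indicator 1 (x k) ∂Q ≤
      tailSup M (t / 2) * ∫⁻ x, ψ x ∂Q := by
  have h1 := hQ.lintegral_le hψ hψk (isCBLip_tailFun ht)
    (tailFun_nonneg t)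
    fun μ hμ => lintegral_tailFun_le hM hμ ht
  rw [ENNReal.coe_toNNReal ((tailSup_le_one hM _).trans_lt ENNReal.one_lt_top).ne] at h1
  refine le_trans (lintegral_mono fun x => ?_) h1
  have := le_tailFun ht (x k)
  gcongr

theorem CondDominated.measure_tail_le (k : ℕ) {t : ℝ} (ht : 0 < t) :
    Q {x | t ≤ |x k|} ≤ tailSup M (t / 2) := by
  have h1 := hQ.lintegral_indicator_tail_le hM (k := k) (ψ := fun _ => 1) measurable_const
    (fun _ _ _ => rfl) ht
  have h2 : MeasurableSet {x : ℕ → ℝ | t ≤ |x k|} :=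
    measurableSet_le measurable_const (by fun_prop)
  calc Q {x | t ≤ |x k|} = ∫⁻ x, {x : ℕ → ℝ | t ≤ |x k|}.indicator 1 x ∂Q :=
        (lintegral_indicator_one h2).symm
    _ = ∫⁻ x, 1 * {x : ℝ | t ≤ |x|}.indicator 1 (x k) ∂Q := by
        simp only [one_mul]
        rfl
    _ ≤ _ := by simpa using h1

/-- The earlier exceedance is part of the past of `x k`, so conditional domination produces one
factor for each of the two. -/
theorem CondDominated.measure_two_tails_le {i k : ℕ} (hik : i < k) {t : ℝ} (ht : 0 < t) :
    Q {x | t ≤ |x i| ∧ t ≤ |x k|} ≤ tailSup M (t / 2) ^ 2 := by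
  have hm : ∀ j, MeasurableSet {x : ℕ → ℝ | t ≤ |x j|} := fun j =>
    measurableSet_le measurable_const (by fun_prop)
  have h1 := hQ.lintegral_indicator_tail_le hM (k := k)
    (ψ := {x : ℕ → ℝ | t ≤ |x i|}.indicator 1) (measurable_one.indicator (hm i))
    (fun x x' h => by simp only [indicator, mem_ofPred_eq, h i hik, Pi.one_apply]) ht
  rw [lintegral_indicator_one (hm i)] at h1
  calc Q {x | t ≤ |x i| ∧ t ≤ |x k|}
      = ∫⁻ x, ({x : ℕ → ℝ | t ≤ |x i|} ∩ {x : ℕ → ℝ | t ≤ |x k|}).indicator 1 x ∂Q :=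
        (lintegral_indicator_one ((hm i).inter (hm k))).symm
    _ = ∫⁻ x, {x : ℕ → ℝ | t ≤ |x i|}.indicator 1 x *
          {x : ℝ | t ≤ |x|}.indicator 1 (x k) ∂Q := by
        refine lintegral_congr fun x => ?_
        rw [inter_indicator_one]
        rfl
    _ ≤ _ := h1
    _ ≤ tailSup M (t / 2) * tailSup M (t / 2) := by gcongr; exact hQ.measure_tail_le hM i ht
    _ = _ := (sq _).symm

theorem CondDominated.measure_exists_tail_le (m : ℕ) {t : ℝ} (ht : 0 < t) :
    Q {x | ∃ i < m, t ≤ |x i|} ≤ m * tailSup M (t / 2) := by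
  have : {x : ℕ → ℝ | ∃ i < m, t ≤ |x i|} = ⋃ i ∈ Finset.range m, {x | t ≤ |x i|} := by
    ext x; simp
  rw [this]
  refine (measure_biUnion_finset_le _ _).trans ?_
  refine (Finset.sum_le_sum fun i _ => hQ.measure_tail_le hM i ht).trans ?_
  simp

theorem CondDominated.measure_exists_two_tails_le (m : ℕ) {t : ℝ} (ht : 0 < t) :
    Q {x | ∃ k < m, ∃ i < k, t ≤ |x i| ∧ t ≤ |x k|} ≤ (m * tailSup M (t / 2)) ^ 2 := by
  have : {x : ℕ → ℝ | ∃ k < m, ∃ i < k, t ≤ |x i| ∧ t ≤ |x k|} ⊆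
      ⋃ k ∈ Finset.range m, ⋃ i ∈ Finset.range k, {x | t ≤ |x i| ∧ t ≤ |x k|} := by
    rintro x ⟨k, hk, i, hi, h⟩
    simp only [mem_iUnion, Finset.mem_range]
    exact ⟨k, hk, i, hi, h⟩
  refine (measure_mono this).trans ((measure_biUnion_finset_le _ _).trans ?_)
  calc _ ≤ ∑ k ∈ Finset.range m, ∑ i ∈ Finset.range m, tailSup M (t / 2) ^ 2 := by
        refine Finset.sum_le_sum fun k hk => (measure_biUnion_finset_le _ _).trans ?_
        refine (Finset.sum_le_sum fun i hi =>
          hQ.measure_two_tails_le hM (Finset.mem_range.1 hi) ht).trans ?_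
        exact Finset.sum_le_sum_of_subset (Finset.range_mono (Finset.mem_range.1 hk).le)
    _ = _ := by
        simp only [Finset.sum_const, Finset.card_range, nsmul_eq_mul]
        ring

end CondDominated

/-! ### Moments of truncated laws. -/

section moments

variable {μ : Measure ℝ} [IsProbabilityMeasure μ] {v : ℝ}
  (h2 : ∫⁻ x, ENNReal.ofReal (x ^ 2) ∂μ ≤ ENNReal.ofReal v)
include h2

omit [IsProbabilityMeasure μ] in
theorem integrable_sq_of_lintegral_le : Integrable (fun x : ℝ => x ^ 2) μ := by
  refine ⟨by fun_prop, ?_⟩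
  rw [hasFiniteIntegral_iff_ofReal (Eventually.of_forall fun x => sq_nonneg x)]
  exact h2.trans_lt ENNReal.ofReal_lt_top

theorem integrable_id_of_lintegral_sq_le : Integrable (fun x : ℝ => x) μ := by
  refine Integrable.mono' ((integrable_sq_of_lintegral_le h2).add (integrable_const (1 : ℝ)))
    (by fun_prop) (Eventually.of_forall fun x => ?_)
  rw [Real.norm_eq_abs, Pi.add_apply]
  cases abs_cases x <;> nlinarith [sq_nonneg (x - 1), sq_nonneg (x + 1)]

omit [IsProbabilityMeasure μ] in
theorem integral_sq_le_of_lintegral_le (hv : 0 ≤ v) : ∫ x, x ^ 2 ∂μ ≤ v := by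
  rw [integral_eq_lintegral_of_nonneg_ae (Eventually.of_forall fun x => sq_nonneg x) (by fun_prop)]
  exact ENNReal.toReal_le_of_le_ofReal hv h2

/-- Beyond `y` the excess is at most `|x|`, and `|x|` is at most `D` or at most `x ^ 2 / D`. The
parameter `D` is decoupled from the truncation level because it will be `lilNorm m`, where the
second term is small, while `y` is of order `√(m / llog m)`. -/
theorem integral_abs_sub_clip_le {y D : ℝ} (hy : 0 ≤ y) (hD : 0 < D) (hv : 0 ≤ v) :
    ∫ x, |x - clip y x| ∂μ ≤ D * μ.real {x | y ≤ |x|} + v / D := by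
  have hi := integrable_sq_of_lintegral_le h2
  have hi1 := integrable_id_of_lintegral_sq_le h2
  have hI : Integrable ({x : ℝ | y ≤ |x|}.indicator fun _ => D) μ :=
    (integrable_const D).indicator (measurableSet_abs_ge y)
  have hpt : ∀ x, |x - clip y x| ≤ {x : ℝ | y ≤ |x|}.indicator (fun _ => D) x + x ^ 2 / D := by
    intro x
    by_cases hx : y ≤ |x|
    · rw [indicator_of_mem (by exact hx)]
      refine (abs_sub_clip_le hy x).trans ?_
      rw [← sq_abs x]
      have : |x| * D ≤ D * D + |x| ^ 2 := by nlinarith [sq_nonneg (|x| - D), sq_nonneg (|x| + D)]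
      calc |x| = |x| * D / D := by field_simp
        _ ≤ (D * D + |x| ^ 2) / D := by gcongr
        _ = _ := by field_simp
    · rw [indicator_of_notMem (by exact hx), clip_of_abs_le (not_le.1 hx).le]
      simp only [sub_self, abs_zero, zero_add]
      positivity
  calc _ ≤ ∫ x, ({x : ℝ | y ≤ |x|}.indicator (fun _ => D) x + x ^ 2 / D) ∂μ :=
        integral_mono_of_nonneg (Eventually.of_forall fun x => abs_nonneg _)
          (hI.add (hi.div_const D)) (Eventually.of_forall hpt)
    _ = D * μ.real {x | y ≤ |x|} + (∫ x, x ^ 2 ∂μ) / D := by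
        rw [integral_add hI (hi.div_const D), integral_div,
          integral_indicator_const _ (measurableSet_abs_ge y), smul_eq_mul, mul_comm]
    _ ≤ _ := by gcongr; exact integral_sq_le_of_lintegral_le h2 hv

variable (hmean : ∫ x, x ∂μ = 0)
include hmean

theorem integral_clip_le {y D : ℝ} (hy : 0 ≤ y) (hD : 0 < D) (hv : 0 ≤ v) :
    ∫ x, clip y x ∂μ ≤ D * μ.real {x | y ≤ |x|} + v / D := by
  have hi1 := integrable_id_of_lintegral_sq_le h2
  have hic : Integrable (clip y) μ := .of_bound (measurable_clip y).aestronglyMeasurable y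
    (Eventually.of_forall fun x => abs_clip_le hy x)
  have h3 : ∫ x, clip y x ∂μ = -∫ x, (x - clip y x) ∂μ := by
    rw [integral_sub hi1 hic, hmean]
    ring
  rw [h3]
  refine le_trans ?_ (integral_abs_sub_clip_le h2 hy hD hv)
  exact (neg_le_abs _).trans abs_integral_le_integral_abs

theorem integral_clip_le_div {y : ℝ} (hy : 0 < y) (hv : 0 ≤ v) :
    ∫ x, clip y x ∂μ ≤ v / y := by
  have hi1 := integrable_id_of_lintegral_sq_le h2
  have hi := integrable_sq_of_lintegral_le h2
  have hic : Integrable (clip y) μ := .of_bound (measurable_clip y).aestronglyMeasurable y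
    (Eventually.of_forall fun x => abs_clip_le hy.le x)
  have h3 : ∫ x, clip y x ∂μ = ∫ x, (clip y x - x) ∂μ := by
    rw [integral_sub hic hi1, hmean, sub_zero]
  rw [h3]
  calc _ ≤ ∫ x, x ^ 2 / y ∂μ := by
        refine integral_mono (hic.sub hi1) (hi.div_const y) fun x => ?_
        rcases le_total |x| y with h | h
        · simp only [clip_of_abs_le h, sub_self]
          positivity
        · have h4 := (le_abs_self _).trans ((abs_sub_comm _ _).le.trans (abs_sub_clip_le hy.le x))
          refine h4.trans ?_
          rw [le_div_iff₀ hy, ← sq_abs, sq]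
          gcongr
    _ = (∫ x, x ^ 2 ∂μ) / y := integral_div _ _
    _ ≤ _ := by gcongr; exact integral_sq_le_of_lintegral_le h2 hv

omit hmean in
theorem lintegral_exp_clip_le {r y b : ℝ} (hr : 0 ≤ r) (hy : 0 ≤ y) (hv : 0 ≤ v)
    (hb : ∫ x, clip y x ∂μ ≤ b) :
    ∫⁻ x, ENNReal.ofReal (Real.exp (r * clip y x)) ∂μ ≤
      ENNReal.ofReal (Real.exp (r * b + r ^ 2 / 2 * Real.exp (r * y) * v)) := by
  have hi := integrable_sq_of_lintegral_le h2
  have hic : Integrable (clip y) μ := .of_bound (measurable_clip y).aestronglyMeasurable y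
    (Eventually.of_forall fun x => abs_clip_le hy x)
  obtain ⟨-, K, -, -, -, hK⟩ := (isCBLip_exp_clip hr hy).exists_bounds
  have hie : Integrable (fun x => Real.exp (r * clip y x)) μ :=
    .of_bound (by fun_prop) K (Eventually.of_forall hK)
  rw [← ofReal_integral_eq_lintegral_ofReal hie (Eventually.of_forall fun x => (Real.exp_pos _).le)]
  refine ENNReal.ofReal_le_ofReal ?_
  calc _ ≤ ∫ x, (1 + r * clip y x + r ^ 2 / 2 * Real.exp (r * y) * x ^ 2) ∂μ := by
        refine integral_mono hie (((integrable_const 1).add (hic.const_mul r)).add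
          (hi.const_mul _)) fun x => ?_
        have h3 := exp_le_quadratic (r * clip y x)
        have h4 : |r * clip y x| ≤ r * y := by
          rw [abs_mul, abs_of_nonneg hr]
          gcongr
          exact abs_clip_le hy x
        have h5 : clip y x ^ 2 ≤ x ^ 2 := sq_le_sq.2 (abs_clip_le_abs hy x)
        have h6 : (r * clip y x) ^ 2 / 2 * Real.exp |r * clip y x| ≤
            r ^ 2 / 2 * Real.exp (r * y) * x ^ 2 := by
          rw [mul_pow]
          calc r ^ 2 * clip y x ^ 2 / 2 * Real.exp |r * clip y x|
              ≤ r ^ 2 * x ^ 2 / 2 * Real.exp (r * y) := by gcongr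
            _ = _ := by ring
        simp only []
        linarith
    _ = 1 + r * ∫ x, clip y x ∂μ + r ^ 2 / 2 * Real.exp (r * y) * ∫ x, x ^ 2 ∂μ := by
        have I1 : Integrable (fun x => 1 + r * clip y x) μ :=
          (integrable_const 1).add (hic.const_mul r)
        rw [integral_add I1 (hi.const_mul _),
          integral_add (integrable_const 1) (hic.const_mul r), integral_const_mul,
          integral_const_mul]
        simp
    _ ≤ 1 + r * b + r ^ 2 / 2 * Real.exp (r * y) * v := by
        gcongr
        exact integral_sq_le_of_lintegral_le h2 hv
    _ ≤ _ := by
        have := Real.add_one_le_exp (r * b + r ^ 2 / 2 * Real.exp (r * y) * v)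
        linarith

end moments

/-! ### Decomposition of a path and the resulting exponents. -/

section pathwise

/-- If at most one coordinate reaches `τ` and that one stays below `D`, then truncation at `τ`
lowers every partial sum by at most `D`. -/
theorem exists_of_le_sum {x : ℕ → ℝ} {m : ℕ} {τ D z : ℝ} (hτ : 0 ≤ τ)
    (h : ∃ n ≤ m, z ≤ ∑ i ∈ Finset.range n, x i) (hD0 : 0 ≤ D) :
    (∃ i < m, D ≤ |x i|) ∨ (∃ k < m, ∃ i < k, τ ≤ |x i| ∧ τ ≤ |x k|) ∨
      ∃ n ≤ m, z - D ≤ ∑ i ∈ Finset.range n, clip τ (x i) := by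
  by_contra! hc
  obtain ⟨hD, h2, h3⟩ := hc
  obtain ⟨n, hn, hz⟩ := h
  have key : ∑ i ∈ Finset.range n, (x i - clip τ (x i)) ≤ D := by
    by_cases hex : ∃ k < n, τ ≤ |x k|
    · obtain ⟨k, hk, hτk⟩ := hex
      rw [Finset.sum_eq_single_of_mem k (Finset.mem_range.2 hk)]
      · exact (le_abs_self _).trans ((abs_sub_clip_le hτ _).trans (hD k (hk.trans_le hn)).le)
      · intro i hi hik
        have hin := Finset.mem_range.1 hi
        have : |x i| < τ := by
          rcases lt_or_gt_of_ne hik with hlt | hlt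
          · by_contra! hge
            exact absurd (h2 k (hk.trans_le hn) i hlt hge) (not_lt.2 hτk)
          · exact h2 i (hin.trans_le hn) k hlt hτk
        rw [clip_of_abs_le this.le, sub_self]
    · push Not at hex
      rw [Finset.sum_eq_zero fun i hi => by
        rw [clip_of_abs_le (hex i (Finset.mem_range.1 hi)).le, sub_self]]
      exact hD0
  rw [Finset.sum_sub_distrib] at key
  have := h3 n hn
  linarith

theorem exists_of_le_sum' {x : ℕ → ℝ} {m : ℕ} {y z : ℝ}
    (h : ∃ n ≤ m, z ≤ ∑ i ∈ Finset.range n, x i) :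
    (∃ i < m, y ≤ |x i|) ∨ ∃ n ≤ m, z ≤ ∑ i ∈ Finset.range n, clip y (x i) := by
  by_contra! hc
  obtain ⟨hD, h3⟩ := hc
  obtain ⟨n, hn, hz⟩ := h
  refine absurd (h3 n hn) (not_lt.2 (hz.trans_eq (Finset.sum_congr rfl fun i hi => ?_)))
  rw [clip_of_abs_le (hD i ((Finset.mem_range.1 hi).trans_le hn)).le]

end pathwise

section calculus

/-- The tilt `r` minimizes the Gaussian exponent `-r s d + m r ^ 2 v / 2`, with value `-(s ^ 2 / v)
l`. The other terms come from the allowance `δ d` for one jump and from the bias of the truncation.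
-/
theorem exponent_good_le {m d l v s δ p τ r w : ℝ} (hm : 0 < m) (hd : 0 < d) (hl : 1 ≤ l)
    (hdl : d ^ 2 = 2 * m * l) (hv : 0 < v) (hs : 0 < s) (hr : r = s * d / (m * v))
    (hp : m * p ≤ 1 / l ^ 2) (hexp : Real.exp (r * τ) * w ≤ v) :
    -(r * (s * d - δ * d)) + m * (r * (d * p + w / d) + r ^ 2 / 2 * Real.exp (r * τ) * w) ≤
      -(l / v) * (s ^ 2 - 2 * s * δ - 2 * s / l ^ 2 - s * w / l) := by
  have h1 : r * d = 2 * s * l / v := by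
    rw [hr]; field_simp; rw [hdl]; ring
  have h2 : m * (r * (w / d)) = s * w / v := by
    rw [hr]; field_simp
  have h3 : m * r ^ 2 / 2 * v = s ^ 2 * l / v := by
    rw [hr]; field_simp; rw [hdl]; ring
  have h4 : m * (r ^ 2 / 2 * Real.exp (r * τ) * w) ≤ s ^ 2 * l / v := by
    rw [← h3]
    calc _ = m * r ^ 2 / 2 * (Real.exp (r * τ) * w) := by ring
      _ ≤ _ := by gcongr
  have h5 : m * (r * (d * p)) ≤ 2 * s * l / v * (1 / l ^ 2) := by
    calc _ = r * d * (m * p) := by ring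
      _ ≤ _ := by rw [h1]; gcongr
  have h6 : r * (s * d - δ * d) = 2 * s * l / v * (s - δ) := by rw [← h1]; ring
  rw [h6]
  have h7 : -(l / v) * (s ^ 2 - 2 * s * δ - 2 * s / l ^ 2 - s * w / l) =
      -(2 * s * l / v * (s - δ)) + (2 * s * l / v * (1 / l ^ 2) + s * w / v + s ^ 2 * l / v) := by
    field_simp
    ring
  rw [h7]
  have h8 : m * (r * (d * p + w / d) + r ^ 2 / 2 * Real.exp (r * τ) * w) =
    m * (r * (d * p)) + m * (r * (w / d)) + m * (r ^ 2 / 2 * Real.exp (r * τ) * w) := by ring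
  rw [h8, h2]
  linarith

/-- The tilt is such that `exp (r δ d) = √l`. The drift and variance terms then stay bounded, and `8
δ ≤ s` turns the main term into `-4 log l`. -/
theorem exponent_bad_le {m d l s δ α w r : ℝ} (hm : 0 < m) (hd : 0 < d) (hl : 1 < l)
    (hdl : d ^ 2 = 2 * m * l) (hδ : 0 < δ) (hw : 0 ≤ w) (hα : α = Real.log l / 2)
    (hr : r = α / (δ * d)) (hs : 8 * δ ≤ s) :
    -(r * (s * d)) + m * (r * (w / (δ * d)) + r ^ 2 / 2 * Real.exp (r * (δ * d)) * w) ≤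
      -(4 * Real.log l) + 3 * w / δ ^ 2 := by
  have hl0 : 0 < l := by linarith
  have hlog : 0 < Real.log l := Real.log_pos hl
  have hα0 : 0 < α := by rw [hα]; positivity
  have hra : r * (δ * d) = α := by rw [hr]; field_simp
  have hexp : Real.exp α = Real.sqrt l := by
    rw [hα, Real.sqrt_eq_rpow, Real.rpow_def_of_pos hl0]; congr 1; ring
  set q := Real.sqrt (Real.sqrt l) with hq
  have hsl : 0 < Real.sqrt l := Real.sqrt_pos.2 hl0
  have hq0 : 0 < q := Real.sqrt_pos.2 hsl
  have hq2 : q ^ 2 = Real.sqrt l := Real.sq_sqrt hsl.le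
  have hq4 : q ^ 4 = l := by
    rw [show q ^ 4 = (q ^ 2) ^ 2 by ring, hq2, Real.sq_sqrt hl0.le]
  have hαq : α ≤ 2 * q := by
    rw [hα, ← hq4, Real.log_pow]
    have := Real.log_le_sub_one_of_pos hq0
    push_cast
    linarith
  have hαl : α ≤ l := by
    have := Real.log_le_sub_one_of_pos hl0
    rw [hα]; linarith
  rw [hra, hexp]
  have h1 : r * (s * d) = α * (s / δ) := by rw [hr]; field_simp
  have h2 : 8 ≤ s / δ := (le_div_iff₀ hδ).2 hs
  have h3 : m * (r * (w / (δ * d))) = α / l * (w / (2 * δ ^ 2)) := by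
    rw [hr]
    have : m * (α / (δ * d) * (w / (δ * d))) = m * α * w / (δ ^ 2 * d ^ 2) := by field_simp
    rw [this, hdl]
    field_simp
  have h4 : m * (r ^ 2 / 2 * Real.sqrt l * w) = α ^ 2 / q ^ 2 * (w / (4 * δ ^ 2)) := by
    rw [hr]
    have : m * ((α / (δ * d)) ^ 2 / 2 * Real.sqrt l * w) =
        m * α ^ 2 * Real.sqrt l * w / (2 * δ ^ 2 * d ^ 2) := by field_simp
    rw [this, hdl, ← hq2, ← hq4]
    field_simp
    ring
  have h5 : α / l * (w / (2 * δ ^ 2)) ≤ 1 * (w / δ ^ 2) := by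
    have e1 : α / l ≤ 1 := (div_le_one hl0).2 hαl
    have e2 : w / (2 * δ ^ 2) ≤ w / δ ^ 2 := by
      gcongr
      nlinarith [sq_nonneg δ]
    gcongr
  have h6 : α ^ 2 / q ^ 2 * (w / (4 * δ ^ 2)) ≤ w / δ ^ 2 := by
    have e1 : α ^ 2 / q ^ 2 ≤ 4 := by
      rw [div_le_iff₀ (by positivity)]
      nlinarith
    calc _ ≤ 4 * (w / (4 * δ ^ 2)) := by gcongr
      _ = _ := by field_simp
  rw [mul_add, h1, h3, h4]
  have h7 : 4 * Real.log l ≤ α * (s / δ) := by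
    calc 4 * Real.log l = α * 8 := by rw [hα]; ring
      _ ≤ _ := by gcongr
  have h8 : 0 ≤ w / δ ^ 2 := by positivity
  have h9 : 3 * w / δ ^ 2 = 3 * (w / δ ^ 2) := by ring
  rw [h9]
  linarith

end calculus

/-! ### The tail bound for one block. -/

/-- `M` is a family of centred laws with variances at most `w`. -/
structure CenteredFamily (M : Set (Measure ℝ)) (w : ℝ) : Prop where
  prob : ∀ μ ∈ M, IsProbabilityMeasure μ
  sq : ∀ μ ∈ M, ∫⁻ x, ENNReal.ofReal (x ^ 2) ∂μ ≤ ENNReal.ofReal w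
  mean : ∀ μ ∈ M, ∫ x, x ∂μ = 0

section block

variable {M : Set (Measure ℝ)} {w : ℝ} (hM : CenteredFamily M w) (hw : 0 ≤ w)
include hM hw

theorem CenteredFamily.maximal_ineq {Q : Measure (ℕ → ℝ)} [IsProbabilityMeasure Q]
    (hQ : CondDominated M Q) {r y b z : ℝ} (hr : 0 ≤ r) (hy : 0 ≤ y) (hb0 : 0 ≤ b)
    (hb : ∀ μ ∈ M, ∫ x, clip y x ∂μ ≤ b) (m : ℕ) :
    Q {x | ∃ n ≤ m, z ≤ ∑ i ∈ Finset.range n, clip y (x i)} ≤ ENNReal.ofReal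
      (Real.exp (-(r * z) + m * (r * b + r ^ 2 / 2 * Real.exp (r * y) * w))) := by
  set a := r * b + r ^ 2 / 2 * Real.exp (r * y) * w with ha
  have ha0 : 0 ≤ a := by have := Real.exp_pos (r * y); positivity
  have h1 := hQ.maximal_ineq hr hy (c := (Real.exp a).toNNReal)
    (by rw [← Real.toNNReal_one]; exact Real.toNNReal_le_toNNReal (Real.one_le_exp ha0))
    (fun μ hμ => by
      have := hM.prob μ hμ
      exact lintegral_exp_clip_le (hM.sq μ hμ) hr hy hw (hb μ hμ)) z m
  refine h1.trans_eq ?_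
  rw [show ((Real.exp a).toNNReal : ℝ≥0∞) = ENNReal.ofReal (Real.exp a) from rfl,
    ← ENNReal.ofReal_pow (Real.exp_pos _).le, ← ENNReal.ofReal_mul (by positivity),
    ← Real.exp_nat_mul, ← Real.exp_add, add_comm]

/-- A dichotomy on the tail mass `m p` at level `τ` of order `√(m / l)`, with `l = llog m`. If `m p
≤ 1 / l ^ 2`, truncation at `τ` gives the Gaussian exponent, and two jumps beyond `τ` have
probability at most `(m p) ^ 2 ≤ m p / l ^ 2`. If `m p > 1 / l ^ 2`, the cruder truncation at `δ d`
leaves a multiple of `l ^ (-4)`, which is below the same multiple of `m p / l ^ 2`. The middle term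
of the bound covers both losses. -/
theorem CenteredFamily.block_bound {s : ℝ} (hs : 0 < s) (hws : w < s ^ 2) :
    ∃ δ > 0, ∃ η > 0, ∃ κ > 0, ∃ K L₀ : ℝ, 0 ≤ K ∧ ∀ m : ℕ, 0 < m → L₀ ≤ llog m →
      ∀ Q : Measure (ℕ → ℝ), IsProbabilityMeasure Q → CondDominated M Q →
        Q {x | ∃ n ≤ m, s * lilNorm m ≤ ∑ i ∈ Finset.range n, x i} ≤
          m * tailSup M (δ * lilNorm m) +
            ENNReal.ofReal (K * (m / llog m ^ 2)) * tailSup M (η * Real.sqrt (m / llog m)) +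
            ENNReal.ofReal (Real.exp (-(1 + κ) * llog m)) := by
  obtain ⟨v, hwv, hvs⟩ := exists_between hws
  have hv : 0 < v := hw.trans_lt hwv
  set g := s ^ 2 - v with hg
  have hg0 : 0 < g := by simp only [hg]; linarith
  -- The first requirement serves `exponent_bad_le`. By the second, `2 s δ` uses at most `g / 4` of
  -- the margin `g`; another `g / 4` goes to the terms vanishing with `l`, and `g / 2` remains for
  -- `κ`.
  obtain ⟨δ, hδ0, hδs, hδg⟩ : ∃ δ > 0, 8 * δ ≤ s ∧ 8 * s * δ ≤ g := by
    refine ⟨min (s / 8) (g / (8 * s)), by positivity, ?_, ?_⟩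
    · linarith [min_le_left (s / 8) (g / (8 * s))]
    · calc 8 * s * min (s / 8) (g / (8 * s)) ≤ 8 * s * (g / (8 * s)) := by
            gcongr; exact min_le_right _ _
        _ = g := by field_simp
  -- The exponent is the product `r τ`, which does not depend on `m`; a small `η` thus keeps the
  -- tilted variance below `v`.
  obtain ⟨η, hη0, hη⟩ : ∃ η > 0, Real.exp (Real.sqrt 2 * s * η / v) * w ≤ v := by
    have hc : Tendsto (fun η : ℝ => Real.exp (Real.sqrt 2 * s * η / v) * w) (𝓝[>] 0)
        (𝓝 (Real.exp (Real.sqrt 2 * s * 0 / v) * w)) :=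
      (Continuous.tendsto (by fun_prop) 0).mono_left nhdsWithin_le_nhds
    rw [mul_zero, zero_div, Real.exp_zero, one_mul] at hc
    obtain ⟨η, h1, h2⟩ := ((hc.eventually_lt_const hwv).and self_mem_nhdsWithin).exists
    exact ⟨η, h2, h1.le⟩
  have hev : ∀ᶠ l : ℝ in atTop, 2 * s / l ^ 2 + s * w / l ≤ g / 4 := by
    have h1 : Tendsto (fun l : ℝ => 2 * s / l ^ 2 + s * w / l) atTop (𝓝 (0 + 0)) :=
      (tendsto_const_nhds.div_atTop (tendsto_pow_atTop two_ne_zero)).add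
        (tendsto_const_nhds.div_atTop tendsto_id)
    rw [add_zero] at h1
    exact h1.eventually_le_const (by positivity)
  obtain ⟨L₁, hL₁⟩ := eventually_atTop.1 hev
  refine ⟨δ / 2, by positivity, η / 2, by positivity, g / (2 * v), by positivity,
    1 + Real.exp (3 * w / δ ^ 2), max L₁ 2, by positivity, fun m hm hl Q hQp hQ => ?_⟩
  set l := llog m with hldef
  set d := lilNorm m with hddef
  have hm' : (0 : ℝ) < m := by exact_mod_cast hm
  have hl2 : 2 ≤ l := (le_max_right _ _).trans hl
  have hl0 : 0 < l := by linarith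
  have hd : 0 < d := lilScale_pos hm'
  have hdl : d ^ 2 = 2 * m * l := lilScale_sq hm'.le
  set τ := η * Real.sqrt (m / l) with hτdef
  have hτ : 0 < τ := mul_pos hη0 (Real.sqrt_pos.2 (by positivity))
  have hT := tailSup_le_one hM.prob (τ / 2)
  have hTtop : tailSup M (τ / 2) ≠ ⊤ := (hT.trans_lt ENNReal.one_lt_top).ne
  set p := (tailSup M (τ / 2)).toReal with hp
  have hTp : tailSup M (τ / 2) = ENNReal.ofReal p := (ENNReal.ofReal_toReal hTtop).symm
  have hp0 : 0 ≤ p := ENNReal.toReal_nonneg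
  have hmass : ∀ μ ∈ M, μ.real {x | τ ≤ |x|} ≤ p := fun μ hμ =>
    ENNReal.toReal_mono hTtop
      ((measure_le_tailSup hμ τ).trans (tailSup_anti M (by linarith)))
  have hτ2 : τ / 2 = η / 2 * Real.sqrt (m / l) := by rw [hτdef]; ring
  have hδ2 : δ * d / 2 = δ / 2 * d := by ring
  rw [← hτ2]
  have hjump := hQ.measure_exists_tail_le hM.prob m (t := δ * d) (by positivity)
  rw [hδ2] at hjump
  rcases le_or_gt (m * p) (1 / l ^ 2) with hgood | hbad
  · set r := s * d / (m * v) with hr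
    have hrτ : r * τ = Real.sqrt 2 * s * η / v := by
      have h1 : d * Real.sqrt (m / l) = Real.sqrt 2 * m := by
        rw [hddef, lilNorm_eq, lilScale, ← Real.sqrt_mul (by positivity)]
        rw [show 2 * (m : ℝ) * llog m * (m / l) = 2 * (m : ℝ) ^ 2 by
          rw [← hldef]; field_simp]
        rw [Real.sqrt_mul (by norm_num), Real.sqrt_sq hm'.le]
      rw [hr, hτdef]
      calc s * d / (m * v) * (η * Real.sqrt (m / l)) =
          s * η * (d * Real.sqrt (m / l)) / (m * v) := by ring
        _ = _ := by rw [h1]; field_simp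
    have hmax := hM.maximal_ineq hw hQ (r := r) (y := τ) (b := d * p + w / d) (z := s * d - δ * d)
      (by positivity) hτ.le (by positivity) (fun μ hμ => by
        have := hM.prob μ hμ
        refine (integral_clip_le (hM.sq μ hμ) (hM.mean μ hμ) hτ.le hd hw).trans ?_
        gcongr
        exact hmass μ hμ) m
    have hexpn := exponent_good_le (δ := δ) (τ := τ) (w := w) hm' hd (by linarith) hdl hv hs hr hgood
      (by rw [hrτ]; exact hη)
    have hL := hL₁ l ((le_max_left _ _).trans hl)
    have hfin : -(l / v) * (s ^ 2 - 2 * s * δ - 2 * s / l ^ 2 - s * w / l) ≤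
        -(1 + g / (2 * v)) * l := by
      have h1 : v + g / 2 ≤ s ^ 2 - 2 * s * δ - 2 * s / l ^ 2 - s * w / l := by
        simp only [hg] at *
        linarith
      calc _ ≤ -(l / v) * (v + g / 2) := by
            rw [neg_mul, neg_mul, neg_le_neg_iff]
            gcongr
        _ = _ := by field_simp
    have h2 := hQ.measure_exists_two_tails_le hM.prob m hτ
    calc _ ≤ Q ({x | ∃ i < m, δ * d ≤ |x i|} ∪ ({x | ∃ k < m, ∃ i < k, τ ≤ |x i| ∧ τ ≤ |x k|} ∪
          {x | ∃ n ≤ m, s * d - δ * d ≤ ∑ i ∈ Finset.range n, clip τ (x i)})) :=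
          measure_mono fun x hx => exists_of_le_sum hτ.le hx (by positivity)
      _ ≤ m * tailSup M (δ / 2 * d) + ((m * tailSup M (τ / 2)) ^ 2 +
          ENNReal.ofReal (Real.exp (-(1 + g / (2 * v)) * l))) := by
          refine (measure_union_le _ _).trans (add_le_add hjump ?_)
          refine (measure_union_le _ _).trans (add_le_add h2 (hmax.trans ?_))
          exact ENNReal.ofReal_le_ofReal (Real.exp_le_exp.2 (hexpn.trans hfin))
      _ ≤ _ := by
          rw [← add_assoc]
          gcongr
          rw [hTp, ← ENNReal.ofReal_natCast, ← ENNReal.ofReal_mul hm'.le,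
            ← ENNReal.ofReal_pow (by positivity), ← ENNReal.ofReal_mul (by positivity)]
          refine ENNReal.ofReal_le_ofReal ?_
          have h3 : 0 ≤ m * p := by positivity
          calc (m * p) ^ 2 = (m * p) * (m * p) := by ring
            _ ≤ (m * p) * (1 / l ^ 2) := by gcongr
            _ = 1 * (m / l ^ 2) * p := by ring
            _ ≤ _ := by
              gcongr
              linarith [Real.exp_pos (3 * w / δ ^ 2)]
  · set α := Real.log l / 2 with hα
    set r := α / (δ * d) with hr
    have hlog : 0 < Real.log l := Real.log_pos (by linarith)
    have hα0 : 0 < α := by positivity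
    have hmax := hM.maximal_ineq hw hQ (r := r) (y := δ * d) (b := w / (δ * d)) (z := s * d)
      (by positivity) (by positivity) (by positivity) (fun μ hμ => by
        have := hM.prob μ hμ
        exact integral_clip_le_div (hM.sq μ hμ) (hM.mean μ hμ) (by positivity) hw) m
    have hexpn := exponent_bad_le (w := w) hm' hd (by linarith) hdl hδ0 hw hα hr hδs
    calc _ ≤ Q ({x | ∃ i < m, δ * d ≤ |x i|} ∪
          {x | ∃ n ≤ m, s * d ≤ ∑ i ∈ Finset.range n, clip (δ * d) (x i)}) :=
          measure_mono fun x hx => exists_of_le_sum' hx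
      _ ≤ m * tailSup M (δ / 2 * d) +
          ENNReal.ofReal (Real.exp (-(4 * Real.log l) + 3 * w / δ ^ 2)) := by
          refine (measure_union_le _ _).trans (add_le_add hjump (hmax.trans ?_))
          exact ENNReal.ofReal_le_ofReal (Real.exp_le_exp.2 hexpn)
      _ ≤ m * tailSup M (δ / 2 * d) +
          ENNReal.ofReal ((1 + Real.exp (3 * w / δ ^ 2)) * (m / l ^ 2)) *
          tailSup M (τ / 2) := by
          gcongr
          rw [hTp, ← ENNReal.ofReal_mul (by positivity)]
          refine ENNReal.ofReal_le_ofReal ?_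
          rw [Real.exp_add, show -(4 * Real.log l) = Real.log l * (-4 : ℝ) by ring,
            ← Real.rpow_def_of_pos hl0, Real.rpow_neg hl0.le,
            show (4 : ℝ) = ((4 : ℕ) : ℝ) by norm_num, Real.rpow_natCast]
          calc (l ^ 4)⁻¹ * Real.exp (3 * w / δ ^ 2) =
              (1 / l ^ 2) * (Real.exp (3 * w / δ ^ 2) / l ^ 2) := by field_simp
            _ ≤ (m * p) * ((1 + Real.exp (3 * w / δ ^ 2)) / l ^ 2) := by
              gcongr
              linarith
            _ = _ := by ring
      _ ≤ _ := le_self_add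

end block

/-! ### Reflection and geometric blocks. -/

/-- The reflected family of laws. -/
def reflect (M : Set (Measure ℝ)) : Set (Measure ℝ) := (fun μ => μ.map Neg.neg) '' M

theorem tailSup_reflect (M : Set (Measure ℝ)) (r : ℝ) : tailSup (reflect M) r = tailSup M r := by
  simp only [tailSup, reflect, iSup_image]
  refine iSup_congr fun μ => iSup_congr fun _ => ?_
  rw [Measure.map_apply measurable_neg (measurableSet_abs_ge r)]
  simp only [preimage_ofPred_eq, abs_neg]

theorem TailIntegrable.reflect {M : Set (Measure ℝ)} (h : TailIntegrable M) :
    TailIntegrable (reflect M) := fun δ hδ => by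
  simpa only [tailSup_reflect] using h δ hδ

theorem CenteredFamily.reflect {M : Set (Measure ℝ)} {w : ℝ} (h : CenteredFamily M w) :
    CenteredFamily (reflect M) w where
  prob := by
    rintro _ ⟨μ, hμ, rfl⟩
    have := h.prob μ hμ
    exact Measure.isProbabilityMeasure_map measurable_neg.aemeasurable
  sq := by
    rintro _ ⟨μ, hμ, rfl⟩
    rw [lintegral_map (by fun_prop) measurable_neg]
    simpa using h.sq μ hμ
  mean := by
    rintro _ ⟨μ, hμ, rfl⟩
    rw [integral_map measurable_neg.aemeasurable (by fun_prop), integral_neg, h.mean μ hμ, neg_zero]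

theorem CondDominated.reflect {M : Set (Measure ℝ)} {Q : Measure (ℕ → ℝ)}
    (h : CondDominated M Q) : CondDominated (reflect M) (Q.map Neg.neg) := by
  intro k ψ φ c hψ hφ h0 hc
  have hφ' : IsCBLip (fun x => φ (-x)) := hφ.comp_lipschitz (g := fun x : ℝ => -x) (K := 1)
    fun x y => by rw [neg_sub_neg, norm_sub_rev, one_mul]
  have hneg : Measurable (Neg.neg : (ℕ → ℝ) → ℕ → ℝ) := measurable_neg
  have hφm := hφ.continuous.measurable
  have h1 := h k (fun y => ψ (-y)) (fun x => φ (-x)) c (hψ.comp measurable_neg) hφ'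
    (fun x => h0 (-x)) (fun μ hμ => by
      have := hc _ ⟨μ, hμ, rfl⟩
      rwa [lintegral_map hφm.ennreal_ofReal measurable_neg] at this)
  have h2 : Measurable fun x : ℕ → ℝ => ψ (firstCoords k x) := hψ.comp (measurable_firstCoords k)
  have h3 : Measurable fun x : ℕ → ℝ => ENNReal.ofReal (φ (x k)) :=
    (hφm.comp (measurable_pi_apply k)).ennreal_ofReal
  have h4 : Measurable fun x : ℕ → ℝ => ψ (firstCoords k x) * ENNReal.ofReal (φ (x k)) := h2.mul h3
  rw [lintegral_map h4 hneg, lintegral_map h2 hneg]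
  exact h1

theorem lilScale_mul_le {c t : ℝ} (hc : 1 ≤ c) (ht : 0 ≤ t) :
    lilScale (c * t) ≤ c * lilScale t := by
  have h1 := llog_mul_le t hc
  have h2 := llog_pos t
  rw [lilScale, lilScale, ← Real.sqrt_sq (by linarith : 0 ≤ c), ← Real.sqrt_mul (sq_nonneg c),
    Real.sqrt_sq (by linarith : 0 ≤ c)]
  refine Real.sqrt_le_sqrt ?_
  calc 2 * (c * t) * llog (c * t) ≤ 2 * (c * t) * (c * llog t) := by gcongr
    _ = _ := by ring

section geometric

variable {θ : ℝ} (hθ : 1 < θ)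
include hθ

theorem tendsto_ceil_pow : Tendsto (fun j : ℕ => ⌈θ ^ j⌉₊) atTop atTop :=
  tendsto_nat_ceil_atTop.comp (tendsto_pow_atTop_atTop_of_one_lt hθ)

theorem eventually_mul_ceil_pow_le : ∃ ρ : ℝ, 1 < ρ ∧
    ∀ᶠ j : ℕ in atTop, ρ * (⌈θ ^ j⌉₊ : ℝ) ≤ (⌈θ ^ (j + 1)⌉₊ : ℝ) := by
  refine ⟨(1 + θ) / 2, by linarith, ?_⟩
  have h1 := (tendsto_pow_atTop_atTop_of_one_lt hθ).eventually_ge_atTop ((1 + θ) / (θ - 1))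
  filter_upwards [h1] with j hj
  have hθ' : 0 < θ - 1 := by linarith
  rw [div_le_iff₀ hθ'] at hj
  have h2 := (Nat.ceil_lt_add_one (show (0 : ℝ) ≤ θ ^ j by positivity)).le
  refine le_trans ?_ (Nat.le_ceil _)
  rw [pow_succ]
  nlinarith

theorem eventually_ceil_pow_succ_le :
    ∀ᶠ j : ℕ in atTop, (⌈θ ^ (j + 1)⌉₊ : ℝ) ≤ θ ^ 2 * ⌈θ ^ j⌉₊ := by
  have hθ' : 0 < θ - 1 := by linarith
  have h1 := (tendsto_pow_atTop_atTop_of_one_lt hθ).eventually_ge_atTop (1 / (θ - 1))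
  filter_upwards [h1] with j hj
  rw [div_le_iff₀ hθ'] at hj
  have h2 := (Nat.ceil_lt_add_one (show (0 : ℝ) ≤ θ ^ (j + 1) by positivity)).le
  have h3 := Nat.le_ceil (θ ^ j)
  have h4 : 0 < θ ^ j := by positivity
  calc _ ≤ θ ^ (j + 1) + 1 := h2
    _ ≤ θ ^ 2 * θ ^ j := by rw [pow_succ]; nlinarith
    _ ≤ _ := by gcongr

/-- Along `θ ^ j` the iterated logarithm is at least `log (j log θ)`, so the terms are at most a
multiple of `j ^ (-(1 + κ))`. -/
theorem tsum_exp_llog_ceil_pow_lt_top {κ : ℝ} (hκ : 0 < κ) :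
    ∑' j : ℕ, ENNReal.ofReal (Real.exp (-(1 + κ) * llog (⌈θ ^ j⌉₊ : ℝ))) < ⊤ := by
  have hlogθ : 0 < Real.log θ := Real.log_pos hθ
  have hs : Summable fun j : ℕ => Real.exp (-(1 + κ) * llog (⌈θ ^ j⌉₊ : ℝ)) := by
    have h1 : Summable fun j : ℕ => Real.log θ ^ (-(1 + κ)) * ((j : ℝ) ^ (1 + κ))⁻¹ :=
      (Real.summable_nat_rpow_inv.2 (by linarith)).mul_left _
    rw [← summable_nat_add_iff 1] at h1 ⊢
    refine Summable.of_nonneg_of_le (fun j => (Real.exp_pos _).le) (fun j => ?_) h1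
    have hj : (0 : ℝ) < ((j + 1 : ℕ) : ℝ) := by positivity
    have h2 : Real.log θ * ((j + 1 : ℕ) : ℝ) ≤ logE (⌈θ ^ (j + 1)⌉₊ : ℝ) := by
      rw [mul_comm, ← Real.log_pow, logE]
      exact Real.log_le_log (by positivity) ((Nat.le_ceil _).trans (le_max_right _ _))
    have h3 : Real.log (Real.log θ * ((j + 1 : ℕ) : ℝ)) ≤ llog (⌈θ ^ (j + 1)⌉₊ : ℝ) := by
      rw [llog, logE]
      exact Real.log_le_log (by positivity) (h2.trans (le_max_right _ _))
    rw [← Real.rpow_neg hj.le, ← Real.mul_rpow hlogθ.le hj.le,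
      Real.rpow_def_of_pos (by positivity), mul_comm]
    refine Real.exp_le_exp.2 ?_
    nlinarith
  rw [← ENNReal.ofReal_tsum_of_nonneg (fun j => (Real.exp_pos _).le) hs]
  exact ENNReal.ofReal_lt_top

variable {M : Set (Measure ℝ)} {w : ℝ} (hM : CenteredFamily M w) (hw : 0 ≤ w)
include hM hw

/-- The bound is chosen before the law `Q`: this uniformity is what lets it pass from measures to
capacities. The finitely many blocks too short for `block_bound` are given the bound one. -/
theorem CenteredFamily.exists_summable_bound (hT : TailIntegrable M) {s : ℝ} (hs : 0 < s)
    (hws : w < s ^ 2) : ∃ a : ℕ → ℝ≥0∞, ∑' j, a j < ⊤ ∧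
      ∀ Q : Measure (ℕ → ℝ), IsProbabilityMeasure Q → CondDominated M Q → ∀ j,
        Q {x | ∃ n ≤ ⌈θ ^ j⌉₊, s * lilNorm ⌈θ ^ j⌉₊ ≤ ∑ i ∈ Finset.range n, x i} ≤ a j := by
  obtain ⟨δ, hδ, η, hη, κ, hκ, K, L₀, hK, hb⟩ := hM.block_bound hw hs hws
  obtain ⟨ρ, hρ, hgrow⟩ := eventually_mul_ceil_pow_le hθ
  have hlim := tendsto_ceil_pow hθ
  have hL : ∀ᶠ j : ℕ in atTop, L₀ ≤ llog (⌈θ ^ j⌉₊ : ℝ) :=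
    (tendsto_llog.comp (tendsto_natCast_atTop_atTop.comp hlim)).eventually_ge_atTop L₀
  obtain ⟨N, hN⟩ := eventually_atTop.1 hL
  refine ⟨fun j => (if j < N then 1 else 0) +
    (⌈θ ^ j⌉₊ * tailSup M (δ * lilNorm ⌈θ ^ j⌉₊) +
      ENNReal.ofReal K * (ENNReal.ofReal (⌈θ ^ j⌉₊ / llog ⌈θ ^ j⌉₊ ^ 2) *
        tailSup M (η * Real.sqrt (⌈θ ^ j⌉₊ / llog ⌈θ ^ j⌉₊))) +
      ENNReal.ofReal (Real.exp (-(1 + κ) * llog ⌈θ ^ j⌉₊))), ?_, fun Q hQp hQ j => ?_⟩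
  · rw [ENNReal.tsum_add, ENNReal.tsum_add, ENNReal.tsum_add, ENNReal.tsum_mul_left]
    refine ENNReal.add_lt_top.2 ⟨?_, ENNReal.add_lt_top.2 ⟨ENNReal.add_lt_top.2 ⟨?_, ?_⟩, ?_⟩⟩
    · rw [tsum_eq_sum (s := Finset.range N) (fun j hj => by
        rw [if_neg (by simpa using hj)])]
      exact ENNReal.sum_lt_top.2 fun j _ => by split_ifs <;> simp
    · exact hT.tsum_scale_lt_top hM.prob hδ hρ hgrow
    · exact ENNReal.mul_lt_top ENNReal.ofReal_lt_top
        (hT.tsum_sqrt_scale_lt_top hM.prob hη hρ hgrow hlim)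
    · exact tsum_exp_llog_ceil_pow_lt_top hθ hκ
  · beta_reduce
    by_cases hj : j < N
    · rw [if_pos hj]
      exact prob_le_one.trans le_self_add
    · rw [if_neg hj, zero_add]
      refine (hb _ (Nat.ceil_pos.2 (by positivity)) (hN j (not_lt.1 hj)) Q hQp hQ).trans_eq ?_
      rw [ENNReal.ofReal_mul hK, mul_assoc]

theorem CenteredFamily.exists_summable_bound_abs (hT : TailIntegrable M) {s : ℝ} (hs : 0 < s)
    (hws : w < s ^ 2) : ∃ a : ℕ → ℝ≥0∞, ∑' j, a j < ⊤ ∧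
      ∀ Q : Measure (ℕ → ℝ), IsProbabilityMeasure Q → CondDominated M Q → ∀ j,
        Q {x | ∃ n ≤ ⌈θ ^ j⌉₊, s * lilNorm ⌈θ ^ j⌉₊ ≤ |∑ i ∈ Finset.range n, x i|} ≤ a j := by
  obtain ⟨a, ha, h1⟩ := hM.exists_summable_bound hθ hw hT hs hws
  obtain ⟨b, hb, h2⟩ := hM.reflect.exists_summable_bound hθ hw hT.reflect hs hws
  refine ⟨fun j => a j + b j, by rw [ENNReal.tsum_add]; exact ENNReal.add_lt_top.2 ⟨ha, hb⟩,
    fun Q hQp hQ j => ?_⟩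
  have hneg : Measurable (Neg.neg : (ℕ → ℝ) → ℕ → ℝ) := measurable_neg
  have h3 := h2 (Q.map Neg.neg) (Measure.isProbabilityMeasure_map hneg.aemeasurable) hQ.reflect j
  refine (measure_mono (t := {x | ∃ n ≤ ⌈θ ^ j⌉₊, s * lilNorm ⌈θ ^ j⌉₊ ≤
    ∑ i ∈ Finset.range n, x i} ∪ Neg.neg ⁻¹' {x | ∃ n ≤ ⌈θ ^ j⌉₊, s * lilNorm ⌈θ ^ j⌉₊ ≤
    ∑ i ∈ Finset.range n, x i}) ?_).trans ((measure_union_le _ _).trans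
      (add_le_add (h1 Q hQp hQ j) ((Measure.le_map_apply hneg.aemeasurable _).trans h3)))
  rintro x ⟨n, hn, h⟩
  rcases le_abs.1 h with h | h
  · exact Or.inl ⟨n, hn, h⟩
  · exact Or.inr ⟨n, hn, by simpa using h⟩

end geometric

/-! ### The upper half for the outer capacity. -/

namespace SublinearExpectationSpace

variable {Ω : Type*} [MeasurableSpace Ω] {S : SublinearExpectationSpace Ω}
  {Pfam : Set (@Measure Ω S.sigmaH)} (hCC : S.CC Pfam) {Y : ℕ → Ω → ℝ} (hY : ∀ n, Y n ∈ S.H)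
  (hind : S.IndepSeq Y) (hid : S.IdentDist Y)
include hCC hY hind hid

/-- Three levels `√w < s₁ < s₂ < s` are used: the block bound holds at `s₁`, the step to `s₂` leaves
room for the thickening in `upCap_le_of_pathLaws`, and the step to `s` pays for the growth of
`lilNorm` within a block, at most `θ ^ 2 = s / s₂`. The tails of the summable series then cover the
limsup event. -/
theorem outCap_frequently_eq_zero {w : ℝ} (hw : 0 ≤ w)
    (hM : CenteredFamily (S.marginalLaws (Y 0)) w) (hT : TailIntegrable (S.marginalLaws (Y 0)))
    {s : ℝ} (hs : 0 < s) (hws : w < s ^ 2) :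
    S.outCap {ω | ∃ᶠ n in atTop, s * lilNorm n ≤ |∑ i ∈ Finset.range n, Y i ω|} = 0 := by
  obtain ⟨s₁, hs₁, hs₁s⟩ : ∃ s₁, Real.sqrt w < s₁ ∧ s₁ < s :=
    exists_between ((Real.sqrt_lt' hs).2 hws)
  obtain ⟨s₂, hs₂, hs₂s⟩ := exists_between hs₁s
  have hs₁0 : 0 < s₁ := (Real.sqrt_nonneg _).trans_lt hs₁
  have hs₂0 : 0 < s₂ := hs₁0.trans hs₂
  set θ := Real.sqrt (s / s₂) with hθdef
  have hθ2 : θ ^ 2 = s / s₂ := Real.sq_sqrt (by positivity)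
  have hθ : 1 < θ := by
    rw [hθdef, Real.lt_sqrt zero_le_one, one_pow, one_lt_div hs₂0]
    exact hs₂s
  obtain ⟨a, ha, hbound⟩ := hM.exists_summable_bound_abs hθ hw hT hs₁0 ((Real.sqrt_lt' hs₁0).1 hs₁)
  set m : ℕ → ℕ := fun j => ⌈θ ^ j⌉₊ with hmdef
  have hm0 : ∀ j, 0 < m j := fun j => Nat.ceil_pos.2 (by positivity)
  have hd0 : ∀ j, 0 < lilNorm (m j) := fun j => lilScale_pos (by exact_mod_cast hm0 j)
  let A : ∀ j, Set (Fin (m j) → ℝ) := fun j => {y | ∃ n ≤ m j, s₂ * lilNorm (m j) ≤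
    |∑ i ∈ Finset.range n, if h : i < m j then y ⟨i, h⟩ else 0|}
  have hA : ∀ j ω, (fun i : Fin (m j) => Y i ω) ∈ A j ↔
      ∃ n ≤ m j, s₂ * lilNorm (m j) ≤ |∑ i ∈ Finset.range n, Y i ω| := fun j ω => by
    refine exists_congr fun n => and_congr_right fun hn => ?_
    have : ∑ i ∈ Finset.range n, (if h : i < m j then Y i ω else 0) =
        ∑ i ∈ Finset.range n, Y i ω :=
      Finset.sum_congr rfl fun i hi => by rw [dif_pos ((Finset.mem_range.1 hi).trans_le hn)]
    exact iff_of_eq (by rw [← this])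
  have hcap : ∀ j, S.upCap {ω | (fun i : Fin (m j) => Y i ω) ∈ A j} ≤ a j := by
    intro j
    have haj : a j ≠ ⊤ := ENNReal.ne_top_of_tsum_ne_top ha.ne j
    have hmj : (0 : ℝ) < m j := by exact_mod_cast hm0 j
    rw [← ENNReal.ofReal_toReal haj]
    -- Moving each of the `m j` coordinates by less than this width moves no partial sum by more
    -- than `(s₂ - s₁) * lilNorm (m j)`.
    refine upCap_le_of_pathLaws hCC hY (δ := (s₂ - s₁) * lilNorm (m j) / m j)
      (div_pos (mul_pos (by linarith) (hd0 j)) hmj) ENNReal.toReal_nonneg fun Q hQ => ?_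
    rw [ENNReal.ofReal_toReal haj]
    refine (measure_mono ?_).trans (hbound Q (isProbabilityMeasure_of_mem_pathLaws hCC hY hQ)
      (condDominated_of_mem_pathLaws hCC hY hind hid hQ) j)
    intro x hx
    obtain ⟨y, ⟨n, hn, hy⟩, hxy⟩ := Metric.mem_thickening_iff.1 hx
    refine ⟨n, hn, ?_⟩
    have h1 : |∑ i ∈ Finset.range n, ((if h : i < m j then y ⟨i, h⟩ else 0) - x i)| ≤
        (s₂ - s₁) * lilNorm (m j) := by
      calc _ ≤ ∑ i ∈ Finset.range n, |(if h : i < m j then y ⟨i, h⟩ else 0) - x i| :=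
            Finset.abs_sum_le_sum_abs _ _
        _ ≤ ∑ i ∈ Finset.range n, (s₂ - s₁) * lilNorm (m j) / m j := by
            refine Finset.sum_le_sum fun i hi => ?_
            have him := (Finset.mem_range.1 hi).trans_le hn
            rw [dif_pos him]
            have := dist_le_pi_dist (firstCoords (m j) x) y ⟨i, him⟩
            rw [Real.dist_eq, abs_sub_comm] at this
            exact this.trans hxy.le
        _ = n * ((s₂ - s₁) * lilNorm (m j) / m j) := by simp
        _ ≤ m j * ((s₂ - s₁) * lilNorm (m j) / m j) := by
            have : 0 ≤ (s₂ - s₁) * lilNorm (m j) / m j :=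
              div_nonneg (mul_nonneg (by linarith) (hd0 j).le) hmj.le
            gcongr
        _ = _ := by field_simp
    rw [Finset.sum_sub_distrib] at h1
    have h2 := abs_sub_abs_le_abs_sub
      (∑ i ∈ Finset.range n, if h : i < m j then y ⟨i, h⟩ else 0) (∑ i ∈ Finset.range n, x i)
    linarith
  obtain ⟨N₀, hN₀⟩ := eventually_atTop.1 (eventually_ceil_pow_succ_le hθ)
  refine outCap_eq_zero_of_subset fun ε hε => ?_
  obtain ⟨N, hN⟩ : ∃ N, ∑' j, a (j + N) ≤ ε :=
    ((ENNReal.tendsto_sum_nat_add a ha.ne).eventually_le_const hε).exists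
  refine ⟨fun j => {ω | (fun i : Fin (m (j + N)) => Y i ω) ∈ A (j + N)}, fun j => ?_, ?_,
    (ENNReal.tsum_le_tsum fun j => hcap (j + N)).trans hN⟩
  · have : {ω | (fun i : Fin (m (j + N)) => Y i ω) ∈ A (j + N)} = ⋃ n ∈ Iic (m (j + N)),
        {ω | s₂ * lilNorm (m (j + N)) ≤ |∑ i ∈ Finset.range n, Y i ω|} := by
      ext ω
      simp only [mem_ofPred_eq, hA, mem_iUnion, mem_Iic, exists_prop]
    change MeasurableSet {ω | (fun i : Fin (m (j + N)) => Y i ω) ∈ A (j + N)}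
    rw [this]
    refine MeasurableSet.biUnion (to_countable _) fun n _ => measurableSet_le measurable_const ?_
    exact (Finset.measurable_sum _ fun i _ => S.measurable_of_mem _ (hY i)).abs
  · intro ω hω
    set j₀ := max N N₀ with hj₀
    obtain ⟨n, hn, h⟩ := (frequently_atTop.1 hω) (m j₀)
    have hex : ∃ j, n ≤ m j := ((tendsto_ceil_pow hθ).eventually_ge_atTop n).exists
    classical
    rcases hn.eq_or_lt with heq | hlt
    · refine mem_iUnion.2 ⟨j₀ - N, ?_⟩
      rw [mem_ofPred_eq, hA, Nat.sub_add_cancel (le_max_left _ _)]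
      refine ⟨n, heq.ge, le_trans ?_ h⟩
      rw [heq]
      have := hd0 j₀
      have h0 : 0 ≤ lilNorm n := lilScale_nonneg _
      gcongr
    · set j := Nat.find hex with hj
      have hjn : n ≤ m j := Nat.find_spec hex
      have hj₀j : j₀ < j := by
        by_contra! hle
        have : m j ≤ m j₀ := Nat.ceil_mono (pow_le_pow_right₀ hθ.le hle)
        omega
      obtain ⟨i, hi⟩ : ∃ i, j = i + 1 := ⟨j - 1, by omega⟩
      have hin : m i < n := by
        have := Nat.find_min hex (m := i) (by omega)
        omega
      refine mem_iUnion.2 ⟨j - N, ?_⟩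
      have hNj : N ≤ j := (le_max_left _ _).trans hj₀j.le
      rw [mem_ofPred_eq, hA, Nat.sub_add_cancel hNj]
      refine ⟨n, hjn, le_trans ?_ h⟩
      have h1 : (m j : ℝ) ≤ θ ^ 2 * m i := by
        rw [hi]
        exact hN₀ i (by have := le_max_right N N₀; omega)
      have h2 : lilNorm (m j) ≤ θ ^ 2 * lilNorm n := by
        calc lilNorm (m j) ≤ lilScale (θ ^ 2 * m i) := lilScale_mono (Nat.cast_nonneg _) h1
          _ ≤ θ ^ 2 * lilScale (m i) := lilScale_mul_le (one_le_pow₀ hθ.le) (Nat.cast_nonneg _)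
          _ ≤ _ := by
            gcongr
            exact lilScale_mono (Nat.cast_nonneg _) (by exact_mod_cast hin.le)
      calc s₂ * lilNorm (m j) ≤ s₂ * (θ ^ 2 * lilNorm n) := by gcongr
        _ = s * lilNorm n := by rw [hθ2]; field_simp

end SublinearExpectationSpace

/-! ### The conditions (M), (Z) and `σ̄` in terms of the marginal laws. -/

theorem lintegral_Ioi_comp_mul (u : ℝ → ℝ≥0∞) {a : ℝ} (ha : 0 < a) :
    ∫⁻ t in Ioi (0 : ℝ), u (a * t) = ENNReal.ofReal a⁻¹ * ∫⁻ t in Ioi (0 : ℝ), u t := by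
  have h1 := lintegral_map_equiv (μ := (volume : Measure ℝ)) ((Ioi (0 : ℝ)).indicator u)
    (MeasurableEquiv.mulLeft₀ a ha.ne')
  have h2 : (volume : Measure ℝ).map (MeasurableEquiv.mulLeft₀ a ha.ne') =
      ENNReal.ofReal |a⁻¹| • volume := Real.map_volume_mul_left ha.ne'
  rw [h2, lintegral_smul_measure, lintegral_indicator measurableSet_Ioi,
    abs_of_pos (inv_pos.2 ha)] at h1
  rw [← smul_eq_mul, h1, ← lintegral_indicator measurableSet_Ioi]
  refine lintegral_congr fun t => ?_
  change _ = (Ioi (0 : ℝ)).indicator u (a * t)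
  by_cases ht : 0 < t
  · rw [indicator_of_mem (by exact ht), indicator_of_mem (by exact mul_pos ha ht)]
  · rw [indicator_of_notMem (by exact ht), indicator_of_notMem]
    rw [mem_Ioi, mul_pos_iff_of_pos_left ha]
    exact ht

theorem lintegral_Ioi_le_tsum {u : ℝ → ℝ≥0∞} (hu : AntitoneOn u (Ici 0)) :
    ∫⁻ t in Ioi (0 : ℝ), u t ≤ ∑' n : ℕ, u n := by
  calc ∫⁻ t in Ioi (0 : ℝ), u t ≤ ∫⁻ t in ⋃ n : ℕ, Ioc (n : ℝ) (n + 1), u t := by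
        refine lintegral_mono_set fun t ht => ?_
        have h1 : 0 < ⌈t⌉₊ := Nat.ceil_pos.2 ht
        refine mem_iUnion.2 ⟨⌈t⌉₊ - 1, ?_, ?_⟩
        · exact Nat.lt_ceil.1 (by omega)
        · have := Nat.le_ceil t
          rw [Nat.cast_sub h1]
          simpa using this
    _ ≤ ∑' n : ℕ, ∫⁻ t in Ioc (n : ℝ) (n + 1), u t := lintegral_iUnion_le _ _
    _ ≤ ∑' n : ℕ, u n := by
        refine ENNReal.tsum_le_tsum fun n => ?_
        have : ∫⁻ t in Ioc (n : ℝ) (n + 1), u t ≤ ∫⁻ _ in Ioc (n : ℝ) (n + 1), u n :=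
          setLIntegral_mono' measurableSet_Ioc fun t ht =>
            hu (mem_Ici.2 (Nat.cast_nonneg n)) ((Nat.cast_nonneg n).trans ht.1.le) ht.1.le
        rwa [setLIntegral_const, Real.volume_Ioc, add_sub_cancel_left, ENNReal.ofReal_one,
          mul_one] at this

theorem tendsto_llog_div : Tendsto (fun c => llog c / c) atTop (𝓝 0) := by
  have h1 : Tendsto (fun c : ℝ => 2 / Real.sqrt c) atTop (𝓝 0) :=
    Real.tendsto_sqrt_atTop.const_div_atTop 2
  refine squeeze_zero' ?_ ?_ h1
  · filter_upwards [eventually_ge_atTop 0] with c hc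
    exact div_nonneg (llog_pos c).le hc
  · filter_upwards [eventually_ge_atTop 1] with c hc
    have h2 := llog_le_two_mul_sqrt (zero_le_one.trans hc)
    have h3 := llog_le_max (Real.sqrt c)
    rw [max_eq_right (Real.one_le_sqrt.2 hc)] at h3
    rw [div_le_div_iff₀ (by linarith) (Real.sqrt_pos.2 (by linarith))]
    have h4 := Real.mul_self_sqrt (zero_le_one.trans hc)
    nlinarith [Real.sqrt_nonneg c]

/-- For `|x| > c`, `llog |x|` exceeds `llog c` at most by the factor `|x| / c`. After integration
this is uniform integrability of the marginal laws with rate `llog c / c`. -/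
theorem abs_sub_clip_le_llog {c : ℝ} (hc : 1 ≤ c) (x : ℝ) :
    |x - clip c x| ≤ llog c / c * (x ^ 2 / llog |x|) := by
  have hc0 : 0 < c := by linarith
  have hl := llog_pos |x|
  rcases le_or_gt |x| c with h | h
  · rw [clip_of_abs_le h, sub_self, abs_zero]
    have := llog_pos c
    positivity
  · refine (abs_sub_clip_le hc0.le x).trans ?_
    have h1 : llog |x| ≤ |x| / c * llog c := by
      have := llog_mul_le c (c := |x| / c) ((one_le_div hc0).2 h.le)
      rwa [div_mul_cancel₀ _ hc0.ne'] at this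
    rw [div_mul_div_comm, le_div_iff₀ (by positivity), ← sq_abs x]
    calc |x| * (c * llog |x|) ≤ |x| * (c * (|x| / c * llog c)) := by gcongr
      _ = _ := by field_simp

section uniform

variable {μ : Measure ℝ} [IsProbabilityMeasure μ] {C : ℝ} (hC : 0 ≤ C)
  (h : ∫⁻ x, ENNReal.ofReal (x ^ 2 / llog |x|) ∂μ ≤ ENNReal.ofReal C)
include h

omit [IsProbabilityMeasure μ] in
theorem integrable_sq_div_llog : Integrable (fun x : ℝ => x ^ 2 / llog |x|) μ := by
  have hl : Measurable llog := llog_mono.measurable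
  have hm : Measurable fun x : ℝ => x ^ 2 / llog |x| := by fun_prop
  refine ⟨hm.aestronglyMeasurable, ?_⟩
  rw [hasFiniteIntegral_iff_ofReal (Eventually.of_forall fun x =>
    div_nonneg (sq_nonneg x) (llog_pos _).le)]
  exact h.trans_lt ENNReal.ofReal_lt_top

theorem integrable_id_of_sq_div_llog : Integrable (fun x : ℝ => x) μ := by
  have h1 := ((integrable_sq_div_llog h).const_mul (llog 1 / 1)).add (integrable_const (1 : ℝ))
  refine h1.mono' (by fun_prop) (Eventually.of_forall fun x => ?_)
  have h2 := abs_sub_clip_le_llog le_rfl x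
  have h3 := abs_clip_le zero_le_one x
  have h4 := abs_sub_abs_le_abs_sub x (clip 1 x)
  simp only [Real.norm_eq_abs, Pi.add_apply]
  linarith

include hC

omit [IsProbabilityMeasure μ] in
theorem integral_abs_sub_clip_le_llog {c : ℝ} (hc : 1 ≤ c) :
    ∫ x, |x - clip c x| ∂μ ≤ C * (llog c / c) := by
  have h1 := integrable_sq_div_llog h
  have h2 : ∫ x, x ^ 2 / llog |x| ∂μ ≤ C := by
    rw [integral_eq_lintegral_of_nonneg_ae (Eventually.of_forall fun x =>
      div_nonneg (sq_nonneg x) (llog_pos _).le) h1.aestronglyMeasurable]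
    exact ENNReal.toReal_le_of_le_ofReal hC h
  have h3 := llog_pos c
  calc ∫ x, |x - clip c x| ∂μ ≤ ∫ x, llog c / c * (x ^ 2 / llog |x|) ∂μ :=
        integral_mono_of_nonneg (Eventually.of_forall fun x => abs_nonneg _)
          (h1.const_mul _) (Eventually.of_forall fun x => abs_sub_clip_le_llog hc x)
    _ = llog c / c * ∫ x, x ^ 2 / llog |x| ∂μ := integral_const_mul _ _
    _ ≤ llog c / c * C := by gcongr
    _ = _ := mul_comm _ _

theorem abs_integral_sub_integral_clip_le {c : ℝ} (hc : 1 ≤ c) :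
    |∫ x, x ∂μ - ∫ x, clip c x ∂μ| ≤ C * (llog c / c) := by
  have h1 : Integrable (clip c) μ := .of_bound (measurable_clip c).aestronglyMeasurable c
    (Eventually.of_forall fun x => abs_clip_le (by linarith) x)
  rw [← integral_sub (integrable_id_of_sq_div_llog h) h1]
  exact (abs_integral_le_integral_abs).trans (integral_abs_sub_clip_le_llog hC h hc)

end uniform

namespace SublinearExpectationSpace

variable {Ω : Type*} [MeasurableSpace Ω] {S : SublinearExpectationSpace Ω}

/-- The variable is nonnegative and the whole space has capacity one, so negative levels contribute
nothing. -/
theorem momentCond_iff {𝕍 : Set Ω → ℝ≥0∞} (hcap : IsCapacity 𝕍) (X : Ω → ℝ) :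
    MomentCond 𝕍 X ↔ ∫⁻ t in Ioi (0 : ℝ), 𝕍 {ω | t ≤ X ω ^ 2 / llog |X ω|} < ⊤ := by
  have h1 : ∫⁻ t in Iio (0 : ℝ), (1 - 𝕍 {ω | t ≤ X ω ^ 2 / llog |X ω|}) = 0 := by
    rw [setLIntegral_congr_fun (g := fun _ => 0) measurableSet_Iio fun t ht => ?_, lintegral_zero]
    have : {ω | t ≤ X ω ^ 2 / llog |X ω|} = univ := eq_univ_of_forall fun ω =>
      (mem_Iio.1 ht).le.trans (div_nonneg (sq_nonneg _) (llog_pos _).le)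
    rw [this, hcap.univ, tsub_self]
  change ((∫⁻ t in Ioi (0 : ℝ), 𝕍 {ω | t ≤ X ω ^ 2 / llog |X ω|} : ℝ≥0∞) : EReal) -
    ((∫⁻ t in Iio (0 : ℝ), (1 - 𝕍 {ω | t ≤ X ω ^ 2 / llog |X ω|}) : ℝ≥0∞) : EReal) < ⊤ ↔ _
  rw [h1, EReal.coe_ennreal_zero, sub_zero, ← EReal.coe_ennreal_top, EReal.coe_ennreal_lt_coe_ennreal_iff]

theorem prob_of_mem_marginalLaws {X : Ω → ℝ} : ∀ μ ∈ S.marginalLaws X, IsProbabilityMeasure μ :=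
  fun _ h => h.1

theorem integrable_of_isCBLip {μ : Measure ℝ} [IsProbabilityMeasure μ] {φ : ℝ → ℝ}
    (hφ : IsCBLip φ) : Integrable φ μ := by
  obtain ⟨_, M, _, _, _, hM⟩ := hφ.exists_bounds
  exact .of_bound hφ.continuous.aestronglyMeasurable M (Eventually.of_forall hM)

/-- `tailFun r` dominates the indicator at level `r` and lies below the one at level `r / 2`.
Together with `cap_le_tailSup`, the tails of `𝕍` and of the marginal laws agree up to a factor two
in the level. -/
theorem tailSup_le_cap {𝕍 : Set Ω → ℝ≥0∞} (hdom : S.Dominates 𝕍) {X : Ω → ℝ} (hX : X ∈ S.H)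
    {r : ℝ} (hr : 0 < r) : tailSup (S.marginalLaws X) r ≤ 𝕍 {ω | r / 2 ≤ |X ω|} := by
  refine iSup₂_le fun μ hμ => ?_
  have := hμ.1
  have hφ := isCBLip_tailFun hr
  have hb := S.comp_mem_Hb_one hX hφ
  have hA : MeasurableSet {ω | r / 2 ≤ |X ω|} :=
    measurableSet_le measurable_const (S.measurable_of_mem X hX).abs
  have h1 := (hdom _ hA _ hb.1 (fun _ => 1) (S.const_mem 1) (fun ω => ?_) fun ω => ?_).1
  · rw [← S.coe_toReal_E hb] at h1
    calc μ {x | r ≤ |x|} = ∫⁻ x, {x | r ≤ |x|}.indicator 1 x ∂μ :=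
          (lintegral_indicator_one (measurableSet_abs_ge r)).symm
      _ ≤ ∫⁻ x, ENNReal.ofReal (tailFun r x) ∂μ := lintegral_mono fun x => le_tailFun hr x
      _ = ENNReal.ofReal (∫ x, tailFun r x ∂μ) :=
          (ofReal_integral_eq_lintegral_ofReal (integrable_of_isCBLip hφ)
            (Eventually.of_forall (tailFun_nonneg r))).symm
      _ ≤ ENNReal.ofReal (S.E fun ω => tailFun r (X ω)).toReal := ENNReal.ofReal_le_ofReal (hμ.2 _ hφ)
      _ ≤ _ := by
          rw [← EReal.coe_ennreal_le_coe_ennreal_iff, EReal.coe_ennreal_ofReal,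
            EReal.coe_strictMono.monotone.map_max]
          exact max_le h1 (EReal.coe_ennreal_nonneg _)
  · have h2 := tailFun_le hr (X ω)
    by_cases hω : r / 2 ≤ |X ω|
    · rw [indicator_of_mem (by exact hω)]
      exact max_le zero_le_one (min_le_right _ _)
    · rw [indicator_of_notMem (by exact hω)] at h2 ⊢
      exact ENNReal.ofReal_eq_zero.1 (le_antisymm h2 bot_le)
  · exact indicator_le_self' (fun _ _ => zero_le_one) ω

variable {Pfam : Set (@Measure Ω S.sigmaH)} (hCC : S.CC Pfam) {Y : ℕ → Ω → ℝ} (hY : ∀ n, Y n ∈ S.H)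

theorem tailIntegrable_of_momentCond {𝕍 : Set Ω → ℝ≥0∞} (hcap : IsCapacity 𝕍)
    (hdom : S.Dominates 𝕍) {X : Ω → ℝ} (hX : X ∈ S.H) (h : MomentCond 𝕍 X) :
    TailIntegrable (S.marginalLaws X) := by
  intro δ hδ
  rw [momentCond_iff hcap] at h
  set c := min (2 * (δ / 2) ^ 2) 1 with hc
  have hc0 : 0 < c := lt_min (by positivity) one_pos
  have hXm := S.measurable_of_mem X hX
  have hl : Measurable llog := llog_mono.measurable
  have hset : ∀ t, MeasurableSet {ω | t ≤ X ω ^ 2 / llog |X ω|} := fun t =>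
    measurableSet_le measurable_const ((hXm.pow_const 2).div (hl.comp hXm.abs))
  calc ∫⁻ t in Ioi (0 : ℝ), tailSup (S.marginalLaws X) (δ * lilScale t)
      ≤ ∫⁻ t in Ioi (0 : ℝ), ((Ioc (0 : ℝ) 1).indicator 1 t +
          𝕍 {ω | c * t ≤ X ω ^ 2 / llog |X ω|}) := by
        refine setLIntegral_mono' measurableSet_Ioi fun t ht => ?_
        rcases le_or_gt t 1 with h1 | h1
        · rw [indicator_of_mem (by exact ⟨ht, h1⟩)]
          exact (tailSup_le_one prob_of_mem_marginalLaws _).trans le_self_add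
        · refine le_trans ?_ le_add_self
          refine (tailSup_le_cap hdom hX (mul_pos hδ (lilScale_pos ht))).trans
            (hcap.mono _ _ (measurableSet_le measurable_const hXm.abs) (hset _) fun ω hω => ?_)
          refine le_sq_div_llog h1.le (half_pos hδ) ?_
          have : δ * lilScale t / 2 ≤ |X ω| := hω
          linarith
    _ = 1 + ENNReal.ofReal c⁻¹ * ∫⁻ t in Ioi (0 : ℝ), 𝕍 {ω | t ≤ X ω ^ 2 / llog |X ω|} := by
        rw [lintegral_add_left (measurable_one.indicator measurableSet_Ioc),
          lintegral_Ioi_comp_mul (fun t => 𝕍 {ω | t ≤ X ω ^ 2 / llog |X ω|}) hc0,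
          lintegral_indicator_one measurableSet_Ioc,
          Measure.restrict_apply measurableSet_Ioc, inter_eq_left.2 Ioc_subset_Ioi_self]
        simp
    _ < ⊤ := ENNReal.add_lt_top.2 ⟨ENNReal.one_lt_top,
        ENNReal.mul_lt_top ENNReal.ofReal_lt_top h⟩

include hCC hY

theorem cap_le_tailSup {𝕍 : Set Ω → ℝ≥0∞} (hdom : S.Dominates 𝕍) {r : ℝ} (hr : 0 < r) :
    𝕍 {ω | r ≤ |Y 0 ω|} ≤ tailSup (S.marginalLaws (Y 0)) (r / 2) := by
  have hφ := isCBLip_tailFun hr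
  have hb := S.comp_mem_Hb_one (hY 0) hφ
  have hA : MeasurableSet {ω | r ≤ |Y 0 ω|} :=
    measurableSet_le measurable_const (S.measurable_of_mem _ (hY 0)).abs
  have hfin : tailSup (S.marginalLaws (Y 0)) (r / 2) ≠ ⊤ :=
    ((tailSup_le_one prob_of_mem_marginalLaws _).trans_lt ENNReal.one_lt_top).ne
  have h1 := (hdom _ hA 0 S.H.zero_mem _ hb.1 (fun ω => indicator_nonneg (fun _ _ => zero_le_one) ω)
    fun ω => ?_).2
  · have h2 := toReal_E_le_of_marginalLaws hCC hY hφ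
      (c := (tailSup (S.marginalLaws (Y 0)) (r / 2)).toReal) fun μ hμ => by
        have := hμ.1
        have h3 := lintegral_tailFun_le prob_of_mem_marginalLaws hμ hr
        rw [ENNReal.coe_toNNReal hfin] at h3
        rw [integral_eq_lintegral_of_nonneg_ae (Eventually.of_forall (tailFun_nonneg r))
          hφ.continuous.aestronglyMeasurable]
        exact ENNReal.toReal_mono hfin h3
    rw [← S.coe_toReal_E hb] at h1
    rw [← EReal.coe_ennreal_le_coe_ennreal_iff, ← EReal.coe_toReal (x := ((tailSup (S.marginalLaws (Y 0)) (r / 2) : ℝ≥0∞) : EReal)) (by simpa using hfin) (EReal.coe_ennreal_ne_bot _)]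
    refine h1.trans (EReal.coe_le_coe_iff.2 ?_)
    simpa using h2
  · have h2 := le_tailFun hr (Y 0 ω)
    by_cases hω : r ≤ |Y 0 ω|
    · rw [indicator_of_mem (by exact hω)] at h2 ⊢
      simpa using h2
    · rw [indicator_of_notMem (by exact hω)]
      exact tailFun_nonneg _ _

theorem momentCond_of_tsum_lt_top {𝕍 : Set Ω → ℝ≥0∞} (hcap : IsCapacity 𝕍)
    (hdom : S.Dominates 𝕍) {c : ℝ} (hc : 0 < c)
    (h : ∑' n : ℕ, tailSup (S.marginalLaws (Y 0)) (c * lilNorm n) < ⊤) : MomentCond 𝕍 (Y 0) := by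
  rw [momentCond_iff hcap]
  set M := S.marginalLaws (Y 0)
  -- Dilating time by `K` raises the scale at least by `√K ≥ 4 c`, so any `c` can be traded for the
  -- level `lilScale t / 4`. The factor four is the product of the losses in `sq_div_llog_ge` and
  -- `cap_le_tailSup`.
  set K := max 1 ((4 * c) ^ 2) with hK
  have hK1 : 1 ≤ K := le_max_left _ _
  have hK0 : 0 < K := by linarith
  have hKc : 4 * c ≤ Real.sqrt K := Real.le_sqrt_of_sq_le (le_max_right _ _)
  have hXm := S.measurable_of_mem _ (hY 0)
  have hl : Measurable llog := llog_mono.measurable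
  have h1 : ∫⁻ t in Ioi (0 : ℝ), tailSup M (lilScale t / 4) ≤
      ENNReal.ofReal K * ∑' n : ℕ, tailSup M (c * lilNorm n) := by
    have h2 : ∫⁻ t in Ioi (0 : ℝ), tailSup M (lilScale (K * t) / 4) ≤
        ∑' n : ℕ, tailSup M (c * lilNorm n) := by
      refine le_trans ?_ (lintegral_Ioi_le_tsum (tailSup_lilScale_antitoneOn M hc))
      refine setLIntegral_mono' measurableSet_Ioi fun t ht => tailSup_anti M ?_
      have h3 := sqrt_mul_lilScale_le hK1 (mem_Ioi.1 ht).le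
      nlinarith [lilScale_nonneg t]
    rw [lintegral_Ioi_comp_mul (fun t => tailSup M (lilScale t / 4)) hK0] at h2
    calc _ = ENNReal.ofReal K * (ENNReal.ofReal K⁻¹ *
          ∫⁻ t in Ioi (0 : ℝ), tailSup M (lilScale t / 4)) := by
          rw [← mul_assoc, ← ENNReal.ofReal_mul hK0.le, mul_inv_cancel₀ hK0.ne',
            ENNReal.ofReal_one, one_mul]
      _ ≤ _ := by gcongr
  refine lt_of_le_of_lt ?_ (h1.trans_lt (ENNReal.mul_lt_top ENNReal.ofReal_lt_top h))
  refine setLIntegral_mono' measurableSet_Ioi fun t ht => ?_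
  have ht0 : 0 < t := ht
  refine (hcap.mono _ {ω | lilScale t / 2 ≤ |Y 0 ω|}
    (measurableSet_le measurable_const ((hXm.pow_const 2).div (hl.comp hXm.abs)))
    (measurableSet_le measurable_const hXm.abs) fun ω hω => sq_div_llog_ge ht0 hω).trans ?_
  have := cap_le_tailSup hCC hY hdom (half_pos (lilScale_pos ht0))
  rwa [div_div, show (2 : ℝ) * 2 = 4 by norm_num] at this

theorem nonempty_marginalLaws : (S.marginalLaws (Y 0)).Nonempty := by
  obtain ⟨Q, hQ, -⟩ := exists_mem_pathLaws_lt_integral hCC hY (d := 0) (φ := fun _ => 0)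
    (IsCBLip.const 0) (a := -1) (by rw [S.toReal_E_const]; norm_num)
  exact ⟨_, map_eval_mem_marginalLaws hCC hY hQ⟩

omit hCC hY in
theorem isCBLip_clip_const_mul (c s : ℝ) : IsCBLip (fun x : ℝ => clip c (s * x)) :=
  (isCBLip_clip c).comp_lipschitz (g := fun x : ℝ => s * x) (K := ‖s‖₊) fun x y => by
    rw [← mul_sub, norm_mul]
    rfl

omit hCC hY in
theorem abs_integral_mul_sub_le {μ : Measure ℝ} [IsProbabilityMeasure μ] {C : ℝ} (hC : 0 ≤ C)
    (h : ∫⁻ x, ENNReal.ofReal (x ^ 2 / llog |x|) ∂μ ≤ ENNReal.ofReal C) {s : ℝ} (hs : |s| = 1)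
    {c : ℝ} (hc : 1 ≤ c) :
    |s * ∫ x, x ∂μ - ∫ x, clip c (s * x) ∂μ| ≤ C * (llog c / c) := by
  have hm : Measurable fun x : ℝ => s * x := by fun_prop
  have := Measure.isProbabilityMeasure_map (μ := μ) hm.aemeasurable
  have hl : Measurable llog := llog_mono.measurable
  have h1 := abs_integral_sub_integral_clip_le (μ := μ.map fun x => s * x) hC (c := c) (by
    rw [lintegral_map (by fun_prop) hm]
    simpa only [mul_pow, ← sq_abs s, abs_mul, hs, one_pow, one_mul] using h) hc
  rwa [integral_map hm.aemeasurable (by fun_prop), integral_map hm.aemeasurable (by fun_prop),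
    integral_const_mul] at h1

section mean

variable {C : ℝ} (hC : 0 ≤ C)
  (h : ∀ μ ∈ S.marginalLaws (Y 0),
    ∫⁻ x, ENNReal.ofReal (x ^ 2 / llog |x|) ∂μ ≤ ENNReal.ofReal C)
include hC h

omit hCC hY in
theorem mul_integral_nonpos_of_hasTruncE {s : ℝ} (hs : |s| = 1)
    (hE : S.HasTruncE (fun ω => s * Y 0 ω) 0) {μ : Measure ℝ} (hμ : μ ∈ S.marginalLaws (Y 0)) :
    s * ∫ x, x ∂μ ≤ 0 := by
  have := hμ.1
  have h1 : Tendsto (fun c => (S.E fun ω => clip c (s * Y 0 ω)).toReal) atTop (𝓝 0) :=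
    (EReal.tendsto_toReal EReal.zero_ne_top EReal.zero_ne_bot).comp hE
  have h2 := h1.add (tendsto_llog_div.const_mul C)
  rw [mul_zero, add_zero] at h2
  refine ge_of_tendsto h2 ?_
  filter_upwards [eventually_ge_atTop 1] with c hc
  have h3 := hμ.2 _ (isCBLip_clip_const_mul c s)
  have h4 := (abs_le.1 (abs_integral_mul_sub_le hC (h μ hμ) hs hc)).2
  linarith

theorem hasTruncE_zero_of_integral_eq_zero {s : ℝ} (hs : |s| = 1)
    (hM : ∀ μ ∈ S.marginalLaws (Y 0), ∫ x, x ∂μ = 0) : S.HasTruncE (fun ω => s * Y 0 ω) 0 := by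
  have h2 : Tendsto (fun c => (S.E fun ω => clip c (s * Y 0 ω)).toReal) atTop (𝓝 0) := by
    have h3 := tendsto_llog_div.const_mul C
    rw [mul_zero] at h3
    refine squeeze_zero_norm' ?_ h3
    filter_upwards [eventually_ge_atTop 1] with c hc
    have h4 : ∀ μ ∈ S.marginalLaws (Y 0), |∫ x, clip c (s * x) ∂μ| ≤ C * (llog c / c) :=
      fun μ hμ => by
        have := hμ.1
        have := abs_integral_mul_sub_le hC (h μ hμ) hs hc
        rwa [hM μ hμ, mul_zero, zero_sub, abs_neg] at this
    rw [Real.norm_eq_abs, abs_le]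
    obtain ⟨μ, hμ⟩ := nonempty_marginalLaws hCC hY
    refine ⟨(abs_le.1 (h4 μ hμ)).1.trans (hμ.2 _ (isCBLip_clip_const_mul c s)),
      toReal_E_le_of_marginalLaws hCC hY (isCBLip_clip_const_mul c s) fun ν hν =>
        (abs_le.1 (h4 ν hν)).2⟩
  have h3 : Tendsto (fun c => (((S.E fun ω => clip c (s * Y 0 ω)).toReal : ℝ) : EReal)) atTop
      (𝓝 ((0 : ℝ) : EReal)) := (continuous_coe_real_ereal.tendsto 0).comp h2
  refine h3.congr fun c => ?_
  exact S.coe_toReal_E (S.comp_mem_Hb_one (hY 0) (isCBLip_clip_const_mul c s))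

/-- By uniform integrability the truncated means converge to the true ones uniformly over the
family. The signs `s = 1` and `s = -1` give the two inequalities for each mean. -/
theorem meanZero_iff : S.MeanZero (Y 0) ↔ ∀ μ ∈ S.marginalLaws (Y 0), ∫ x, x ∂μ = 0 := by
  have e1 : (fun ω => 1 * Y 0 ω) = Y 0 := by ext; simp
  have e2 : (fun ω => (-1) * Y 0 ω) = -Y 0 := by ext; simp
  refine ⟨fun ⟨h1, h2⟩ μ hμ => ?_, fun hM => ⟨?_, ?_⟩⟩
  · rw [← e1] at h1
    rw [← e2] at h2
    have h3 := mul_integral_nonpos_of_hasTruncE hC h (by simp) h1 hμ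
    have h4 := mul_integral_nonpos_of_hasTruncE hC h (by simp) h2 hμ
    linarith
  · rw [← e1]
    exact hasTruncE_zero_of_integral_eq_zero hCC hY hC h (by simp) hM
  · rw [← e2]
    exact hasTruncE_zero_of_integral_eq_zero hCC hY hC h (by simp) hM

end mean

omit [MeasurableSpace Ω] hCC hY in
theorem truncRV_sq {c : ℝ} (hc : 0 ≤ c) (X : Ω → ℝ) :
    truncRV c (fun ω => X ω ^ 2) = fun ω => clip (Real.sqrt c) (X ω) * clip (Real.sqrt c) (X ω) := by
  funext ω
  have h0 := Real.sqrt_nonneg c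
  have h1 := Real.mul_self_sqrt hc
  simp only [truncRV, clip]
  rw [max_eq_right (le_min (by nlinarith [sq_nonneg (X ω)]) (by linarith))]
  rcases le_total |X ω| (Real.sqrt c) with h | h
  · have h2 := abs_le.1 h
    rw [min_eq_left h2.2, max_eq_right h2.1, min_eq_left (by nlinarith [sq_abs (X ω), abs_nonneg (X ω)])]
    ring
  · rw [min_eq_right (by nlinarith [sq_abs (X ω), abs_nonneg (X ω)])]
    rcases le_abs.1 h with h2 | h2
    · rw [min_eq_right h2, max_eq_right (by linarith), h1]
    · rw [min_eq_left (by linarith), max_eq_left (by linarith)]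
      linarith

omit hCC hY in
theorem isCBLip_clip_sq (r : ℝ) : IsCBLip (fun x : ℝ => clip r x * clip r x) :=
  (isCBLip_clip r).mul (isCBLip_clip r)

theorem sigmaBar_sq_le {w : ℝ≥0∞}
    (h : ∀ μ ∈ S.marginalLaws (Y 0), ∫⁻ x, ENNReal.ofReal (x ^ 2) ∂μ ≤ w) :
    S.sigmaBar (Y 0) ^ 2 ≤ w := by
  rcases eq_or_ne w ⊤ with rfl | hw
  · exact le_top
  rw [← EReal.coe_ennreal_le_coe_ennreal_iff]
  refine le_of_tendsto (S.hasTruncE_sq (hY 0)) ?_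
  filter_upwards [eventually_ge_atTop 0] with c hc
  have hφ := isCBLip_clip_sq (Real.sqrt c)
  rw [truncRV_sq hc, ← S.coe_toReal_E (S.comp_mem_Hb_one (hY 0) hφ), ← ENNReal.ofReal_toReal hw,
    EReal.coe_ennreal_ofReal, max_eq_left ENNReal.toReal_nonneg, EReal.coe_le_coe_iff]
  refine toReal_E_le_of_marginalLaws hCC hY hφ fun μ hμ => ?_
  have := hμ.1
  rw [integral_eq_lintegral_of_nonneg_ae (Eventually.of_forall fun x => mul_self_nonneg _)
    hφ.continuous.aestronglyMeasurable]
  refine ENNReal.toReal_mono hw ((lintegral_mono fun x => ENNReal.ofReal_le_ofReal ?_).trans (h μ hμ))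
  have := abs_clip_le_abs (Real.sqrt_nonneg c) x
  rw [← sq_abs x, ← abs_mul_abs_self (clip _ _)]
  nlinarith [abs_nonneg (clip (Real.sqrt c) x)]

omit hCC in
theorem lintegral_sq_le_sigmaBar_sq {μ : Measure ℝ} (hμ : μ ∈ S.marginalLaws (Y 0)) :
    ∫⁻ x, ENNReal.ofReal (x ^ 2) ∂μ ≤ S.sigmaBar (Y 0) ^ 2 := by
  have := hμ.1
  have h1 : ∀ n : ℕ, ∫⁻ x, ENNReal.ofReal (clip n x * clip n x) ∂μ ≤ S.sigmaBar (Y 0) ^ 2 := by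
    intro n
    have hφ := isCBLip_clip_sq (n : ℝ)
    rw [← ofReal_integral_eq_lintegral_ofReal (integrable_of_isCBLip hφ)
      (Eventually.of_forall fun x => mul_self_nonneg _)]
    refine (ENNReal.ofReal_le_ofReal (hμ.2 _ hφ)).trans ?_
    rw [← EReal.coe_ennreal_le_coe_ennreal_iff, EReal.coe_ennreal_ofReal,
      EReal.coe_strictMono.monotone.map_max, S.coe_toReal_E (S.comp_mem_Hb_one (hY 0) hφ)]
    refine max_le (ge_of_tendsto (S.hasTruncE_sq (hY 0)) ?_) (EReal.coe_ennreal_nonneg _)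
    filter_upwards [eventually_ge_atTop ((n : ℝ) ^ 2)] with c hc
    have hc0 : 0 ≤ c := (sq_nonneg _).trans hc
    have hn : (n : ℝ) ≤ Real.sqrt c := Real.le_sqrt_of_sq_le hc
    rw [truncRV_sq hc0]
    refine S.mono _ (S.comp_mem_Hb_one (hY 0) (isCBLip_clip_sq _)).1 _
      (S.comp_mem_Hb_one (hY 0) hφ).1 fun ω => ?_
    have e1 := congrFun (truncRV_sq hc0 (Y 0)) ω
    have e2 := congrFun (truncRV_sq (sq_nonneg (n : ℝ)) (Y 0)) ω
    rw [Real.sqrt_sq (Nat.cast_nonneg n)] at e2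
    beta_reduce at e1 e2 ⊢
    rw [← e1, ← e2]
    exact max_le (le_max_of_le_right (le_min (by nlinarith [sq_nonneg (Y 0 ω)])
      (by nlinarith [sq_nonneg (n : ℝ)]))) (le_max_of_le_right (min_le_min_left _ hc))
  have h2 : ∀ x : ℝ, liminf (fun n : ℕ => ENNReal.ofReal (clip n x * clip n x)) atTop =
      ENNReal.ofReal (x ^ 2) := fun x => by
    refine Tendsto.liminf_eq (tendsto_const_nhds.congr' ?_)
    filter_upwards [eventually_ge_atTop ⌈|x|⌉₊] with n hn
    rw [clip_of_abs_le ((Nat.le_ceil _).trans (by exact_mod_cast hn)), sq]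
  calc ∫⁻ x, ENNReal.ofReal (x ^ 2) ∂μ
      = ∫⁻ x, liminf (fun n : ℕ => ENNReal.ofReal (clip n x * clip n x)) atTop ∂μ := by
        simp only [h2]
    _ ≤ liminf (fun n : ℕ => ∫⁻ x, ENNReal.ofReal (clip n x * clip n x) ∂μ) atTop :=
        lintegral_liminf_le fun n =>
          (isCBLip_clip_sq (n : ℝ)).continuous.measurable.ennreal_ofReal
    _ ≤ _ := (liminf_le_liminf (Eventually.of_forall h1)).trans_eq (liminf_const _)

theorem sigmaBar_sq_eq :
    S.sigmaBar (Y 0) ^ 2 = ⨆ μ ∈ S.marginalLaws (Y 0), ∫⁻ x, ENNReal.ofReal (x ^ 2) ∂μ :=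
  le_antisymm (sigmaBar_sq_le hCC hY fun _ hμ =>
    le_iSup₂ (f := fun (μ : Measure ℝ) (_ : μ ∈ S.marginalLaws (Y 0)) =>
      ∫⁻ x, ENNReal.ofReal (x ^ 2) ∂μ) _ hμ)
    (iSup₂_le fun _ hμ => lintegral_sq_le_sigmaBar_sq hY hμ)

end SublinearExpectationSpace

/-! ### Convolution powers and independent blocks. -/

/-- The `n`-fold convolution power, the law of a sum of `n` independent variables of law `μ`. -/
noncomputable def convPow (μ : Measure ℝ) : ℕ → Measure ℝ
  | 0 => Measure.dirac 0
  | n + 1 => Measure.conv (convPow μ n) μ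

instance isProbabilityMeasure_convPow (μ : Measure ℝ) [IsProbabilityMeasure μ] (n : ℕ) :
    IsProbabilityMeasure (convPow μ n) := by
  induction n with
  | zero => exact Measure.dirac.isProbabilityMeasure
  | succ n ih =>
    rw [convPow]
    infer_instance

theorem convPow_add (μ : Measure ℝ) [IsProbabilityMeasure μ] (m n : ℕ) :
    convPow μ (m + n) = Measure.conv (convPow μ m) (convPow μ n) := by
  induction n with
  | zero => rw [add_zero, convPow, Measure.conv_dirac_zero]
  | succ n ih => rw [← add_assoc, convPow, convPow, ih, Measure.conv_assoc]

theorem convPow_Ici_add_le (μ : Measure ℝ) [IsProbabilityMeasure μ] (m n : ℕ) (a b : ℝ) :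
    convPow μ m (Ici a) * convPow μ n (Ici b) ≤ convPow μ (m + n) (Ici (a + b)) := by
  rw [convPow_add, Measure.conv, Measure.map_apply (by fun_prop) measurableSet_Ici,
    ← Measure.prod_prod]
  refine measure_mono fun p hp => ?_
  have h1 : a ≤ p.1 := hp.1
  have h2 : b ≤ p.2 := hp.2
  exact mem_Ici.2 (add_le_add h1 h2)

theorem convPow_Ici_mul_le (μ : Measure ℝ) [IsProbabilityMeasure μ] (k p : ℕ) (a : ℝ) :
    convPow μ p (Ici a) ^ k ≤ convPow μ (k * p) (Ici (k * a)) := by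
  induction k with
  | zero => simp [convPow]
  | succ k ih =>
    rw [pow_succ, Nat.succ_mul]
    refine (mul_le_mul_left ih _).trans ((convPow_Ici_add_le μ (k * p) p _ _).trans_eq ?_)
    push_cast
    ring_nf

theorem convPow_map_neg (μ : Measure ℝ) [IsProbabilityMeasure μ] (n : ℕ) :
    convPow (μ.map Neg.neg) n = (convPow μ n).map Neg.neg := by
  induction n with
  | zero => simp [convPow, Measure.map_dirac' measurable_neg]
  | succ n ih =>
    rw [convPow, convPow, ih]
    exact (Measure.map_conv_addMonoidHom (negAddMonoidHom : ℝ →+ ℝ) measurable_neg).symm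

section independence

open ProbabilityTheory

variable {Ω : Type*} [MeasurableSpace Ω] {P : Measure Ω} {X : ℕ → Ω → ℝ}

theorem map_sum_Ico_eq_convPow [IsProbabilityMeasure P] (hX : iIndepFun X P)
    (hm : ∀ i, Measurable (X i)) {μ : Measure ℝ} [IsProbabilityMeasure μ] (a n : ℕ)
    (hμ : ∀ i ∈ Finset.Ico a (a + n), P.map (X i) = μ) :
    P.map (fun ω => ∑ i ∈ Finset.Ico a (a + n), X i ω) = convPow μ n := by
  induction n with
  | zero => simp [convPow, Measure.map_const]
  | succ n ih =>
    have h1 := hX.indepFun_finsetSum_of_notMem hm (s := Finset.Ico a (a + n)) (i := a + n) (by simp)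
    have h2 := h1.map_add_eq_map_conv_map (by fun_prop) (hm _)
    have e : (fun ω => ∑ i ∈ Finset.Ico a (a + n), X i ω) = ∑ i ∈ Finset.Ico a (a + n), X i := by
      ext; simp
    rw [convPow, ← ih fun i hi => hμ i (by simp at hi ⊢; omega), ← hμ (a + n) (by simp), e, ← h2]
    congr 1
    ext ω
    rw [← add_assoc, Finset.sum_Ico_succ_top (by omega)]
    simp

/-- Induction on the largest index: the events of all earlier blocks depend on the coordinates
before `a j` only. -/
theorem iIndepSet_sum_Ico (hX : iIndepFun X P) (hm : ∀ i, Measurable (X i)) {a b : ℕ → ℕ}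
    (hab : ∀ i j, i < j → b i ≤ a j) {B : ℕ → Set ℝ} (hB : ∀ j, MeasurableSet (B j)) :
    iIndepSet (fun j => {ω | ∑ i ∈ Finset.Ico (a j) (b j), X i ω ∈ B j}) P := by
  have := hX.isProbabilityMeasure
  have hA : ∀ j, MeasurableSet {ω | ∑ i ∈ Finset.Ico (a j) (b j), X i ω ∈ B j} := fun j =>
    (Finset.measurable_sum _ fun i _ => hm i) (hB j)
  rw [iIndepSet_iff_meas_biInter hA]
  intro s
  induction s using Finset.induction_on_max with
  | empty => simp
  | insert j s hs ih =>
    have hj : j ∉ s := fun h => lt_irrefl _ (hs j h)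
    rw [Finset.set_biInter_insert, Finset.prod_insert hj, ← ih, inter_comm, mul_comm]
    have h1 := hX.indepFun_finset (Finset.range (a j)) (Finset.Ico (a j) (b j))
      (Finset.disjoint_left.2 fun i hi => by simp at hi ⊢; omega) hm
    have hcoord : ∀ (t : Finset ℕ), ∀ i ∈ t,
        Measurable[MeasurableSpace.comap (fun ω (i : t) => X i ω) inferInstance] (X i) :=
      fun t i hi =>
        Measurable.comp (g := fun f : t → ℝ => f ⟨i, hi⟩) (measurable_pi_apply _)
          (comap_measurable fun ω (i : t) => X i ω)
    refine (Indep_iff _ _ P).1 h1 _ _ ?_ ?_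
    · refine Finset.measurableSet_biInter _ fun i hi => ?_
      refine (Finset.measurable_sum _ fun l hl => hcoord _ l ?_) (hB i)
      have := hab i j (hs i hi)
      simp at hl ⊢
      omega
    · exact (Finset.measurable_sum _ fun l hl => hcoord _ l hl) (hB j)

theorem ae_frequently_sum_Ico (hX : iIndepFun X P) (hm : ∀ i, Measurable (X i)) {a b : ℕ → ℕ}
    (hab : ∀ i j, i < j → b i ≤ a j) {B : ℕ → Set ℝ} (hB : ∀ j, MeasurableSet (B j))
    (hsum : ∑' j, P {ω | ∑ i ∈ Finset.Ico (a j) (b j), X i ω ∈ B j} = ⊤) :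
    ∀ᵐ ω ∂P, ∃ᶠ j in atTop, ∑ i ∈ Finset.Ico (a j) (b j), X i ω ∈ B j := by
  have := hX.isProbabilityMeasure
  have hA : ∀ j, MeasurableSet {ω | ∑ i ∈ Finset.Ico (a j) (b j), X i ω ∈ B j} := fun j =>
    (Finset.measurable_sum _ fun i _ => hm i) (hB j)
  have h1 := measure_limsup_eq_one hA (iIndepSet_sum_Ico hX hm hab hB) hsum
  rw [← prob_compl_eq_zero_iff (MeasurableSet.measurableSet_limsup hA)] at h1
  filter_upwards [compl_mem_ae_iff.2 h1] with ω hω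
  simpa [mem_limsup_iff_frequently_mem] using hω

end independence

/-! ### The central limit theorem as a lower bound for tails. -/

section gaussian

open ProbabilityTheory

theorem exp_le_gaussianReal_Ioi {a : ℝ} (ha : 0 ≤ a) :
    ENNReal.ofReal (Real.exp (-((a + 1) ^ 2 / 2)) / 3) ≤ gaussianReal 0 1 (Ioi a) := by
  rw [gaussianReal_apply 0 one_ne_zero]
  calc ENNReal.ofReal (Real.exp (-((a + 1) ^ 2 / 2)) / 3)
      = ∫⁻ _ in Ioc a (a + 1), ENNReal.ofReal (Real.exp (-((a + 1) ^ 2 / 2)) / 3) := by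
        simp
    _ ≤ ∫⁻ x in Ioc a (a + 1), gaussianPDF 0 1 x := by
        refine setLIntegral_mono' measurableSet_Ioc fun x hx => ENNReal.ofReal_le_ofReal ?_
        have h3 : Real.sqrt (2 * Real.pi * (1 : ℝ≥0)) ≤ 3 := by
          rw [NNReal.coe_one, mul_one]
          refine Real.sqrt_le_iff.2 ⟨by norm_num, ?_⟩
          nlinarith [Real.pi_lt_d2]
        have h4 : 0 < Real.sqrt (2 * Real.pi * (1 : ℝ≥0)) :=
          Real.sqrt_pos.2 (by simp [Real.pi_pos])
        rw [gaussianPDFReal, div_eq_mul_inv, mul_comm]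
        have hx0 : 0 ≤ x := ha.trans hx.1.le
        have h5 : -((a + 1) ^ 2 / 2) ≤ -(x - 0) ^ 2 / (2 * ((1 : ℝ≥0) : ℝ)) := by
          rw [NNReal.coe_one]
          nlinarith [hx.2]
        gcongr
    _ ≤ _ := lintegral_mono_set Ioc_subset_Ioi_self

/-- The limit theorem bounds the liminf over the open half-line by the Gaussian mass. Replacing the
constant three of `exp_le_gaussianReal_Ioi` by four gives the strict inequality that holds for all
large `p`. -/
theorem eventually_convPow_Ici_ge {μ : Measure ℝ} [IsProbabilityMeasure μ] {v : ℝ} (hv : 0 < v)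
    (hvar : ∫ x, x ^ 2 ∂μ = v)
    (hmean : ∫ x, x ∂μ = 0) {a : ℝ} (ha : 0 ≤ a) :
    ∀ᶠ p : ℕ in atTop, ENNReal.ofReal (Real.exp (-((a + 1) ^ 2 / 2)) / 4) ≤
      convPow μ p (Ici (a * Real.sqrt v * Real.sqrt p)) := by
  have hsv : 0 < Real.sqrt v := Real.sqrt_pos.2 hv
  set Q := Measure.infinitePi fun _ : ℕ => μ with hQ
  have hind0 : iIndepFun (fun (i : ℕ) (x : ℕ → ℝ) => x i) Q :=
    iIndepFun_infinitePi (X := fun _ x => x) (fun _ => measurable_id)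
  have hlaw : ∀ i, Q.map (fun x => x i) = μ := fun i => Measure.infinitePi_map_eval _ i
  have hm1 : ∀ i, Measurable fun x : ℕ → ℝ => x i := fun i => measurable_pi_apply i
  let X : ℕ → (ℕ → ℝ) → ℝ := fun i x => (Real.sqrt v)⁻¹ * x i
  have hind : iIndepFun X Q := hind0.comp (fun _ y => (Real.sqrt v)⁻¹ * y) fun _ => by fun_prop
  have hid : ∀ i, IdentDistrib (X i) (X 0) Q Q := fun i =>
    IdentDistrib.comp (u := fun y => (Real.sqrt v)⁻¹ * y)
      ⟨(hm1 i).aemeasurable, (hm1 0).aemeasurable, by rw [hlaw, hlaw]⟩ (by fun_prop)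
  have h0 : ∫ x, X 0 x ∂Q = 0 := by
    have : ∫ x, (Real.sqrt v)⁻¹ * x 0 ∂Q = ∫ y, (Real.sqrt v)⁻¹ * y ∂(Q.map fun x => x 0) := by
      rw [integral_map (hm1 0).aemeasurable (by fun_prop)]
    rw [this, hlaw, integral_const_mul, hmean, mul_zero]
  have h1 : ∫ x, (X 0 ^ 2) x ∂Q = 1 := by
    have : ∫ x, ((Real.sqrt v)⁻¹ * x 0) ^ 2 ∂Q =
        ∫ y, ((Real.sqrt v)⁻¹ * y) ^ 2 ∂(Q.map fun x => x 0) := by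
      rw [integral_map (hm1 0).aemeasurable (by fun_prop)]
    change ∫ x, ((Real.sqrt v)⁻¹ * x 0) ^ 2 ∂Q = 1
    rw [this, hlaw]
    simp only [mul_pow]
    rw [integral_const_mul, hvar, inv_pow, Real.sq_sqrt hv.le, inv_mul_cancel₀ hv.ne']
  have hclt := tendstoInDistribution_inv_sqrt_mul_sum (P' := gaussianReal 0 1) (Y := id)
    ⟨aemeasurable_id, Measure.map_id⟩ h0 h1 hind hid
  have h2 := ProbabilityMeasure.le_liminf_measure_open_of_tendsto hclt.tendsto (isOpen_Ioi (a := a))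
  have h3 : ENNReal.ofReal (Real.exp (-((a + 1) ^ 2 / 2)) / 4) < gaussianReal 0 1 (Ioi a) := by
    refine lt_of_lt_of_le ?_ (exp_le_gaussianReal_Ioi ha)
    have := Real.exp_pos (-((a + 1) ^ 2 / 2))
    exact (ENNReal.ofReal_lt_ofReal_iff (by positivity)).2 (by linarith)
  simp only [ProbabilityMeasure.coe_mk, Measure.map_id] at h2
  have h4 := eventually_lt_of_lt_liminf (h3.trans_le h2)
  filter_upwards [h4, eventually_gt_atTop 0] with p hp hp0
  refine hp.le.trans ?_
  have hsp : 0 < Real.sqrt p := Real.sqrt_pos.2 (by exact_mod_cast hp0)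
  rw [← map_sum_Ico_eq_convPow hind0 hm1 0 p fun i _ => hlaw i,
    Measure.map_apply (Finset.measurable_sum _ fun i _ => hm1 i) measurableSet_Ici,
    Measure.map_apply (by fun_prop) measurableSet_Ioi]
  refine measure_mono fun x hx => ?_
  have hx' : a < (Real.sqrt p)⁻¹ * ∑ i ∈ Finset.range p, (Real.sqrt v)⁻¹ * x i := hx
  rw [← Finset.mul_sum, ← mul_assoc, ← mul_inv, inv_mul_eq_div, lt_div_iff₀ (by positivity)] at hx'
  have : a * Real.sqrt v * Real.sqrt p ≤ ∑ i ∈ Finset.Ico 0 (0 + p), x i := by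
    rw [zero_add, ← Finset.range_eq_Ico]
    linarith
  exact this

end gaussian

/-! ### Sub-blocks when the variance is infinite. -/

open ProbabilityTheory in
-- A one-sided Paley–Zygmund bound: a quartic below the indicator of `[1 / 16, ∞)` is integrated at
-- `T / s`. The linear term makes the quartic nonpositive on the negative axis and has integral
-- zero; the others leave `3 / 64 - 4 / 256 - 1 / 64 = 1 / 64`.
theorem one_div_le_measureReal_of_moments {Ω : Type*} [MeasurableSpace Ω] {P : Measure Ω}
    [IsProbabilityMeasure P] {T : Ω → ℝ} (hT : Measurable T) {B : ℝ} (hB : ∀ ω, |T ω| ≤ B)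
    {s : ℝ} (hs : 0 < s) (h1 : ∫ ω, T ω ∂P = 0) (h2 : ∫ ω, T ω ^ 2 ∂P = s ^ 2)
    (h4 : ∫ ω, T ω ^ 4 ∂P ≤ 4 * s ^ 4) : 1 / 64 ≤ P.real {ω | s / 16 ≤ T ω} := by
  have hint : ∀ k : ℕ, Integrable (fun ω => T ω ^ k) P := fun k =>
    .of_bound (hT.pow_const k).aestronglyMeasurable (B ^ k) (Eventually.of_forall fun ω => by
      rw [norm_pow]
      exact pow_le_pow_left₀ (norm_nonneg _) (hB ω) k)
  have hA : MeasurableSet {ω | s / 16 ≤ T ω} := measurableSet_le measurable_const hT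
  have key : ∀ t : ℝ, 3 / 64 * t ^ 2 - t ^ 4 / 256 + t / 8 - 1 / 64 ≤
      {t : ℝ | 1 / 16 ≤ t}.indicator (fun _ => 1) t := by
    intro t
    by_cases ht : 1 / 16 ≤ t
    · rw [indicator_of_mem (by exact ht)]
      nlinarith [sq_nonneg (t ^ 2 - 8), sq_nonneg (t - 1)]
    · rw [indicator_of_notMem (by exact ht)]
      push Not at ht
      rcases le_total 0 t with h0 | h0
      · have : t ^ 2 ≤ t / 16 := by nlinarith
        have : 0 ≤ t ^ 4 := by positivity
        linarith
      · have : 0 ≤ -t * (t + 2) ^ 2 * (4 - t) := by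
          have : 0 ≤ -t := by linarith
          have : 0 ≤ 4 - t := by linarith
          positivity
        nlinarith
  have e1 : Integrable T P := by simpa using hint 1
  have i2 := ((hint 2).div_const (s ^ 2)).const_mul (3 / 64)
  have i4 := ((hint 4).div_const (s ^ 4)).const_mul (-1 / 256)
  have i1 := (e1.div_const s).const_mul (1 / 8)
  have i0 := integrable_const (μ := P) (-1 / 64 : ℝ)
  have hle : ∫ ω, (3 / 64 * (T ω ^ 2 / s ^ 2) + (-1 / 256 * (T ω ^ 4 / s ^ 4) +
      (1 / 8 * (T ω / s) + -1 / 64))) ∂P ≤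
      ∫ ω, {ω | s / 16 ≤ T ω}.indicator (fun _ => (1 : ℝ)) ω ∂P := by
    refine integral_mono (i2.add (i4.add (i1.add i0))) ((integrable_const 1).indicator hA)
      fun ω => ?_
    have h5 := key (T ω / s)
    rw [div_pow, div_pow] at h5
    have h6 : {t : ℝ | 1 / 16 ≤ t}.indicator (fun _ => (1 : ℝ)) (T ω / s) =
        {ω | s / 16 ≤ T ω}.indicator (fun _ => (1 : ℝ)) ω := by
      have : 1 / 16 ≤ T ω / s ↔ s / 16 ≤ T ω := by
        rw [le_div_iff₀ hs]
        constructor <;> intro h <;> linarith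
      simp only [indicator, mem_ofPred_eq, this]
    rw [← h6]
    linarith
  rw [integral_indicator_const _ hA, smul_eq_mul, mul_one,
    integral_add i2 (i4.fun_add (i1.fun_add i0)), integral_add i4 (i1.fun_add i0),
    integral_add i1 i0, integral_const_mul, integral_const_mul, integral_const_mul, integral_div,
    integral_div, integral_div, h1, h2, div_self (by positivity)] at hle
  have h5 : (∫ ω, T ω ^ 4 ∂P) / s ^ 4 ≤ 4 := (div_le_iff₀ (by positivity)).2 h4
  simp at hle
  linarith

open ProbabilityTheory in
theorem sum_moments {Ω : Type*} [MeasurableSpace Ω] {P : Measure Ω} {X : ℕ → Ω → ℝ}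
    (hX : iIndepFun X P) (hm : ∀ i, Measurable (X i)) {B v w : ℝ} (hB : ∀ i ω, |X i ω| ≤ B)
    (h1 : ∀ i, ∫ ω, X i ω ∂P = 0) (h2 : ∀ i, ∫ ω, X i ω ^ 2 ∂P = v)
    (h4 : ∀ i, ∫ ω, X i ω ^ 4 ∂P ≤ w) (p : ℕ) :
    ∫ ω, ∑ i ∈ Finset.range p, X i ω ∂P = 0 ∧
    ∫ ω, (∑ i ∈ Finset.range p, X i ω) ^ 2 ∂P = p * v ∧
    ∫ ω, (∑ i ∈ Finset.range p, X i ω) ^ 4 ∂P ≤ 3 * p ^ 2 * v ^ 2 + p * w := by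
  have hprob := hX.isProbabilityMeasure
  induction p with
  | zero => simp
  | succ p ih =>
    obtain ⟨i1, i2, i4⟩ := ih
    set S : Ω → ℝ := fun ω => ∑ i ∈ Finset.range p, X i ω with hS
    have hSm : Measurable S := Finset.measurable_sum _ fun i _ => hm i
    have hSB : ∀ ω, |S ω| ≤ p * B := fun ω => by
      refine (Finset.abs_sum_le_sum_abs _ _).trans
        ((Finset.sum_le_sum fun i _ => hB i ω).trans_eq ?_)
      simp
    have hind : IndepFun S (X p) P := by
      have := hX.indepFun_finsetSum_of_notMem hm (s := Finset.range p) (i := p) (by simp)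
      have e : S = ∑ i ∈ Finset.range p, X i := by ext; simp [hS]
      rwa [e]
    have hI : ∀ j k : ℕ, Integrable (fun ω => S ω ^ j * X p ω ^ k) P := fun j k =>
      .of_bound ((hSm.pow_const j).mul ((hm p).pow_const k)).aestronglyMeasurable
        ((p * B) ^ j * B ^ k) (Eventually.of_forall fun ω => by
          rw [norm_mul, norm_pow, norm_pow]
          have := (abs_nonneg _).trans (hSB ω)
          exact mul_le_mul (pow_le_pow_left₀ (norm_nonneg _) (hSB ω) j)
            (pow_le_pow_left₀ (norm_nonneg _) (hB p ω) k) (by positivity) (by positivity))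
    have hprod : ∀ j k : ℕ, ∫ ω, S ω ^ j * X p ω ^ k ∂P = (∫ ω, S ω ^ j ∂P) * ∫ ω, X p ω ^ k ∂P :=
      fun j k => (hind.comp (φ := fun x => x ^ j) (ψ := fun x => x ^ k) (by fun_prop)
        (by fun_prop)).integral_mul_eq_mul_integral (hSm.pow_const j).aestronglyMeasurable
          ((hm p).pow_const k).aestronglyMeasurable
    have hX1 : ∫ ω, X p ω ^ 1 ∂P = 0 := by simpa using h1 p
    have hS1 : ∫ ω, S ω ^ 1 ∂P = 0 := by simpa using i1
    have e : ∀ ω, ∑ i ∈ Finset.range (p + 1), X i ω = S ω + X p ω := fun ω =>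
      Finset.sum_range_succ _ _
    simp only [e]
    refine ⟨?_, ?_, ?_⟩
    · have := hI 1 0
      have := hI 0 1
      simp only [pow_one, pow_zero, one_mul, mul_one] at *
      rw [integral_add (by assumption) (by assumption), i1, h1, add_zero]
    · have e2 : ∀ ω, (S ω + X p ω) ^ 2 =
          S ω ^ 2 * X p ω ^ 0 + (2 * (S ω ^ 1 * X p ω ^ 1) + S ω ^ 0 * X p ω ^ 2) := fun ω => by ring
      simp only [e2]
      rw [integral_add (hI _ _) (((hI _ _).const_mul _).fun_add (hI _ _)),
        integral_add ((hI _ _).const_mul _) (hI _ _), integral_const_mul, hprod, hprod, hprod, hX1,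
        i2, h2]
      simp
      ring
    · have e4 : ∀ ω, (S ω + X p ω) ^ 4 = S ω ^ 4 * X p ω ^ 0 + (4 * (S ω ^ 3 * X p ω ^ 1) +
          (6 * (S ω ^ 2 * X p ω ^ 2) + (4 * (S ω ^ 1 * X p ω ^ 3) + S ω ^ 0 * X p ω ^ 4))) :=
        fun ω => by ring
      simp only [e4]
      rw [integral_add (hI _ _) (((hI _ _).const_mul _).fun_add (((hI _ _).const_mul _).fun_add
          (((hI _ _).const_mul _).fun_add (hI _ _)))),
        integral_add ((hI _ _).const_mul _) (((hI _ _).const_mul _).fun_add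
          (((hI _ _).const_mul _).fun_add (hI _ _))),
        integral_add ((hI _ _).const_mul _) (((hI _ _).const_mul _).fun_add (hI _ _)),
        integral_add ((hI _ _).const_mul _) (hI _ _), integral_const_mul, integral_const_mul,
        integral_const_mul, hprod, hprod, hprod, hprod, hprod, hX1, hS1, i2, h2]
      have := h4 p
      simp
      nlinarith [sq_nonneg v]

theorem tendsto_div_llog : Tendsto (fun c => c / llog c) atTop atTop := by
  have h1 : Tendsto (fun c => llog c / c) atTop (𝓝[>] 0) := by
    refine tendsto_nhdsWithin_iff.2 ⟨tendsto_llog_div, ?_⟩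
    filter_upwards [eventually_gt_atTop 0] with c hc
    exact div_pos (llog_pos c) hc
  refine (tendsto_inv_nhdsGT_zero.comp h1).congr fun c => ?_
  rw [Function.comp_apply, inv_div]

section infiniteVariance

open ProbabilityTheory

variable {μ : Measure ℝ} [IsProbabilityMeasure μ]

theorem exists_le_integral_clip_sq (h : ∫⁻ x, ENNReal.ofReal (x ^ 2) ∂μ = ⊤) (V : ℝ) :
    ∃ n : ℕ, ∀ b : ℝ, n ≤ b → V ≤ ∫ x, clip b x ^ 2 ∂μ := by
  have hcont : ∀ b : ℝ, Measurable fun x => clip b x ^ 2 := fun b => (measurable_clip b).pow_const 2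
  by_contra! hcon
  have h1 : ∀ n : ℕ, ∫⁻ x, ENNReal.ofReal (clip n x ^ 2) ∂μ ≤ ENNReal.ofReal V := by
    intro n
    obtain ⟨b, hnb, hb⟩ := hcon n
    have hb0 : 0 ≤ b := (Nat.cast_nonneg n).trans hnb
    have hint : Integrable (fun x => clip b x ^ 2) μ :=
      .of_bound (hcont b).aestronglyMeasurable (b ^ 2) (Eventually.of_forall fun x => by
        rw [norm_pow]
        exact pow_le_pow_left₀ (norm_nonneg _) (abs_clip_le hb0 x) 2)
    refine le_trans (lintegral_mono fun x => ENNReal.ofReal_le_ofReal ?_)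
      ((ofReal_integral_eq_lintegral_ofReal hint
        (Eventually.of_forall fun x => sq_nonneg _)).symm.le.trans
        (ENNReal.ofReal_le_ofReal hb.le))
    refine sq_le_sq.2 ?_
    have hn : (0 : ℝ) ≤ n := Nat.cast_nonneg n
    rcases le_total |x| b with hx | hx
    · rw [clip_of_abs_le hx]
      exact abs_clip_le_abs hn x
    · refine (abs_clip_le hn x).trans (hnb.trans ?_)
      simp only [clip]
      rcases le_abs.1 hx with hx | hx
      · rw [min_eq_right hx, max_eq_right (by linarith)]
        exact le_abs_self b
      · rw [min_eq_left (by linarith), max_eq_left (by linarith), abs_neg]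
        exact le_abs_self b
  have h2 : ∀ x : ℝ, liminf (fun n : ℕ => ENNReal.ofReal (clip n x ^ 2)) atTop =
      ENNReal.ofReal (x ^ 2) := fun x => by
    refine Tendsto.liminf_eq (tendsto_const_nhds.congr' ?_)
    filter_upwards [eventually_ge_atTop ⌈|x|⌉₊] with n hn
    rw [clip_of_abs_le ((Nat.le_ceil _).trans (by exact_mod_cast hn))]
  have h3 : ∫⁻ x, ENNReal.ofReal (x ^ 2) ∂μ ≤ ENNReal.ofReal V := by
    rw [← lintegral_congr h2]
    exact (lintegral_liminf_le fun n : ℕ => (hcont n).ennreal_ofReal).trans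
      ((liminf_le_liminf (Eventually.of_forall h1)).trans_eq (liminf_const _))
  rw [h] at h3
  exact ENNReal.ofReal_ne_top (top_le_iff.1 h3)

theorem abs_integral_clip_sub_integral_clip_le {b d : ℝ} (hb : 0 ≤ b) (hbd : b ≤ d) :
    |∫ x, clip d x ∂μ - ∫ x, clip b x ∂μ| ≤ 2 * d * μ.real {x | b ≤ |x|} := by
  have hi : ∀ y : ℝ, 0 ≤ y → Integrable (clip y) μ := fun y hy =>
    .of_bound (measurable_clip y).aestronglyMeasurable y (Eventually.of_forall fun x =>
      abs_clip_le hy x)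
  rw [← integral_sub (hi d (hb.trans hbd)) (hi b hb)]
  have h2 : ∫ x, {x : ℝ | b ≤ |x|}.indicator (fun _ => 2 * d) x ∂μ = 2 * d * μ.real {x | b ≤ |x|} := by
    rw [integral_indicator_const _ (measurableSet_abs_ge b), smul_eq_mul, mul_comm]
  rw [← h2]
  refine abs_integral_le_integral_abs.trans (integral_mono_of_nonneg
    (Eventually.of_forall fun x => abs_nonneg _)
    ((integrable_const _).indicator (measurableSet_abs_ge b)) (Eventually.of_forall fun x => ?_))
  beta_reduce
  by_cases hx : b ≤ |x|
  · rw [indicator_of_mem (by exact hx)]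
    have h3 := abs_clip_le (hb.trans hbd) x
    have h4 := abs_clip_le hb x
    have h5 := abs_sub (clip d x) (clip b x)
    linarith
  · rw [indicator_of_notMem (by exact hx)]
    push Not at hx
    rw [clip_of_abs_le hx.le, clip_of_abs_le (hx.le.trans hbd), sub_self, abs_zero]

variable {C : ℝ} (hC : 0 ≤ C)
  (h : ∫⁻ x, ENNReal.ofReal (x ^ 2 / llog |x|) ∂μ ≤ ENNReal.ofReal C) (hmean : ∫ x, x ∂μ = 0)
include hC h hmean

/-- The bias is compared with that of truncation at `d = lilScale m`, which the moment bound
controls; between the two levels `hJ` gives at most `2 d / m`. Both contributions have squares of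
order `llog m / m`, while `p` is at most `m / (γ llog m)`. -/
theorem mul_sq_integral_clip_le {γ m p : ℝ} (hγ : 0 < γ) (hm : 1 ≤ m) (hp : 0 ≤ p)
    (hpm : γ * llog m * p ≤ m) (hJ : m * μ.real {x | Real.sqrt (m / llog m) ≤ |x|} ≤ 1) :
    p * (∫ x, clip (Real.sqrt (m / llog m)) x ∂μ) ^ 2 ≤ (4 * C ^ 2 + 16) / γ := by
  set l := llog m with hl
  set b := Real.sqrt (m / l) with hb
  set d := lilScale m with hd
  have hl1 : 1 ≤ l := one_le_llog m
  have hm0 : 0 < m := by linarith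
  have hd2 : d ^ 2 = 2 * m * l := lilScale_sq hm0.le
  have hd1 : 1 ≤ d := by
    rw [← one_le_sq_iff₀ (lilScale_nonneg m), hd2]
    nlinarith
  have hbd : b ≤ d := by
    refine Real.sqrt_le_sqrt ?_
    rw [div_le_iff₀ (by linarith)]
    nlinarith
  have hld : llog d ≤ 2 * l := by
    have : d ≤ 2 * m := by
      refine abs_le_of_sq_le_sq' ?_ (by linarith) |>.2
      have := llog_le_max m
      rw [max_eq_right hm] at this
      rw [hd2]
      nlinarith
    exact (llog_mono this).trans (llog_mul_le m one_le_two)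
  have h1 := abs_integral_sub_integral_clip_le hC h hd1
  rw [hmean] at h1
  have h2 := abs_integral_clip_sub_integral_clip_le (μ := μ) (Real.sqrt_nonneg (m / l)) hbd
  set c := ∫ x, clip b x ∂μ with hc
  have h3 : |c| ≤ 2 * C * l / d + 2 * d / m := by
    have h4 : μ.real {x | b ≤ |x|} ≤ 1 / m := by
      rw [le_div_iff₀ hm0]
      linarith
    have h5 : C * (llog d / d) ≤ 2 * C * l / d := by
      rw [mul_div_assoc', div_le_div_iff_of_pos_right (by linarith)]
      nlinarith
    have h6 : 2 * d * μ.real {x | b ≤ |x|} ≤ 2 * d / m := by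
      calc _ ≤ 2 * d * (1 / m) := by gcongr
        _ = _ := by ring
    rw [abs_le] at h1 h2 ⊢
    constructor <;> linarith
  have h4 : c ^ 2 ≤ (4 * C ^ 2 + 16) * (l / m) := by
    have e1 : (2 * C * l / d) ^ 2 = 2 * C ^ 2 * (l / m) := by
      rw [div_pow, hd2]
      field_simp
    have e2 : (2 * d / m) ^ 2 = 8 * (l / m) := by
      rw [div_pow, mul_pow, hd2]
      field_simp
      ring
    have : c ^ 2 ≤ (2 * C * l / d + 2 * d / m) ^ 2 := by
      rw [← sq_abs c]
      exact pow_le_pow_left₀ (abs_nonneg _) h3 2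
    nlinarith [sq_nonneg (2 * C * l / d - 2 * d / m)]
  rw [le_div_iff₀ hγ]
  calc p * c ^ 2 * γ ≤ p * ((4 * C ^ 2 + 16) * (l / m)) * γ := by gcongr
    _ = (4 * C ^ 2 + 16) * ((γ * l * p) / m) := by ring
    _ ≤ (4 * C ^ 2 + 16) * 1 := by
        gcongr
        exact (div_le_one hm0).2 hpm
    _ = _ := mul_one _

set_option maxHeartbeats 1000000 in
-- Truncated at `b = √(m / llog m)` and centred, the law has a variance `v` as large as desired. Its
-- fourth moment is at most `(2 b) ^ 2 * v`, and `(2 b) ^ 2 ≤ p v` because `m / llog m` is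
-- comparable with `p`. The one-sided moment bound gives probability `1 / 64`, of which at most half
-- is lost to coordinates beyond `b`.
theorem exists_convPow_Ici_ge_of_lintegral_sq_eq_top (hinf : ∫⁻ x, ENNReal.ofReal (x ^ 2) ∂μ = ⊤)
    {a γ : ℝ} (hγ : 0 < γ) :
    ∃ L : ℝ, ∀ m p : ℕ, L ≤ m → m ≤ 4 * γ * llog m * p → γ * llog m * p ≤ m →
      m * μ.real {x | Real.sqrt (m / llog m) ≤ |x|} ≤ 1 →
      ENNReal.ofReal (1 / 128) ≤ convPow μ p (Ici (a * Real.sqrt p)) := by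
  set C₂ := Real.sqrt ((4 * C ^ 2 + 16) / γ) with hC₂
  set I := ∫ x, |x| ∂μ with hI
  have hi1 : Integrable (fun x : ℝ => x) μ := integrable_id_of_sq_div_llog h
  -- `I ^ 2` pays for the square of the truncated mean, `16 γ` for the fourth moment, and the last
  -- term makes `√v / 16` exceed `a + C₂`, where `C₂` bounds `√p` times the truncated mean.
  set V := I ^ 2 + (16 * γ + 256 * (a + C₂) ^ 2) with hV
  obtain ⟨n₀, hn₀⟩ := exists_le_integral_clip_sq hinf V
  have hev : ∀ᶠ m : ℝ in atTop, 1 ≤ m ∧ 128 / γ ≤ llog m ∧ (n₀ : ℝ) ^ 2 ≤ m / llog m :=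
    (eventually_ge_atTop 1).and ((tendsto_llog.eventually_ge_atTop _).and
      (tendsto_div_llog.eventually_ge_atTop _))
  obtain ⟨L, hL⟩ := eventually_atTop.1 hev
  refine ⟨L, fun m p hLm hmp hpm hJ => ?_⟩
  obtain ⟨hm1, hl1, hb1⟩ := hL m hLm
  set l := llog m with hl
  have hl0 : 0 < l := llog_pos m
  set b := Real.sqrt (m / l) with hb
  have hb0 : 0 ≤ b := Real.sqrt_nonneg _
  have hb2 : b ^ 2 = m / l := Real.sq_sqrt (by positivity)
  have hnb : (n₀ : ℝ) ≤ b := Real.le_sqrt_of_sq_le hb1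
  have hp0 : 0 < (p : ℝ) := by
    by_contra! hp
    have : (p : ℝ) = 0 := le_antisymm hp (Nat.cast_nonneg p)
    rw [this, mul_zero] at hmp
    linarith
  set c := ∫ x, clip b x ∂μ with hc
  have hpc : p * c ^ 2 ≤ (4 * C ^ 2 + 16) / γ :=
    mul_sq_integral_clip_le hC h hmean hγ hm1 hp0.le hpm hJ
  have hclip : Integrable (clip b) μ := .of_bound (measurable_clip b).aestronglyMeasurable b
    (Eventually.of_forall fun x => abs_clip_le hb0 x)
  have hclip2 : Integrable (fun x => clip b x ^ 2) μ :=
    .of_bound ((measurable_clip b).pow_const 2).aestronglyMeasurable (b ^ 2)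
      (Eventually.of_forall fun x => by
        rw [norm_pow]
        exact pow_le_pow_left₀ (norm_nonneg _) (abs_clip_le hb0 x) 2)
  have hcb : |c| ≤ b := by
    refine abs_integral_le_integral_abs.trans ((integral_mono hclip.abs (integrable_const b)
      fun x => abs_clip_le hb0 x).trans_eq ?_)
    simp
  have hcI : |c| ≤ I := abs_integral_le_integral_abs.trans
    (integral_mono hclip.abs hi1.abs fun x => abs_clip_le_abs hb0 x)
  let g : ℝ → ℝ := fun x => clip b x - c
  have hg : Measurable g := (measurable_clip b).sub_const c
  have hgb : ∀ x, |g x| ≤ 2 * b := fun x => by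
    have h5 := abs_sub (clip b x) c
    have h6 := abs_clip_le hb0 x
    change |clip b x - c| ≤ _
    linarith
  set v := ∫ x, g x ^ 2 ∂μ with hv
  have hg1 : ∫ x, g x ∂μ = 0 := by
    change ∫ x, (clip b x - c) ∂μ = 0
    rw [integral_sub hclip (integrable_const c)]
    simp [hc]
  have hvv : v = ∫ x, clip b x ^ 2 ∂μ - c ^ 2 := by
    have e : ∀ x, g x ^ 2 = clip b x ^ 2 + (-(2 * c) * clip b x + c ^ 2) := fun x => by
      change (clip b x - c) ^ 2 = _
      ring
    rw [hv]
    simp only [e]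
    rw [integral_add hclip2 ((hclip.const_mul _).fun_add (integrable_const _)),
      integral_add (hclip.const_mul _) (integrable_const _), integral_const_mul]
    simp [← hc]
    ring
  have hvV : 16 * γ + 256 * (a + C₂) ^ 2 ≤ v := by
    have h5 := hn₀ b hnb
    have h6 : c ^ 2 ≤ I ^ 2 := by
      rw [← sq_abs c]
      exact pow_le_pow_left₀ (abs_nonneg _) hcI 2
    linarith
  have hv0 : 0 < v := by linarith [sq_nonneg (a + C₂)]
  have hg4 : ∫ x, g x ^ 4 ∂μ ≤ (2 * b) ^ 2 * v := by
    rw [hv, ← integral_const_mul]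
    refine integral_mono_of_nonneg (Eventually.of_forall fun x => by positivity) ?_
      (Eventually.of_forall fun x => ?_)
    · refine Integrable.const_mul (.of_bound (hg.pow_const 2).aestronglyMeasurable ((2 * b) ^ 2)
        (Eventually.of_forall fun x => ?_)) _
      rw [norm_pow]
      exact pow_le_pow_left₀ (norm_nonneg _) (hgb x) 2
    · have : g x ^ 2 ≤ (2 * b) ^ 2 := by
        rw [← sq_abs (g x)]
        exact pow_le_pow_left₀ (abs_nonneg _) (hgb x) 2
      calc g x ^ 4 = g x ^ 2 * g x ^ 2 := by ring
        _ ≤ (2 * b) ^ 2 * g x ^ 2 := mul_le_mul_of_nonneg_right this (sq_nonneg _)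
  set Q := Measure.infinitePi fun _ : ℕ => μ with hQ
  have hind0 : iIndepFun (fun (i : ℕ) (x : ℕ → ℝ) => x i) Q :=
    iIndepFun_infinitePi (X := fun _ x => x) (fun _ => measurable_id)
  have hlaw : ∀ i, Q.map (fun x => x i) = μ := fun i => Measure.infinitePi_map_eval _ i
  have hm1' : ∀ i, Measurable fun x : ℕ → ℝ => x i := fun i => measurable_pi_apply i
  have hind : iIndepFun (fun (i : ℕ) (x : ℕ → ℝ) => g (x i)) Q := hind0.comp (fun _ => g) fun _ => hg
  have hint : ∀ (i : ℕ) (k : ℕ), ∫ x, g (x i) ^ k ∂Q = ∫ y, g y ^ k ∂μ := fun i k => by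
    rw [← hlaw i, integral_map (hm1' i).aemeasurable (hg.pow_const k).aestronglyMeasurable]
  obtain ⟨s1, s2, s4⟩ := sum_moments hind (fun i => hg.comp (hm1' i)) (fun i x => hgb (x i))
    (v := v) (w := (2 * b) ^ 2 * v)
    (fun i => by simpa [hg1] using hint i 1) (fun i => hint i 2) (fun i => (hint i 4).trans_le hg4) p
  have hsm : Measurable fun x : ℕ → ℝ => ∑ i ∈ Finset.range p, g (x i) :=
    Finset.measurable_sum _ fun i _ => hg.comp (hm1' i)
  have hpz := one_div_le_measureReal_of_moments (s := Real.sqrt (p * v)) hsm (B := p * (2 * b))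
    (fun x => (Finset.abs_sum_le_sum_abs _ _).trans
      ((Finset.sum_le_sum fun i _ => hgb (x i)).trans_eq (by simp)))
    (Real.sqrt_pos.2 (by positivity)) s1 (by rw [s2, Real.sq_sqrt (by positivity)]) (by
      refine s4.trans ?_
      have e : Real.sqrt (p * v) ^ 4 = (p * v) ^ 2 := by
        rw [show 4 = 2 * 2 from rfl, pow_mul, Real.sq_sqrt (by positivity)]
      rw [e]
      have h5 : (2 * b) ^ 2 ≤ p * v := by
        rw [mul_pow, hb2, mul_div_assoc', div_le_iff₀ hl0]
        have : 16 * γ ≤ v := by linarith [sq_nonneg (a + C₂)]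
        calc (2 : ℝ) ^ 2 * m ≤ 16 * γ * (p * l) := by linarith
          _ ≤ v * (p * l) := by gcongr
          _ = _ := by ring
      linarith [mul_le_mul_of_nonneg_left h5 (show 0 ≤ p * v by positivity)])
  have hexc : Q.real {x | ∃ i < p, b ≤ |x i|} ≤ 1 / 128 := by
    have h5 : {x : ℕ → ℝ | ∃ i < p, b ≤ |x i|} ⊆
        ⋃ i ∈ Finset.range p, (fun x : ℕ → ℝ => x i) ⁻¹' {y | b ≤ |y|} := by
      rintro x ⟨i, hi, hx⟩
      exact mem_biUnion (by simpa using hi) hx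
    refine (measureReal_mono h5 (measure_ne_top _ _)).trans ((measureReal_biUnion_finset_le _ _).trans ?_)
    have h6 : ∀ i, Q.real ((fun x : ℕ → ℝ => x i) ⁻¹' {y | b ≤ |y|}) = μ.real {y | b ≤ |y|} := by
      intro i
      rw [← hlaw i, map_measureReal_apply (hm1' i) (measurableSet_abs_ge b)]
    simp only [h6, Finset.sum_const, Finset.card_range, nsmul_eq_mul]
    rw [div_le_iff₀ hγ] at hl1
    have h7 : 128 * (p : ℝ) ≤ m := by linarith [mul_le_mul_of_nonneg_right hl1 hp0.le]
    have h8 : (0 : ℝ) ≤ μ.real {y | b ≤ |y|} := measureReal_nonneg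
    linarith [mul_le_mul_of_nonneg_right h7 h8]
  have hfin : 1 / 128 ≤ Q.real {x | a * Real.sqrt p ≤ ∑ i ∈ Finset.range p, x i} := by
    have hsub : {x : ℕ → ℝ | Real.sqrt (p * v) / 16 ≤ ∑ i ∈ Finset.range p, g (x i)} ⊆
        {x | a * Real.sqrt p ≤ ∑ i ∈ Finset.range p, x i} ∪ {x | ∃ i < p, b ≤ |x i|} := by
      intro x hx
      by_cases hex : ∃ i < p, b ≤ |x i|
      · exact Or.inr hex
      push Not at hex
      left
      have hx' : Real.sqrt (p * v) / 16 ≤ ∑ i ∈ Finset.range p, g (x i) := hx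
      have e : ∑ i ∈ Finset.range p, g (x i) = ∑ i ∈ Finset.range p, x i - p * c := by
        change ∑ i ∈ Finset.range p, (clip b (x i) - c) = _
        rw [Finset.sum_sub_distrib]
        simp only [Finset.sum_const, Finset.card_range, nsmul_eq_mul]
        congr 1
        exact Finset.sum_congr rfl fun i hi => clip_of_abs_le (hex i (Finset.mem_range.1 hi)).le
      rw [e, Real.sqrt_mul hp0.le] at hx'
      have h5 : 16 * (a + C₂) ≤ Real.sqrt v := by
        refine Real.le_sqrt_of_sq_le ?_
        linarith [sq_nonneg (a + C₂)]
      have h6 : p * |c| ≤ Real.sqrt p * C₂ := by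
        have : Real.sqrt p * |c| ≤ C₂ := by
          rw [hC₂, ← Real.sqrt_sq (abs_nonneg c), ← Real.sqrt_mul hp0.le, sq_abs]
          exact Real.sqrt_le_sqrt hpc
        calc p * |c| = Real.sqrt p * (Real.sqrt p * |c|) := by
              rw [← mul_assoc, Real.mul_self_sqrt hp0.le]
          _ ≤ _ := by gcongr
      have h7 : Real.sqrt p * (16 * (a + C₂)) ≤ Real.sqrt p * Real.sqrt v := by gcongr
      have h8 : p * (-|c|) ≤ p * c := mul_le_mul_of_nonneg_left (neg_abs_le c) hp0.le
      have h9 : a * Real.sqrt p ≤ ∑ i ∈ Finset.range p, x i := by linarith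
      exact h9
    have := (measureReal_mono (μ := Q) hsub (measure_ne_top _ _)).trans (measureReal_union_le _ _)
    linarith
  rw [← map_sum_Ico_eq_convPow hind0 hm1' 0 p fun i _ => hlaw i,
    Measure.map_apply (Finset.measurable_sum _ fun i _ => hm1' i) measurableSet_Ici, zero_add,
    ← Finset.range_eq_Ico]
  exact ENNReal.ofReal_le_of_le_toReal hfin

end infiniteVariance

/-! ### A lower bound for one block. -/

section block

variable {μ : Measure ℝ} [IsProbabilityMeasure μ] {C : ℝ} (hC : 0 ≤ C)
  (h : ∫⁻ x, ENNReal.ofReal (x ^ 2 / llog |x|) ∂μ ≤ ENNReal.ofReal C) (hmean : ∫ x, x ∂μ = 0)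
include hC h hmean

/-- A block will consist of about `γ llog m` sub-blocks of length `p`. The condition `2 K ^ 2 < γ a
^ 2` says that success in all of them suffices for the level `K * lilNorm m`, and `γ * -log q < 1`
that joint success costs less than `exp (-llog m)`. With infinite variance `q` is fixed and `a`
free; with finite variance `v > K ^ 2`, the Gaussian bound at a high level `b` has `-log q` close to
`b ^ 2 / 2` and `a = b √v`. -/
theorem exists_subblock_bound {K : ℝ} (hK : 0 < K)
    (hKv : ENNReal.ofReal (K ^ 2) < ∫⁻ x, ENNReal.ofReal (x ^ 2) ∂μ) :
    ∃ a γ q L : ℝ, 0 < a ∧ 0 < γ ∧ 0 < q ∧ q < 1 ∧ 2 * K ^ 2 < γ * a ^ 2 ∧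
      γ * -Real.log q < 1 ∧ ∀ m p : ℕ, L ≤ m → m ≤ 4 * γ * llog m * p → γ * llog m * p ≤ m →
        m * μ.real {x | Real.sqrt (m / llog m) ≤ |x|} ≤ 1 →
        ENNReal.ofReal q ≤ convPow μ p (Ici (a * Real.sqrt p)) := by
  rcases eq_or_ne (∫⁻ x, ENNReal.ofReal (x ^ 2) ∂μ) ⊤ with hinf | hfin
  · set t := -Real.log (1 / 128) with ht
    have ht0 : 0 < t := neg_pos.2 (Real.log_neg (by norm_num) (by norm_num))
    have hγ : 0 < 1 / (2 * t) := by positivity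
    set a := 2 * K * Real.sqrt (2 * t) with ha
    obtain ⟨L, hL⟩ := exists_convPow_Ici_ge_of_lintegral_sq_eq_top hC h hmean hinf (a := a) hγ
    refine ⟨a, 1 / (2 * t), 1 / 128, L, by positivity, hγ, by norm_num, by norm_num, ?_, ?_, hL⟩
    · rw [ha, mul_pow, Real.sq_sqrt (by positivity)]
      field_simp
      norm_num
    · rw [← ht]
      field_simp
      norm_num
  · set v := (∫⁻ x, ENNReal.ofReal (x ^ 2) ∂μ).toReal with hv
    have hvar : ∫ x, x ^ 2 ∂μ = v := integral_eq_lintegral_of_nonneg_ae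
      (Eventually.of_forall fun x => sq_nonneg x) (by fun_prop)
    rw [← ENNReal.ofReal_toReal hfin, ENNReal.ofReal_lt_ofReal_iff_of_nonneg (sq_nonneg K)] at hKv
    have hK2 : 0 < K ^ 2 := by positivity
    have hv0 : 0 < v := hK2.trans hKv
    set r := v / K ^ 2 with hr
    have hr1 : 1 < r := (one_lt_div hK2).2 hKv
    -- For large `b` the corrections to `b ^ 2` are outweighed by `r = v / K ^ 2 > 1`; this opens
    -- the interval from which `γ` is taken.
    obtain ⟨b, hb0, hb⟩ : ∃ b : ℝ, 0 < b ∧ (b + 1) ^ 2 + 4 < r * b ^ 2 := by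
      refine ⟨4 / (r - 1) + 4, by have := sub_pos.2 hr1; positivity, ?_⟩
      have h1 : 0 < r - 1 := sub_pos.2 hr1
      have h2 : (r - 1) * (4 / (r - 1) + 4) = 4 + 4 * (r - 1) := by field_simp
      set b := 4 / (r - 1) + 4
      have hb4 : 4 < b := lt_add_of_pos_left _ (by positivity)
      nlinarith
    set q := Real.exp (-((b + 1) ^ 2 / 2)) / 4 with hq
    have hq0 : 0 < q := by positivity
    have hlogq : -Real.log q ≤ ((b + 1) ^ 2 + 4) / 2 := by
      have h4 : Real.log 4 ≤ 2 := by
        rw [show (4 : ℝ) = 2 ^ 2 by norm_num, Real.log_pow]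
        have := Real.log_two_lt_d9
        push_cast
        linarith
      rw [hq, Real.log_div (Real.exp_pos _).ne' (by norm_num), Real.log_exp]
      linarith
    have hq1 : q < 1 := by
      have : Real.exp (-((b + 1) ^ 2 / 2)) ≤ 1 :=
        Real.exp_le_one_iff.2 (by linarith [sq_nonneg (b + 1)])
      rw [hq]
      linarith
    obtain ⟨γ, hγ1, hγ2⟩ : ∃ γ, 2 * K ^ 2 / (b ^ 2 * v) < γ ∧ γ < 2 / ((b + 1) ^ 2 + 4) := by
      refine exists_between ?_
      rw [div_lt_div_iff₀ (by positivity) (by positivity)]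
      rw [hr, div_mul_eq_mul_div, lt_div_iff₀ hK2] at hb
      linarith
    have hγ0 : 0 < γ := lt_trans (by positivity) hγ1
    obtain ⟨p₀, hp₀⟩ := eventually_atTop.1
      (eventually_convPow_Ici_ge hv0 hvar hmean hb0.le)
    have hev : ∀ᶠ m : ℝ in atTop, 1 ≤ m ∧ 4 * γ * p₀ ≤ m / llog m :=
      (eventually_ge_atTop 1).and (tendsto_div_llog.eventually_ge_atTop _)
    obtain ⟨L, hL⟩ := eventually_atTop.1 hev
    refine ⟨b * Real.sqrt v, γ, q, L, by have := Real.sqrt_pos.2 hv0; positivity, hγ0, hq0, hq1,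
      ?_, ?_, fun m p hLm hmp _ _ => hp₀ p ?_⟩
    · rw [mul_pow, Real.sq_sqrt hv0.le]
      exact (div_lt_iff₀ (by positivity)).1 hγ1
    · calc γ * -Real.log q ≤ γ * (((b + 1) ^ 2 + 4) / 2) := by gcongr
        _ < 2 / ((b + 1) ^ 2 + 4) * (((b + 1) ^ 2 + 4) / 2) := by gcongr
        _ = 1 := by field_simp
    · obtain ⟨_, h2⟩ := hL m hLm
      have hl := llog_pos m
      rw [le_div_iff₀ hl] at h2
      have h3 : 4 * γ * llog m * p₀ ≤ 4 * γ * llog m * p := by linarith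
      exact_mod_cast le_of_mul_le_mul_left h3 (by positivity)

/-- With `k = ⌈γ llog m⌉` sub-blocks of length `N / k`, probabilities multiply by
`convPow_Ici_mul_le`. The gap between `ρ'` and `ρ` absorbs the remainder of the division, and the
factor `c = q` pays for the ceiling. -/
theorem exists_block_bound {K : ℝ} (hK : 0 < K)
    (hKv : ENNReal.ofReal (K ^ 2) < ∫⁻ x, ENNReal.ofReal (x ^ 2) ∂μ) :
    ∃ ρ θ c L : ℝ, ρ < 1 ∧ 0 < θ ∧ θ < 1 ∧ 0 < c ∧ ∀ m N : ℕ, L ≤ m → ρ * m ≤ N → N ≤ m →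
        m * μ.real {x | Real.sqrt (m / llog m) ≤ |x|} ≤ 1 → ∃ n ≤ N,
        ENNReal.ofReal (c * Real.exp (-(θ * llog m))) ≤ convPow μ n (Ici (K * lilNorm m)) := by
  obtain ⟨a, γ, q, L₁, ha, hγ, hq0, hq1, hKγ, hθ1, hsub⟩ := exists_subblock_bound hC h hmean hK hKv
  set ρ' := 2 * K ^ 2 / (γ * a ^ 2) with hρ'
  have hρ'1 : ρ' < 1 := (div_lt_one (by positivity)).2 hKγ
  obtain ⟨ρ, hρ1, hρ2⟩ := exists_between (max_lt hρ'1 (show (3 / 4 : ℝ) < 1 by norm_num))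
  have hρρ' : 0 < ρ - ρ' := sub_pos.2 ((le_max_left _ _).trans_lt hρ1)
  have hρ34 : 3 / 4 < ρ := (le_max_right _ _).trans_lt hρ1
  have hlogq : 0 < -Real.log q := neg_pos.2 (Real.log_neg hq0 hq1)
  have hev : ∀ᶠ m : ℝ in atTop, L₁ ≤ m ∧ 1 ≤ m ∧ 1 / γ ≤ llog m ∧ 8 * γ ≤ m / llog m ∧
      2 * γ / (ρ - ρ') ≤ m / llog m :=
    (eventually_ge_atTop _).and ((eventually_ge_atTop _).and
      ((tendsto_llog.eventually_ge_atTop _).and ((tendsto_div_llog.eventually_ge_atTop _).and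
      (tendsto_div_llog.eventually_ge_atTop _))))
  obtain ⟨L, hL⟩ := eventually_atTop.1 hev
  refine ⟨ρ, γ * -Real.log q, q, L, hρ2, by positivity, hθ1, hq0, fun m N hLm hN hNm hJ => ?_⟩
  obtain ⟨hm1, hm2, hl1, hl2, hl3⟩ := hL m hLm
  set l := llog m with hl
  have hl0 : 0 < l := llog_pos m
  rw [div_le_iff₀ hγ] at hl1
  rw [le_div_iff₀ hl0] at hl2 hl3
  rw [div_mul_eq_mul_div, div_le_iff₀ hρρ'] at hl3
  set k := ⌈γ * l⌉₊ with hk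
  have hk1 : γ * l ≤ k := Nat.le_ceil _
  have hk2 : (k : ℝ) ≤ γ * l + 1 := (Nat.ceil_lt_add_one (by positivity)).le
  have hk3 : (k : ℝ) ≤ 2 * (γ * l) := by linarith
  have hk0 : 0 < (k : ℝ) := lt_of_lt_of_le (by positivity) hk1
  have hk0' : 0 < k := by exact_mod_cast hk0
  set p := N / k with hp
  have hkp : k * p ≤ N := Nat.mul_div_le N k
  have hkp' : (k : ℝ) * p ≤ N := by exact_mod_cast hkp
  have hNkp : (N : ℝ) ≤ k * p + k := by
    have := Nat.lt_mul_div_succ N hk0'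
    have h2 : N ≤ k * p + k := by
      rw [Nat.mul_add, mul_one] at this
      exact this.le
    exact_mod_cast h2
  have hNm' : (N : ℝ) ≤ m := by exact_mod_cast hNm
  have hp0 : (0 : ℝ) ≤ p := Nat.cast_nonneg p
  have hmp : m ≤ 4 * γ * l * p := by
    have : k * (p : ℝ) ≤ 2 * (γ * l) * p := by gcongr
    nlinarith
  have hpm : γ * l * p ≤ m := by
    have : γ * l * (p : ℝ) ≤ k * p := by gcongr
    linarith
  have hbd := hsub m p hm1 hmp hpm hJ
  refine ⟨k * p, hkp, ?_⟩
  calc ENNReal.ofReal (q * Real.exp (-(γ * -Real.log q * l)))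
      ≤ ENNReal.ofReal (q ^ k) := by
        refine ENNReal.ofReal_le_ofReal ?_
        have e1 : q * Real.exp (-(γ * -Real.log q * l)) = Real.exp ((γ * l + 1) * Real.log q) := by
          nth_rw 1 [← Real.exp_log hq0]
          rw [← Real.exp_add]
          ring_nf
        rw [e1, ← Real.rpow_natCast, Real.rpow_def_of_pos hq0, mul_comm]
        refine Real.exp_le_exp.2 ?_
        nlinarith
    _ = ENNReal.ofReal q ^ k := ENNReal.ofReal_pow hq0.le k
    _ ≤ convPow μ p (Ici (a * Real.sqrt p)) ^ k := by gcongr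
    _ ≤ convPow μ (k * p) (Ici (k * (a * Real.sqrt p))) := convPow_Ici_mul_le μ k p _
    _ ≤ _ := by
        refine measure_mono (Ici_subset_Ici.2 ?_)
        refine abs_le_of_sq_le_sq' ?_ (by positivity) |>.2
        rw [mul_pow, lilNorm_eq, lilScale_sq (by linarith), mul_pow, mul_pow, Real.sq_sqrt hp0]
        have h1 : ρ' * m ≤ k * p := by linarith
        rw [hρ', div_mul_eq_mul_div, div_le_iff₀ (by positivity)] at h1
        calc K ^ 2 * (2 * m * l) = (2 * K ^ 2 * m) * l := by ring
          _ ≤ (k * p * (γ * a ^ 2)) * l := by gcongr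
          _ = (γ * l) * (k * a ^ 2 * p) := by ring
          _ ≤ k * (k * a ^ 2 * p) := by gcongr
          _ = _ := by ring

end block

/-! ### The first absolute moment of a sum. -/

section moment

open ProbabilityTheory

theorem clip_sq_le_llog {d : ℝ} (hd : 1 ≤ d) (x : ℝ) :
    clip d x ^ 2 ≤ llog d * (x ^ 2 / llog |x|) := by
  have hd0 : 0 < d := by linarith
  have hl := llog_pos |x|
  have hl' := one_le_llog d
  rw [mul_div_assoc', le_div_iff₀ hl]
  rcases le_or_gt |x| d with h | h
  · rw [clip_of_abs_le h, mul_comm]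
    have := llog_mono h
    gcongr
  · have h1 : llog |x| ≤ |x| / d * llog d := by
      have := llog_mul_le d (c := |x| / d) ((one_le_div hd0).2 h.le)
      rwa [div_mul_cancel₀ _ hd0.ne'] at this
    have h2 : clip d x ^ 2 ≤ d ^ 2 := by
      rw [← sq_abs]
      exact pow_le_pow_left₀ (abs_nonneg _) (abs_clip_le hd0.le x) 2
    calc clip d x ^ 2 * llog |x| ≤ d ^ 2 * (|x| / d * llog d) := by gcongr
      _ = (d * |x|) * llog d := by field_simp
      _ ≤ (|x| * |x|) * llog d := by gcongr
      _ = _ := by rw [abs_mul_abs_self]; ring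

/-- After truncation at `d = lilNorm n` each variable has second moment at most `2 C llog n`, which
adds up to `C d ^ 2`; the bias and the remainder cost at most `C d` each. Only the uniform bound `C`
enters, so the variances may be infinite. -/
theorem lintegral_abs_sum_le {Ω : Type*} [MeasurableSpace Ω] {P : Measure Ω} {X : ℕ → Ω → ℝ}
    (hX : iIndepFun X P) (hm : ∀ i, Measurable (X i)) {C : ℝ} (hC : 0 ≤ C)
    (h : ∀ i, ∫⁻ ω, ENNReal.ofReal (X i ω ^ 2 / llog |X i ω|) ∂P ≤ ENNReal.ofReal C)
    (hmean : ∀ i, ∫ ω, X i ω ∂P = 0) (n : ℕ) :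
    ∫⁻ ω, ENNReal.ofReal |∑ i ∈ Finset.range n, X i ω| ∂P ≤
      ENNReal.ofReal ((1 + 4 * C) * lilNorm n) := by
  have hprob := hX.isProbabilityMeasure
  rcases Nat.eq_zero_or_pos n with rfl | hn
  · simp
  have hn1 : (1 : ℝ) ≤ n := by exact_mod_cast hn
  set l := llog n with hl
  have hl1 : 1 ≤ l := one_le_llog n
  set d := lilNorm n with hd
  have hd2 : d ^ 2 = 2 * n * l := lilScale_sq (by linarith)
  have hd0 : 0 ≤ d := lilScale_nonneg n
  have hd1 : 1 ≤ d := by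
    rw [← one_le_sq_iff₀ hd0, hd2]
    nlinarith
  have hld : llog d ≤ 2 * l := by
    have : d ≤ 2 * n := by
      refine abs_le_of_sq_le_sq' ?_ (by linarith) |>.2
      have := llog_le_max n
      rw [max_eq_right hn1] at this
      rw [hd2]
      nlinarith
    exact (llog_mono this).trans (llog_mul_le n one_le_two)
  have hlaw : ∀ i, IsProbabilityMeasure (P.map (X i)) := fun i =>
    Measure.isProbabilityMeasure_map (hm i).aemeasurable
  have hlm : Measurable llog := llog_mono.measurable
  have hmap : ∀ i, ∫⁻ x, ENNReal.ofReal (x ^ 2 / llog |x|) ∂(P.map (X i)) ≤ ENNReal.ofReal C :=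
    fun i => by
      rw [lintegral_map (by fun_prop) (hm i)]
      exact h i
  set e := C * (llog d / d) with he
  have hne : n * e ≤ C * d := by
    have : n * (llog d / d) ≤ d := by
      rw [mul_div_assoc', div_le_iff₀ (by linarith), ← sq, hd2]
      nlinarith
    calc n * e = C * (n * (llog d / d)) := by ring
      _ ≤ _ := by gcongr
  have hX1 : ∀ i, Integrable (X i) P := fun i =>
    (integrable_id_of_sq_div_llog (hmap i)).comp_measurable (hm i)
  have hZb : ∀ i ω, |clip d (X i ω)| ≤ d := fun i ω => abs_clip_le hd0 _
  have hZm : ∀ i, Measurable fun ω => clip d (X i ω) := fun i => (measurable_clip d).comp (hm i)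
  have hZ1 : ∀ i, Integrable (fun ω => clip d (X i ω)) P := fun i =>
    .of_bound (hZm i).aestronglyMeasurable d (Eventually.of_forall (hZb i))
  have hbias : ∀ i, |∫ ω, clip d (X i ω) ∂P| ≤ e := fun i => by
    have := abs_integral_sub_integral_clip_le hC (hmap i) hd1
    rwa [integral_map (hm i).aemeasurable (by fun_prop),
      integral_map (hm i).aemeasurable (measurable_clip d).aestronglyMeasurable, hmean,
      zero_sub, abs_neg] at this
  have hrest : ∀ i, ∫ ω, |X i ω - clip d (X i ω)| ∂P ≤ e := fun i => by
    have hmc := measurable_clip d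
    have hmm : Measurable fun x => |x - clip d x| := by fun_prop
    have := integral_abs_sub_clip_le_llog hC (hmap i) hd1
    rwa [integral_map (hm i).aemeasurable hmm.aestronglyMeasurable] at this
  have hsq : ∀ i, ∫ ω, clip d (X i ω) ^ 2 ∂P ≤ 2 * l * C := fun i => by
    have hmc := measurable_clip d
    have hmm : Measurable fun x => clip d x ^ 2 := by fun_prop
    have h1 := integrable_sq_div_llog (hmap i)
    have h2 : ∫ x, x ^ 2 / llog |x| ∂(P.map (X i)) ≤ C := by
      rw [integral_eq_lintegral_of_nonneg_ae (Eventually.of_forall fun x =>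
        div_nonneg (sq_nonneg x) (llog_pos _).le) h1.aestronglyMeasurable]
      exact ENNReal.toReal_le_of_le_ofReal hC (hmap i)
    rw [← integral_map (f := fun x => clip d x ^ 2) (hm i).aemeasurable hmm.aestronglyMeasurable]
    calc _ ≤ ∫ x, llog d * (x ^ 2 / llog |x|) ∂(P.map (X i)) :=
          integral_mono_of_nonneg (Eventually.of_forall fun x => sq_nonneg _) (h1.const_mul _)
            (Eventually.of_forall fun x => clip_sq_le_llog hd1 x)
      _ = llog d * ∫ x, x ^ 2 / llog |x| ∂(P.map (X i)) := integral_const_mul _ _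
      _ ≤ 2 * l * C := mul_le_mul hld h2 (integral_nonneg fun x =>
          div_nonneg (sq_nonneg x) (llog_pos _).le) (by linarith)
  set W : Ω → ℝ := fun ω => ∑ i ∈ Finset.range n, clip d (X i ω) with hW
  set w := ∫ ω, W ω ∂P with hw
  have hWm : Measurable W := Finset.measurable_sum _ fun i _ => hZm i
  have hw1 : |w| ≤ n * e := by
    rw [hw, hW, integral_finsetSum _ fun i _ => hZ1 i]
    refine (Finset.abs_sum_le_sum_abs _ _).trans ((Finset.sum_le_sum fun i _ => hbias i).trans_eq ?_)
    simp
  have hvar : ∫ ω, (W ω - w) ^ 2 ∂P ≤ C * d ^ 2 := by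
    have hZ2 : ∀ i, MemLp (fun ω => clip d (X i ω)) 2 P := fun i =>
      MemLp.of_bound (hZm i).aestronglyMeasurable d (Eventually.of_forall (hZb i))
    have h1 : Var[W; P] = ∑ i ∈ Finset.range n, Var[fun ω => clip d (X i ω); P] := by
      have hWe : W = ∑ i ∈ Finset.range n, fun ω => clip d (X i ω) := by ext; simp [hW]
      rw [hWe]
      exact IndepFun.variance_sum (fun i _ => hZ2 i) fun i _ j _ hij =>
        (hX.indepFun hij).comp (measurable_clip d) (measurable_clip d)
    rw [← variance_eq_integral hWm.aemeasurable, h1]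
    calc _ ≤ ∑ i ∈ Finset.range n, 2 * l * C := Finset.sum_le_sum fun i _ =>
          (variance_le_expectation_sq (hZm i).aestronglyMeasurable).trans (hsq i)
      _ = _ := by
          rw [hd2]
          simp
          ring
  have hW2 : Integrable (fun ω => (W ω - w) ^ 2) P := by
    have hWb : ∀ ω, |W ω - w| ≤ n * d + |w| := fun ω => by
      refine (abs_sub _ _).trans (add_le_add ?_ le_rfl)
      refine (Finset.abs_sum_le_sum_abs _ _).trans
        ((Finset.sum_le_sum fun i _ => hZb i ω).trans_eq (by simp))
    exact .of_bound ((hWm.sub_const w).pow_const 2).aestronglyMeasurable ((n * d + |w|) ^ 2)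
      (Eventually.of_forall fun ω => by
        rw [norm_pow]
        exact pow_le_pow_left₀ (norm_nonneg _) (hWb ω) 2)
  have hR : ∀ i, Integrable (fun ω => |X i ω - clip d (X i ω)|) P := fun i =>
    ((hX1 i).sub (hZ1 i)).abs
  have hRs : Integrable (fun ω => ∑ i ∈ Finset.range n, |X i ω - clip d (X i ω)|) P :=
    integrable_finsetSum _ fun i _ => hR i
  have hS : Integrable (fun ω => ∑ i ∈ Finset.range n, X i ω) P :=
    integrable_finsetSum _ fun i _ => hX1 i
  rw [← ofReal_integral_eq_lintegral_ofReal hS.abs (Eventually.of_forall fun ω => abs_nonneg _)]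
  refine ENNReal.ofReal_le_ofReal ?_
  have hpt : ∀ ω, |∑ i ∈ Finset.range n, X i ω| ≤ (d / 2 + |w|) + (1 / (2 * d) * (W ω - w) ^ 2 +
      ∑ i ∈ Finset.range n, |X i ω - clip d (X i ω)|) := fun ω => by
    have e1 : ∑ i ∈ Finset.range n, X i ω = (W ω - w) + w +
        ∑ i ∈ Finset.range n, (X i ω - clip d (X i ω)) := by
      rw [Finset.sum_sub_distrib]
      simp only [hW]
      ring
    have e2 := Finset.abs_sum_le_sum_abs (fun i => X i ω - clip d (X i ω)) (Finset.range n)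
    have e3 : |W ω - w| ≤ d / 2 + 1 / (2 * d) * (W ω - w) ^ 2 := by
      rw [← sq_abs (W ω - w)]
      have : 0 < d := by linarith
      have : d / 2 + 1 / (2 * d) * |W ω - w| ^ 2 - |W ω - w| = (|W ω - w| - d) ^ 2 / (2 * d) := by
        field_simp
        ring
      have : 0 ≤ (|W ω - w| - d) ^ 2 / (2 * d) := by positivity
      linarith
    rw [e1]
    have e4 := abs_add_le ((W ω - w) + w) (∑ i ∈ Finset.range n, (X i ω - clip d (X i ω)))
    have e5 := abs_add_le (W ω - w) w
    linarith
  refine (integral_mono hS.abs ((integrable_const _).fun_add ((hW2.const_mul _).fun_add hRs)) hpt).trans ?_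
  have hRn : ∫ ω, ∑ i ∈ Finset.range n, |X i ω - clip d (X i ω)| ∂P ≤ n * e := by
    rw [integral_finsetSum _ fun i _ => hR i]
    exact (Finset.sum_le_sum fun i _ => hrest i).trans_eq (by simp)
  have h3 : 1 / (2 * d) * ∫ ω, (W ω - w) ^ 2 ∂P ≤ C * d := by
    calc _ ≤ 1 / (2 * d) * (C * d ^ 2) := by gcongr
      _ = C * d / 2 := by field_simp
      _ ≤ _ := by nlinarith
  rw [integral_add (integrable_const _) ((hW2.const_mul _).fun_add hRs),
    integral_add (hW2.const_mul _) hRs, integral_const_mul]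
  simp only [integral_const, probReal_univ, one_smul]
  have hCd : 0 ≤ C * d := by positivity
  have e : (1 + 4 * C) * d = d + 4 * (C * d) := by ring
  rw [e]
  linarith

end moment

/-! ### Sparse blocks and index classes. -/

/-- A very sparse sequence of times. -/
def sparse (j : ℕ) : ℕ := j.factorial ^ 4

theorem sparse_mono : Monotone sparse := fun _ _ h => Nat.pow_le_pow_left (Nat.factorial_le h) 4

theorem le_sparse (j : ℕ) : j ≤ sparse j :=
  (Nat.self_le_factorial j).trans (Nat.le_self_pow (by norm_num) _)

theorem sparse_pos (j : ℕ) : 0 < sparse j := pow_pos j.factorial_pos 4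

theorem sparse_succ (j : ℕ) : sparse (j + 1) = (j + 1) ^ 4 * sparse j := by
  rw [sparse, sparse, Nat.factorial_succ, mul_pow]

theorem tendsto_sparse : Tendsto sparse atTop atTop :=
  tendsto_atTop_mono le_sparse tendsto_id

/-- The fourth power in `sparse` is there for this: the inverse ratios are summable, which makes the
past of a block negligible. -/
theorem lilNorm_sparse_le (j : ℕ) :
    ((j : ℝ) + 1) ^ 2 * lilNorm (sparse j) ≤ lilNorm (sparse (j + 1)) := by
  have h1 : (1 : ℝ) ≤ ((j : ℝ) + 1) ^ 4 := one_le_pow₀ (by linarith [Nat.cast_nonneg (α := ℝ) j])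
  have h2 := sqrt_mul_lilScale_le h1 (Nat.cast_nonneg (sparse j))
  rw [show ((j : ℝ) + 1) ^ 4 = (((j : ℝ) + 1) ^ 2) ^ 2 by ring, Real.sqrt_sq (by positivity)] at h2
  rw [lilNorm_eq, lilNorm_eq, sparse_succ]
  refine h2.trans_eq ?_
  push_cast
  ring_nf

theorem eventually_sparse_le {ρ : ℝ} (hρ : ρ < 1) :
    ∀ᶠ j in atTop, ρ * sparse (j + 1) ≤ ((sparse (j + 1) - sparse j : ℕ) : ℝ) := by
  have h1 : ∀ᶠ j : ℕ in atTop, 1 / (1 - ρ) ≤ (j : ℝ) :=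
    tendsto_natCast_atTop_atTop.eventually_ge_atTop _
  filter_upwards [h1] with j hj
  have hρ' : 0 < 1 - ρ := sub_pos.2 hρ
  rw [Nat.cast_sub (sparse_mono (Nat.le_succ j))]
  rw [div_le_iff₀ hρ'] at hj
  have h2 : (sparse (j + 1) : ℝ) = ((j : ℝ) + 1) ^ 4 * sparse j := by
    rw [sparse_succ]
    push_cast
    ring
  have h3 : (0 : ℝ) ≤ sparse j := Nat.cast_nonneg _
  have hj0 : (0 : ℝ) ≤ j := Nat.cast_nonneg _
  have h4 : 1 ≤ (1 - ρ) * ((j : ℝ) + 1) ^ 4 := by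
    have : (j : ℝ) ≤ ((j : ℝ) + 1) ^ 4 := by
      have := one_le_pow₀ (n := 3) (show (1 : ℝ) ≤ (j : ℝ) + 1 by linarith)
      nlinarith
    nlinarith
  rw [h2]
  nlinarith

theorem eventually_two_mul_sparse_le : ∀ᶠ j in atTop, (2 : ℝ) * sparse j ≤ sparse (j + 1) := by
  filter_upwards [eventually_ge_atTop 1] with j hj
  rw [sparse_succ]
  have h1 : (1 : ℝ) ≤ j := by exact_mod_cast hj
  have h2 : (2 : ℝ) ≤ ((j : ℝ) + 1) ^ 4 := by
    have := pow_le_pow_left₀ (by norm_num) (show (2 : ℝ) ≤ (j : ℝ) + 1 by linarith) 4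
    linarith
  push_cast
  gcongr

/-- The times are not too sparse either: `log (sparse j)` is at most `4 j log j`, hence of order at
most `j ^ (1 / θ)`, so the success probabilities of the blocks decay no faster than `1 / j`. -/
theorem exists_div_le_exp_llog_sparse {θ : ℝ} (hθ : 0 < θ) (hθ1 : θ < 1) :
    ∃ c : ℝ, 0 < c ∧ ∀ j : ℕ, 0 < j → c / j ≤ Real.exp (-(θ * llog (sparse j))) := by
  set s := 1 / θ - 1 with hs
  have hs0 : 0 < s := sub_pos.2 ((one_lt_div hθ).2 hθ1)
  set A := Real.exp 1 + 4 / s with hA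
  have hA0 : 0 < A := by positivity
  refine ⟨A ^ (-θ), by positivity, fun j hj => ?_⟩
  have hj1 : (1 : ℝ) ≤ j := by exact_mod_cast hj
  have hj0 : (0 : ℝ) < j := by linarith
  have hjθ : 1 ≤ (j : ℝ) ^ (1 / θ) := Real.one_le_rpow hj1 (by positivity)
  have he1 : (1 : ℝ) ≤ Real.exp 1 := Real.one_le_exp zero_le_one
  have h1 : logE (sparse j) ≤ Real.exp 1 + 4 / s * (j : ℝ) ^ (1 / θ) := by
    have hsp : (1 : ℝ) ≤ sparse j := by exact_mod_cast sparse_pos j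
    have h2 : logE (sparse j) ≤ 1 + Real.log (sparse j) := by
      have hl := Real.log_nonneg hsp
      rw [logE]
      rcases le_total (Real.exp 1) (sparse j : ℝ) with h | h
      · rw [max_eq_right h]
        linarith
      · rw [max_eq_left h, Real.log_exp]
        linarith
    have h3 : Real.log (sparse j) ≤ 4 * (j * Real.log j) := by
      rw [sparse, Nat.cast_pow, Real.log_pow]
      have : Real.log (j.factorial : ℝ) ≤ j * Real.log j := by
        rw [← Real.log_pow]
        exact Real.log_le_log (by exact_mod_cast j.factorial_pos)
          (by exact_mod_cast Nat.factorial_le_pow j)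
      push_cast
      linarith
    have h4 : j * Real.log j ≤ (j : ℝ) ^ (1 / θ) / s := by
      calc j * Real.log j ≤ j * ((j : ℝ) ^ s / s) := by
            gcongr
            exact Real.log_le_rpow_div hj0.le hs0
        _ = (j : ℝ) ^ (1 / θ) / s := by
            rw [mul_div_assoc', hs, Real.rpow_sub_one hj0.ne', mul_div_cancel₀ _ hj0.ne']
    calc logE (sparse j) ≤ 1 + 4 * ((j : ℝ) ^ (1 / θ) / s) := by linarith
      _ ≤ _ := by
        rw [div_mul_eq_mul_div, mul_div_assoc]
        linarith
  have h2 : llog (sparse j) ≤ Real.log (A * (j : ℝ) ^ (1 / θ)) := by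
    rw [llog, logE]
    refine Real.log_le_log (lt_max_of_lt_left (Real.exp_pos 1)) ?_
    have h4s : 0 ≤ 4 / s := by positivity
    refine max_le ?_ (h1.trans ?_) <;> rw [hA, add_mul] <;> nlinarith
  rw [Real.log_mul hA0.ne' (by positivity), Real.log_rpow hj0] at h2
  calc A ^ (-θ) / j = Real.exp (-(θ * (Real.log A + 1 / θ * Real.log j))) := by
        have e : -(θ * (Real.log A + 1 / θ * Real.log j)) = Real.log A * -θ + -Real.log j := by
          field_simp
          ring
        rw [e, Real.exp_add, Real.exp_neg (Real.log j), Real.exp_log hj0,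
          ← Real.rpow_def_of_pos hA0, div_eq_mul_inv]
    _ ≤ _ := Real.exp_le_exp.2 (neg_le_neg (by gcongr))

/-- The class of an index, the exponent of two in its successor. -/
def indexClass (j : ℕ) : ℕ := padicValNat 2 (j + 1)

theorem indexClass_eq (k i : ℕ) : indexClass (2 ^ k * (2 * i + 1) - 1) = k := by
  have h0 : 0 < 2 ^ k * (2 * i + 1) := by positivity
  rw [indexClass, Nat.sub_add_cancel h0, padicValNat.mul (by positivity) (by positivity),
    padicValNat.prime_pow, padicValNat.eq_zero_of_not_dvd (by omega), add_zero]

/-- The class `k` contains an arithmetic progression of step `2 ^ (k + 1)`, along which the harmonic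
series diverges. One sequence of blocks can thus serve countably many targets. -/
theorem tsum_indexClass_eq_top {c : ℝ} (hc : 0 < c) (k : ℕ) :
    ∑' j : ℕ, (if indexClass j = k then ENNReal.ofReal (c / (j + 1 : ℕ)) else 0) = ⊤ := by
  by_contra hne
  let f : ℕ → ℕ := fun i => 2 ^ k * (2 * i + 1) - 1
  have hf1 : ∀ i, f i + 1 = 2 ^ k * (2 * i + 1) := fun i =>
    Nat.sub_add_cancel (show 0 < 2 ^ k * (2 * i + 1) by positivity)
  have hf : Function.Injective f := fun a b hab => by
    have h1 : f a + 1 = f b + 1 := by rw [hab]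
    rw [hf1, hf1] at h1
    have := Nat.eq_of_mul_eq_mul_left (by positivity) h1
    omega
  have h1 := ENNReal.tsum_comp_le_tsum_of_injective hf
    fun j : ℕ => if indexClass j = k then ENNReal.ofReal (c / (j + 1 : ℕ)) else 0
  have h2 : ∑' i : ℕ, ENNReal.ofReal (c / 2 ^ (k + 1) * (1 / ((i + 1 : ℕ) : ℝ))) ≠ ⊤ := by
    refine ne_top_of_le_ne_top hne (le_trans (ENNReal.tsum_le_tsum fun i => ?_) h1)
    rw [if_pos (indexClass_eq k i), hf1]
    refine ENNReal.ofReal_le_ofReal ?_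
    rw [div_mul_div_comm, mul_one]
    refine div_le_div_of_nonneg_left hc.le (by positivity) ?_
    push_cast
    rw [pow_succ, mul_assoc]
    gcongr
    linarith
  have h3 := ENNReal.summable_toReal h2
  have h4 : Summable fun i : ℕ => 1 / ((i + 1 : ℕ) : ℝ) := by
    refine (summable_mul_left_iff (show c / 2 ^ (k + 1) ≠ 0 by positivity)).1
      (h3.congr fun i => ?_)
    rw [ENNReal.toReal_ofReal (by positivity)]
  exact Real.not_summable_one_div_natCast
    ((summable_nat_add_iff (f := fun i : ℕ => 1 / (i : ℝ)) 1).1 h4)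

/-- The number of the block that contains a given time. -/
noncomputable def blockIndex (i : ℕ) : ℕ := sInf {j | i < sparse (j + 1)}

theorem blockIndex_eq {i j : ℕ} (h1 : sparse j ≤ i) (h2 : i < sparse (j + 1)) :
    blockIndex i = j := by
  refine le_antisymm (Nat.sInf_le h2) (le_csInf ⟨j, h2⟩ fun l hl => ?_)
  by_contra! hlj
  have := sparse_mono (show l + 1 ≤ j by omega)
  have hl' : i < sparse (l + 1) := hl
  omega

open ProbabilityTheory

theorem measurableSet_le_mul (a s : ℝ) : MeasurableSet {y : ℝ | a ≤ s * y} :=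
  measurableSet_le measurable_const (by fun_prop)

theorem exists_signed_block_bound {μ : Measure ℝ} [IsProbabilityMeasure μ] {C : ℝ} (hC : 0 ≤ C)
    (h : ∫⁻ x, ENNReal.ofReal (x ^ 2 / llog |x|) ∂μ ≤ ENNReal.ofReal C) (hmean : ∫ x, x ∂μ = 0)
    {K s : ℝ} (hs : s = 1 ∨ s = -1) (hK : 0 < K)
    (hKv : ENNReal.ofReal (K ^ 2) < ∫⁻ x, ENNReal.ofReal (x ^ 2) ∂μ) :
    ∃ ρ θ c L : ℝ, ρ < 1 ∧ 0 < θ ∧ θ < 1 ∧ 0 < c ∧ ∀ m N : ℕ, L ≤ m → ρ * m ≤ N → N ≤ m →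
      m * μ.real {x | Real.sqrt (m / llog m) ≤ |x|} ≤ 1 → ∃ n ≤ N,
        ENNReal.ofReal (c * Real.exp (-(θ * llog m))) ≤
          convPow μ n {y | K * lilNorm m ≤ s * y} := by
  rcases hs with rfl | rfl
  · simp only [one_mul]
    exact exists_block_bound hC h hmean hK hKv
  · have hl : Measurable llog := llog_mono.measurable
    have hn : Measurable (Neg.neg : ℝ → ℝ) := measurable_neg
    have : IsProbabilityMeasure (μ.map Neg.neg) := Measure.isProbabilityMeasure_map hn.aemeasurable
    obtain ⟨ρ, θ, c, L, hρ, hθ, hθ1, hc, H⟩ := exists_block_bound (μ := μ.map Neg.neg) hC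
      (by rw [lintegral_map (by fun_prop) hn]; simpa using h)
      (by rw [integral_map hn.aemeasurable (by fun_prop), integral_neg, hmean, neg_zero]) hK
      (by rw [lintegral_map (by fun_prop) hn]; simpa using hKv)
    refine ⟨ρ, θ, c, L, hρ, hθ, hθ1, hc, fun m N h1 h2 h3 h4 => ?_⟩
    have hms : MeasurableSet {x : ℝ | Real.sqrt (m / llog m) ≤ |x|} :=
      measurableSet_le measurable_const (by fun_prop)
    obtain ⟨n, hn', hb⟩ := H m N h1 h2 h3 (by
      rw [measureReal_def, Measure.map_apply hn hms]
      simpa [measureReal_def] using h4)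
    refine ⟨n, hn', hb.trans_eq ?_⟩
    rw [convPow_map_neg, Measure.map_apply hn measurableSet_Ici]
    congr 1
    ext y
    simp [le_neg]

/-- Where the tail hypothesis of the block bound fails, `exp (-θ l)` is at most a multiple of `1 / l
^ 2`, hence of `m / l ^ 2` times the tail, and `tsum_sqrt_scale_lt_top` makes these terms summable.
What is left of the divergent harmonic series comes from blocks where the bound applies. -/
theorem exists_block_lengths {M : Set (Measure ℝ)} (hM : ∀ μ ∈ M, IsProbabilityMeasure μ)
    (hT : TailIntegrable M) {μ : Measure ℝ} (hμ : μ ∈ M) {C : ℝ} (hC : 0 ≤ C)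
    (h : ∫⁻ x, ENNReal.ofReal (x ^ 2 / llog |x|) ∂μ ≤ ENNReal.ofReal C) (hmean : ∫ x, x ∂μ = 0)
    {K s : ℝ} (hs : s = 1 ∨ s = -1) (hK : 0 < K)
    (hKv : ENNReal.ofReal (K ^ 2) < ∫⁻ x, ENNReal.ofReal (x ^ 2) ∂μ) (k : ℕ) :
    ∃ n : ℕ → ℕ, (∀ j, n j ≤ sparse (j + 1) - sparse j) ∧
      ∑' j, (if indexClass j = k then
        convPow μ (n j) {y | K * lilNorm (sparse (j + 1)) ≤ s * y} else 0) = ⊤ := by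
  have := hM μ hμ
  obtain ⟨ρ, θ, c, L, hρ, hθ, hθ1, hc, H⟩ := exists_signed_block_bound hC h hmean hs hK hKv
  set m : ℕ → ℕ := fun j => sparse (j + 1) with hm
  have hex : ∀ j, ∃ n ≤ m j - sparse j, L ≤ m j → ρ * m j ≤ (m j - sparse j : ℕ) →
      m j * μ.real {x | Real.sqrt (m j / llog (m j)) ≤ |x|} ≤ 1 →
      ENNReal.ofReal (c * Real.exp (-(θ * llog (m j)))) ≤
        convPow μ n {y | K * lilNorm (m j) ≤ s * y} := fun j => by
    by_cases hj : L ≤ m j ∧ ρ * m j ≤ (m j - sparse j : ℕ) ∧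
      m j * μ.real {x | Real.sqrt (m j / llog (m j)) ≤ |x|} ≤ 1
    · obtain ⟨n, hn, hb⟩ := H (m j) (m j - sparse j) hj.1 hj.2.1 (Nat.sub_le _ _) hj.2.2
      exact ⟨n, hn, fun _ _ _ => hb⟩
    · exact ⟨0, Nat.zero_le _, fun h1 h2 h3 => (hj ⟨h1, h2, h3⟩).elim⟩
  choose n hn hb using hex
  refine ⟨n, hn, ?_⟩
  have hmt : Tendsto m atTop atTop := tendsto_sparse.comp (tendsto_add_atTop_nat 1)
  have hbad := TailIntegrable.tsum_sqrt_scale_lt_top hM hT one_pos (m := m) (ρ := 2) one_lt_two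
    ((tendsto_add_atTop_nat 1).eventually eventually_two_mul_sparse_le) hmt
  obtain ⟨J, hJ⟩ := eventually_atTop.1 ((eventually_sparse_le hρ).and
    ((tendsto_natCast_atTop_atTop.comp hmt).eventually_ge_atTop L))
  obtain ⟨c', hc', hexp⟩ := exists_div_le_exp_llog_sparse hθ hθ1
  by_contra hne
  have hle : ∀ j, (if indexClass j = k then ENNReal.ofReal (c * c' / (j + 1 : ℕ)) else 0) ≤
      ((if indexClass j = k then convPow μ (n j) {y | K * lilNorm (m j) ≤ s * y} else 0) +
        ENNReal.ofReal (c * (2 / θ ^ 2)) * (ENNReal.ofReal (m j / llog (m j) ^ 2) *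
          tailSup M (1 * Real.sqrt (m j / llog (m j))))) +
      (if j ∈ Finset.range J then ENNReal.ofReal c else 0) := fun j => by
    split_ifs with hjk hj hj
    · refine le_add_left (ENNReal.ofReal_le_ofReal ?_)
      rw [mul_div_assoc]
      refine (mul_le_mul_of_nonneg_left (hexp (j + 1) j.succ_pos) hc.le).trans ?_
      refine mul_le_of_le_one_right hc.le (Real.exp_le_one_iff.2 ?_)
      have := llog_pos (sparse (j + 1))
      rw [neg_nonpos]
      positivity
    · rw [add_zero]
      have hj' := hJ j (by simpa using hj)
      have hstep : ENNReal.ofReal (c * c' / (j + 1 : ℕ)) ≤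
          ENNReal.ofReal (c * Real.exp (-(θ * llog (m j)))) := by
        refine ENNReal.ofReal_le_ofReal ?_
        rw [mul_div_assoc]
        exact mul_le_mul_of_nonneg_left (hexp (j + 1) j.succ_pos) hc.le
      by_cases hg : m j * μ.real {x | Real.sqrt (m j / llog (m j)) ≤ |x|} ≤ 1
      · exact le_add_right (hstep.trans (hb j hj'.2 hj'.1 hg))
      · refine le_add_left (hstep.trans ?_)
        have hl := llog_pos (m j)
        set l := llog (m j) with hl_def
        have he : Real.exp (-(θ * l)) ≤ 2 / θ ^ 2 * (1 / l ^ 2) := by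
          have h1 := Real.quadratic_le_exp_of_nonneg (show 0 ≤ θ * l by positivity)
          rw [Real.exp_neg, ← one_div, div_mul_div_comm, mul_one,
            div_le_div_iff₀ (Real.exp_pos _) (by positivity)]
          nlinarith [mul_pos hθ hl]
        have h2 : ENNReal.ofReal (μ.real {x | Real.sqrt (m j / l) ≤ |x|}) ≤
            tailSup M (1 * Real.sqrt (m j / l)) := by
          rw [ofReal_measureReal, one_mul]
          exact measure_le_tailSup hμ _
        calc ENNReal.ofReal (c * Real.exp (-(θ * l)))
            ≤ ENNReal.ofReal (c * (2 / θ ^ 2) * (m j / l ^ 2 *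
                μ.real {x | Real.sqrt (m j / l) ≤ |x|})) := by
              refine ENNReal.ofReal_le_ofReal ?_
              rw [mul_assoc]
              refine mul_le_mul_of_nonneg_left (he.trans ?_) hc.le
              refine mul_le_mul_of_nonneg_left ?_ (by positivity)
              rw [div_mul_eq_mul_div]
              exact div_le_div_of_nonneg_right (not_le.1 hg).le (by positivity)
          _ ≤ _ := by
              rw [ENNReal.ofReal_mul (by positivity), ENNReal.ofReal_mul (p := m j / l ^ 2) (by positivity)]
              gcongr
    · exact zero_le
    · exact zero_le
  have htot := (tsum_indexClass_eq_top (mul_pos hc hc') k).symm.le.trans (ENNReal.tsum_le_tsum hle)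
  rw [ENNReal.tsum_add, ENNReal.tsum_add, ENNReal.tsum_mul_left] at htot
  refine absurd htot (not_le.2 (ENNReal.add_lt_top.2 ⟨ENNReal.add_lt_top.2
    ⟨lt_top_iff_ne_top.2 hne, ENNReal.mul_lt_top ENNReal.ofReal_lt_top hbad⟩, ?_⟩))
  rw [tsum_eq_sum (s := Finset.range J) fun j hj => if_neg hj]
  refine ENNReal.sum_lt_top.2 fun j _ => ?_
  split_ifs
  simp

/-! ### Large values of the walk under a blockwise product law. -/

section law

variable {Ω : Type*} [MeasurableSpace Ω] {P : Measure Ω} {X : ℕ → Ω → ℝ}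
  (hX : iIndepFun X P) (hm : ∀ i, Measurable (X i)) {C : ℝ} (hC : 0 ≤ C)
include hX hm hC

/-- The expected ratio is at most `(1 + 4 C) / (j + 1) ^ 2`, so the ratios have an integrable, hence
almost surely finite, sum. -/
theorem ae_eventually_abs_sum_sparse_le
    (h : ∀ i, ∫⁻ ω, ENNReal.ofReal (X i ω ^ 2 / llog |X i ω|) ∂P ≤ ENNReal.ofReal C)
    (hmean : ∀ i, ∫ ω, X i ω ∂P = 0) :
    ∀ᵐ ω ∂P, ∀ ε > 0, ∀ᶠ j in atTop,
      |∑ i ∈ Finset.range (sparse j), X i ω| ≤ ε * lilNorm (sparse (j + 1)) := by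
  have hpos : ∀ j, 0 < lilNorm (sparse j) := fun j => by
    rw [lilNorm_eq]
    exact lilScale_pos (by exact_mod_cast sparse_pos j)
  set f : ℕ → Ω → ℝ≥0∞ := fun j ω =>
    ENNReal.ofReal (|∑ i ∈ Finset.range (sparse j), X i ω| / lilNorm (sparse (j + 1))) with hf
  have hfm : ∀ j, Measurable (f j) := fun j => by fun_prop
  have hfi : ∀ j, ∫⁻ ω, f j ω ∂P ≤ ENNReal.ofReal ((1 + 4 * C) * (1 / ((j : ℝ) + 1) ^ 2)) := fun j => by
    have h1 : ∀ ω, f j ω = ENNReal.ofReal (1 / lilNorm (sparse (j + 1))) *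
        ENNReal.ofReal |∑ i ∈ Finset.range (sparse j), X i ω| := fun ω => by
      have := (hpos (j + 1)).le
      rw [← ENNReal.ofReal_mul (by positivity), one_div_mul_eq_div]
    have h2 := hpos (j + 1)
    simp only [h1]
    rw [lintegral_const_mul _ (by fun_prop)]
    refine (mul_le_mul_right (lintegral_abs_sum_le hX hm hC h hmean _) _).trans ?_
    rw [← ENNReal.ofReal_mul (by positivity)]
    refine ENNReal.ofReal_le_ofReal ?_
    rw [mul_left_comm]
    refine mul_le_mul_of_nonneg_left ?_ (by positivity)
    rw [one_div_mul_eq_div, div_le_div_iff₀ h2 (by positivity), one_mul, mul_comm]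
    exact lilNorm_sparse_le j
  have hsum : ∫⁻ ω, ∑' j, f j ω ∂P ≠ ⊤ := by
    rw [lintegral_tsum fun j => (hfm j).aemeasurable]
    refine ne_top_of_le_ne_top ?_ (ENNReal.tsum_le_tsum hfi)
    refine (Summable.mul_left _ ?_).tsum_ofReal_ne_top
    have := (summable_nat_add_iff (f := fun n : ℕ => 1 / (n : ℝ) ^ 2) 1).2
      (Real.summable_one_div_nat_pow.2 one_lt_two)
    exact_mod_cast this
  filter_upwards [ae_lt_top (Measurable.tsum hfm) hsum] with ω hω ε hε
  have h1 := (ENNReal.tendsto_atTop_zero_of_tsum_ne_top hω.ne).eventually_lt_const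
    (ENNReal.ofReal_pos.2 hε)
  filter_upwards [h1] with j hj
  rw [ENNReal.ofReal_lt_ofReal_iff hε, div_lt_iff₀ (hpos _)] at hj
  exact hj.le

/-- The block with number `j` carries the law of its class. For each class the second Borel–Cantelli
lemma gives infinitely many large increments, and the loss from `K k` to `K'` pays for the past of
the block. -/
theorem ae_frequently_mul_lilNorm_le {M : Set (Measure ℝ)} (hM : ∀ μ ∈ M, IsProbabilityMeasure μ)
    (hT : TailIntegrable M)
    (h : ∀ μ ∈ M, ∫⁻ x, ENNReal.ofReal (x ^ 2 / llog |x|) ∂μ ≤ ENNReal.ofReal C)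
    (hmean : ∀ μ ∈ M, ∫ x, x ∂μ = 0) {μ : ℕ → Measure ℝ} (hμ : ∀ k, μ k ∈ M) {K s : ℕ → ℝ}
    (hs : ∀ k, s k = 1 ∨ s k = -1) (hK : ∀ k, 0 < K k)
    (hKv : ∀ k, ENNReal.ofReal (K k ^ 2) < ∫⁻ x, ENNReal.ofReal (x ^ 2) ∂(μ k))
    (hlaw : ∀ i, P.map (X i) = μ (indexClass (blockIndex i))) :
    ∀ᵐ ω ∂P, ∀ k, ∀ K' < K k, ∃ᶠ n in atTop,
      K' * lilNorm n ≤ s k * ∑ i ∈ Finset.range n, X i ω := by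
  have hP := hX.isProbabilityMeasure
  have hl : Measurable llog := llog_mono.measurable
  have h1 : ∀ k, ∀ᵐ ω ∂P, ∃ᶠ j in atTop, ∃ n ≤ sparse (j + 1) - sparse j,
      K k * lilNorm (sparse (j + 1)) ≤ s k * ∑ i ∈ Finset.Ico (sparse j) (sparse j + n), X i ω := by
    intro k
    have := hM _ (hμ k)
    obtain ⟨n, hn, htop⟩ := exists_block_lengths hM hT (hμ k) hC (h _ (hμ k)) (hmean _ (hμ k))
      (hs k) (hK k) (hKv k) k
    have hbl : ∀ j, sparse j + n j ≤ sparse (j + 1) := fun j => by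
      have := hn j
      have := sparse_mono (Nat.le_succ j)
      simp only [Nat.succ_eq_add_one] at this
      omega
    set B : ℕ → Set ℝ := fun j =>
      if indexClass j = k then {y | K k * lilNorm (sparse (j + 1)) ≤ s k * y} else ∅ with hB
    have hBm : ∀ j, MeasurableSet (B j) := fun j => by
      simp only [hB]
      split_ifs
      exacts [measurableSet_le_mul _ _, .empty]
    have hsum : ∑' j, P {ω | ∑ i ∈ Finset.Ico (sparse j) (sparse j + n j), X i ω ∈ B j} = ⊤ := by
      rw [← htop]
      refine tsum_congr fun j => ?_
      simp only [hB]
      split_ifs with hj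
      · have e := map_sum_Ico_eq_convPow hX hm (μ := μ k) (sparse j) (n j) fun i hi => by
          rw [Finset.mem_Ico] at hi
          rw [hlaw, blockIndex_eq hi.1 (hi.2.trans_le (hbl j)), hj]
        rw [← e, Measure.map_apply (by fun_prop) (measurableSet_le_mul _ _)]
        rfl
      · simp
    filter_upwards [ae_frequently_sum_Ico hX hm (a := sparse) (b := fun j => sparse j + n j)
      (fun i j hij => (hbl i).trans (sparse_mono hij)) hBm hsum] with ω hω
    refine hω.mono fun j hj => ⟨n j, hn j, ?_⟩
    simp only [hB] at hj
    split_ifs at hj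
    · exact hj
    · exact hj.elim
  have h2 := ae_eventually_abs_sum_sparse_le hX hm hC
    (fun i => by
      rw [← lintegral_map (f := fun x => ENNReal.ofReal (x ^ 2 / llog |x|)) (by fun_prop) (hm i),
        hlaw]
      exact h _ (hμ _))
    (fun i => by
      rw [← integral_map (f := fun x => x) (hm i).aemeasurable (by fun_prop), hlaw]
      exact hmean _ (hμ _))
  filter_upwards [ae_all_iff.2 h1, h2] with ω h1 h2 k K' hK'
  -- A negative `K'` is replaced by zero, so that passing to the larger norm `lilNorm (sparse (j +
  -- 1))` goes in the right direction.
  have hε : 0 < K k - max K' 0 := sub_pos.2 (max_lt hK' (hK k))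
  refine frequently_atTop.2 fun a => ?_
  obtain ⟨j, ⟨⟨n, hn, hb⟩, hj⟩, haj⟩ :=
    (((h1 k).and_eventually (h2 _ hε)).and_eventually (eventually_ge_atTop a)).exists
  have hsj := sparse_mono (Nat.le_succ j)
  simp only [Nat.succ_eq_add_one] at hsj
  refine ⟨sparse j + n, haj.trans ((le_sparse j).trans (Nat.le_add_right _ _)), ?_⟩
  rw [← Finset.sum_range_add_sum_Ico _ (Nat.le_add_right (sparse j) n), mul_add]
  have h3 : -|∑ i ∈ Finset.range (sparse j), X i ω| ≤
      s k * ∑ i ∈ Finset.range (sparse j), X i ω := by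
    rcases hs k with e | e <;> rw [e]
    · linarith [neg_abs_le (∑ i ∈ Finset.range (sparse j), X i ω)]
    · linarith [le_abs_self (∑ i ∈ Finset.range (sparse j), X i ω)]
  have h4 : lilNorm (sparse j + n) ≤ lilNorm (sparse (j + 1)) := by
    rw [lilNorm_eq, lilNorm_eq]
    exact lilScale_mono (Nat.cast_nonneg _) (by exact_mod_cast (by omega))
  have h5 : 0 ≤ lilNorm (sparse j + n) := Real.sqrt_nonneg _
  have h6 : K' * lilNorm (sparse j + n) ≤ max K' 0 * lilNorm (sparse (j + 1)) :=
    mul_le_mul (le_max_left _ _) h4 h5 (le_max_right _ _)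
  rw [sub_mul] at hj
  linarith

end law

open ProbabilityTheory

/-! ### Cluster sets of slowly moving sequences. -/

section cluster

variable {x : ℕ → ℝ}

/-- A discrete intermediate value theorem: the first passage to `a` after a time below `a`
overshoots by at most one step, and the steps vanish. -/
theorem mapClusterPt_of_frequently_le_of_frequently_ge
    (hstep : Tendsto (fun n => x (n + 1) - x n) atTop (𝓝 0)) {a : ℝ}
    (h1 : ∃ᶠ n in atTop, x n ≤ a) (h2 : ∃ᶠ n in atTop, a ≤ x n) : MapClusterPt a atTop x := by
  rw [mapClusterPt_iff_frequently]
  intro s hs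
  obtain ⟨ε, hε, hs⟩ := Metric.mem_nhds_iff.1 hs
  refine frequently_atTop.2 fun N => ?_
  obtain ⟨N₁, hN₁⟩ := eventually_atTop.1 (hstep.eventually (Metric.ball_mem_nhds 0 hε))
  obtain ⟨m, hm, hma⟩ := frequently_atTop.1 h1 (max N N₁)
  have hex : ∃ p, m ≤ p ∧ a ≤ x p := frequently_atTop.1 h2 m
  classical
  obtain ⟨hp, hpa⟩ := Nat.find_spec hex
  set p := Nat.find hex with hp_def
  refine ⟨p, (le_max_left _ _).trans (hm.trans hp), hs ?_⟩
  rw [Metric.mem_ball, Real.dist_eq]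
  rcases hp.eq_or_lt with e | hlt
  · rw [← e] at hpa ⊢
    rw [le_antisymm hma hpa, sub_self, abs_zero]
    exact hε
  · have hprev : x (p - 1) < a := by
      by_contra! hge
      have := Nat.find_min hex (m := p - 1) (by omega)
      exact this ⟨by omega, hge⟩
    have := hN₁ (p - 1) ((le_max_right _ _).trans (hm.trans (by omega)))
    rw [Nat.sub_add_cancel (by omega), Real.dist_eq, sub_zero, abs_lt] at this
    rw [abs_lt]
    constructor <;> linarith

theorem isClosed_clusterSet (x : ℕ → ℝ) : IsClosed (clusterSet x) := isClosed_setOfPred_clusterPt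

/-- Interior reals are crossed infinitely often; the endpoints, possibly infinite, follow because
the cluster set is closed. For `σ = 0` the interior is empty, and the sequence converges to zero
instead. -/
theorem clusterSet_eq_Icc (hstep : Tendsto (fun n => x (n + 1) - x n) atTop (𝓝 0)) {σ : ℝ≥0∞}
    (hup : ∀ s : ℝ, σ < ENNReal.ofReal s → ∀ᶠ n in atTop, |x n| ≤ s)
    (hlow : ∀ K : ℝ, 0 ≤ K → ENNReal.ofReal K < σ →
      (∃ᶠ n in atTop, K ≤ x n) ∧ ∃ᶠ n in atTop, x n ≤ -K) :
    clusterSet x = Icc (-(σ : EReal)) (σ : EReal) := by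
  have hreal : ∀ s : ℝ, (σ : EReal) < s → ∀ᶠ n in atTop, |x n| ≤ s := fun s hs => by
    refine hup s ?_
    have hs0 : (0 : EReal) < s := (EReal.coe_ennreal_nonneg σ).trans_lt hs
    rw [← EReal.coe_ennreal_lt_coe_ennreal_iff, EReal.coe_ennreal_ofReal,
      max_eq_left (by exact_mod_cast hs0.le)]
    exact hs
  refine Subset.antisymm (fun a ha => ⟨?_, ?_⟩) ?_
  · by_contra! hlt
    rw [EReal.lt_neg_comm] at hlt
    obtain ⟨s, hs1, hs2⟩ := EReal.lt_iff_exists_real_btwn.1 hlt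
    rw [EReal.lt_neg_comm] at hs2
    have h1 := mapClusterPt_iff_frequently.1 ha _ (Iio_mem_nhds hs2)
    obtain ⟨n, hn1, hn2⟩ := (h1.and_eventually (hreal s hs1)).exists
    rw [mem_Iio, ← EReal.coe_neg, EReal.coe_lt_coe_iff] at hn1
    linarith [neg_abs_le (x n)]
  · by_contra! hlt
    obtain ⟨s, hs1, hs2⟩ := EReal.lt_iff_exists_real_btwn.1 hlt
    have h1 := mapClusterPt_iff_frequently.1 ha _ (Ioi_mem_nhds hs2)
    obtain ⟨n, hn1, hn2⟩ := (h1.and_eventually (hreal s hs1)).exists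
    rw [mem_Ioi, EReal.coe_lt_coe_iff] at hn1
    linarith [le_abs_self (x n)]
  · rcases eq_or_ne σ 0 with rfl | hσ
    · simp only [EReal.coe_ennreal_zero, neg_zero, Icc_self, singleton_subset_iff]
      have h0 : Tendsto x atTop (𝓝 0) := by
        rw [Metric.tendsto_atTop']
        intro ε hε
        obtain ⟨N, hN⟩ := eventually_atTop.1 (hup (ε / 2) (by simpa using hε))
        refine ⟨N, fun n hn => ?_⟩
        rw [Real.dist_eq, sub_zero]
        linarith [hN n hn.le]
      exact ((continuous_coe_real_ereal.tendsto 0).comp h0).mapClusterPt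
    · have hne : -(σ : EReal) ≠ σ := by
        have h1 : (0 : EReal) < σ := by exact_mod_cast pos_iff_ne_zero.2 hσ
        have h2 : -(σ : EReal) < 0 := by simpa using h1
        exact (h2.trans h1).ne
      rw [← closure_Ioo hne]
      refine closure_minimal (fun a ha => ?_) (isClosed_clusterSet x)
      lift a to ℝ using ⟨(ha.2.trans_le le_top).ne, (bot_le.trans_lt ha.1).ne'⟩
      have hK : ENNReal.ofReal |a| < σ := by
        rw [← EReal.coe_ennreal_lt_coe_ennreal_iff, EReal.coe_ennreal_ofReal,
          max_eq_left (abs_nonneg a)]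
        rcases abs_choice a with h | h <;> rw [h]
        · exact ha.2
        · rw [EReal.coe_neg, EReal.neg_lt_comm]
          exact ha.1
      obtain ⟨h1, h2⟩ := hlow |a| (abs_nonneg a) hK
      exact (mapClusterPt_of_frequently_le_of_frequently_ge hstep
        (h2.mono fun n hn => hn.trans (neg_abs_le a)) (h1.mono fun n hn => (le_abs_self a).trans hn)
        ).continuousAt_comp continuous_coe_real_ereal.continuousAt

theorem limsup_abs_eq_top (h : ∀ K : ℕ, ∃ᶠ n in atTop, (K : ℝ) ≤ |x n|) :
    limsup (fun n => ((|x n| : ℝ) : EReal)) atTop = ⊤ := by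
  refine EReal.eq_top_iff_forall_lt _ |>.2 fun y => ?_
  obtain ⟨K, hK⟩ := exists_nat_gt y
  refine lt_of_lt_of_le (EReal.coe_lt_coe_iff.2 hK) (le_limsup_of_frequently_le ?_)
  exact (h K).mono fun n hn => EReal.coe_le_coe_iff.2 hn

end cluster

theorem lilNorm_pos {n : ℕ} (hn : 0 < n) : 0 < lilNorm n := by
  rw [lilNorm_eq]
  exact lilScale_pos (by exact_mod_cast hn)

theorem lilNorm_mono : Monotone lilNorm := fun a b h => by
  rw [lilNorm_eq, lilNorm_eq]
  exact lilScale_mono (Nat.cast_nonneg _) (by exact_mod_cast h)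

theorem lilNorm_succ_le {n : ℕ} (hn : 0 < n) :
    lilNorm (n + 1) ≤ (1 + 1 / n) * lilNorm n := by
  have hn' : (0 : ℝ) < n := by exact_mod_cast hn
  rw [lilNorm_eq, lilNorm_eq]
  refine le_trans (le_of_eq ?_) (lilScale_mul_le (c := 1 + 1 / n) (by simp) hn'.le)
  push_cast
  field_simp

/-- If the steps of a walk are negligible, so are those of the normalized walk. -/
theorem tendsto_lilRatio_step {y : ℕ → ℝ}
    (h : Tendsto (fun n => y n / lilNorm (n + 1)) atTop (𝓝 0)) :
    Tendsto (fun n => (∑ i ∈ Finset.range (n + 1), y i) / lilNorm (n + 1) -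
      (∑ i ∈ Finset.range n, y i) / lilNorm n) atTop (𝓝 0) := by
  have h1 : Tendsto (fun n => |y n| / lilNorm (n + 1)) atTop (𝓝 0) := by
    have := h.abs
    rw [abs_zero] at this
    refine this.congr fun n => ?_
    rw [abs_div, abs_of_pos (lilNorm_pos n.succ_pos)]
  -- Passing from `lilNorm n` to `lilNorm (n + 1)` has a relative effect of at most `1 / n`, so it
  -- contributes no more than the average of the normalized steps, a null sequence by Cesàro.
  have h2 := h1.add h1.cesaro
  rw [add_zero] at h2
  refine squeeze_zero_norm' ?_ h2
  filter_upwards [eventually_gt_atTop 0] with n hn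
  have hn' : (0 : ℝ) < n := by exact_mod_cast hn
  have hd := lilNorm_pos hn
  have hd1 := lilNorm_pos n.succ_pos
  set S := ∑ i ∈ Finset.range n, y i with hS
  have hSle : |S| / lilNorm (n + 1) ≤ ∑ i ∈ Finset.range n, |y i| / lilNorm (i + 1) := by
    rw [div_le_iff₀ hd1, Finset.sum_mul]
    refine (Finset.abs_sum_le_sum_abs _ _).trans (Finset.sum_le_sum fun i hi => ?_)
    have hi1 := lilNorm_pos i.succ_pos
    rw [div_mul_eq_mul_div, le_div_iff₀ hi1]
    exact mul_le_mul_of_nonneg_left (lilNorm_mono (by simp at hi; omega)) (abs_nonneg _)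
  have hdiff : |S / lilNorm (n + 1) - S / lilNorm n| ≤ (n : ℝ)⁻¹ * (|S| / lilNorm (n + 1)) := by
    have h3 := lilNorm_succ_le hn
    have h4 := lilNorm_mono (Nat.le_succ n)
    simp only [Nat.succ_eq_add_one] at h4
    have e : S / lilNorm (n + 1) - S / lilNorm n =
        -(S / lilNorm (n + 1) * ((lilNorm (n + 1) - lilNorm n) / lilNorm n)) := by
      field_simp
      ring
    have h5 : (lilNorm (n + 1) - lilNorm n) / lilNorm n ≤ (n : ℝ)⁻¹ := by
      rw [div_le_iff₀ hd, ← one_div]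
      linarith
    rw [e, abs_neg, abs_mul, abs_div, abs_of_pos hd1, mul_comm,
      abs_of_nonneg (div_nonneg (sub_nonneg.2 h4) hd.le)]
    exact mul_le_mul_of_nonneg_right h5 (by positivity)
  have e : (S + y n) / lilNorm (n + 1) - S / lilNorm n =
      y n / lilNorm (n + 1) + (S / lilNorm (n + 1) - S / lilNorm n) := by ring
  rw [Finset.sum_range_succ, e]
  refine (norm_add_le _ _).trans (add_le_add ?_ (hdiff.trans ?_))
  · rw [Real.norm_eq_abs, abs_div, abs_of_pos hd1]
  · exact mul_le_mul_of_nonneg_left hSle (by positivity)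

/-- A large step forces one of the two adjacent partial sums to be large; `3 K` accounts for
`lilNorm (n + 1) ≤ 2 * lilNorm n`. -/
theorem frequently_abs_sum_of_frequently_abs {y : ℕ → ℝ}
    (h : ∀ k : ℕ, ∃ᶠ n in atTop, ((k : ℝ) + 1) * lilNorm n ≤ |y n|) (K : ℕ) :
    ∃ᶠ n in atTop, (K : ℝ) * lilNorm n ≤ |∑ i ∈ Finset.range n, y i| := by
  refine frequently_atTop.2 fun N => ?_
  obtain ⟨n, hn, hy⟩ := frequently_atTop.1 (h (3 * K)) (max N 1)
  have hn1 : 0 < n := (le_max_right N 1).trans hn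
  have hN : N ≤ n := (le_max_left N 1).trans hn
  have hn' : (1 : ℝ) ≤ n := by exact_mod_cast hn1
  by_contra! hcon
  have h1 := hcon n hN
  have h2 := hcon (n + 1) (by omega)
  have hd := lilNorm_pos hn1
  have h3 : lilNorm (n + 1) ≤ 2 * lilNorm n := by
    refine (lilNorm_succ_le hn1).trans (mul_le_mul_of_nonneg_right ?_ hd.le)
    have := (div_le_one (by linarith)).2 hn'
    linarith
  have h4 : |y n| ≤ |∑ i ∈ Finset.range (n + 1), y i| + |∑ i ∈ Finset.range n, y i| := by
    rw [Finset.sum_range_succ]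
    have := abs_sub (∑ i ∈ Finset.range n, y i + y n) (∑ i ∈ Finset.range n, y i)
    rwa [add_sub_cancel_left] at this
  have h5 : (K : ℝ) * lilNorm (n + 1) ≤ K * (2 * lilNorm n) := by gcongr
  push_cast at hy
  nlinarith

theorem frequently_abs_sum_of_tendsto_ne_zero {y : ℕ → ℝ} {m : ℝ} (hm : m ≠ 0)
    (h : Tendsto (fun n : ℕ => (∑ i ∈ Finset.range n, y i) / n) atTop (𝓝 m)) (K : ℕ) :
    ∃ᶠ n in atTop, (K : ℝ) * lilNorm n ≤ |∑ i ∈ Finset.range n, y i| := by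
  refine Eventually.frequently ?_
  have hm' : 0 < |m| := abs_pos.2 hm
  have h1 := h.abs.eventually (lt_mem_nhds (half_lt_self hm'))
  have hc : 0 < (|m| / 2) ^ 2 / (2 * (K + 1) ^ 2) := by positivity
  have h2 := (tendsto_llog_div.comp tendsto_natCast_atTop_atTop).eventually (gt_mem_nhds hc)
  filter_upwards [h1, h2, eventually_gt_atTop 0] with n h1 h2 hn
  have hn' : (0 : ℝ) < n := by exact_mod_cast hn
  rw [abs_div, abs_of_pos hn', lt_div_iff₀ hn'] at h1
  refine le_trans ?_ h1.le
  simp only [Function.comp] at h2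
  rw [div_lt_div_iff₀ hn' (by positivity)] at h2
  refine le_of_sq_le_sq ?_ (by positivity)
  rw [mul_pow, lilNorm_eq, lilScale_sq hn'.le]
  have hl := llog_pos n
  calc (K : ℝ) ^ 2 * (2 * n * llog n) ≤ ((K : ℝ) + 1) ^ 2 * (2 * n * llog n) := by
        gcongr
        linarith
    _ = n * (llog n * (2 * (K + 1) ^ 2)) := by ring
    _ ≤ n * ((|m| / 2) ^ 2 * n) := by gcongr
    _ = _ := by ring

/-- A divergent series with antitone terms diverges along each index class. -/
theorem tsum_indexClass_eq_top_of_antitone {f : ℕ → ℝ≥0∞} (hf : Antitone f) (hne : ∀ n, f n ≠ ⊤)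
    (h : ∑' n, f n = ⊤) (k : ℕ) : ∑' n, (if indexClass n = k then f n else 0) = ⊤ := by
  by_contra hcon
  have hinj : Function.Injective fun i : ℕ => 2 ^ (k + 1) * i + (2 ^ k - 1) := fun a b hab =>
    Nat.eq_of_mul_eq_mul_left (show 0 < 2 ^ (k + 1) by positivity) (Nat.add_right_cancel hab)
  have h1 := ENNReal.tsum_comp_le_tsum_of_injective hinj fun n => if indexClass n = k then f n else 0
  have hcl : ∀ i : ℕ, indexClass (2 ^ (k + 1) * i + (2 ^ k - 1)) = k := fun i => by
    refine (congrArg indexClass ?_).trans (indexClass_eq k i)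
    have := Nat.one_le_two_pow (n := k)
    rw [pow_succ, mul_assoc, mul_add, mul_one]
    omega
  simp only [hcl, if_true] at h1
  have h2 := ENNReal.summable_toReal (ne_top_of_le_ne_top hcon h1)
  -- For antitone terms, summability along one residue class is equivalent to summability of the
  -- whole series.
  have h3 := (summable_indicator_mod_iff_summable (2 ^ (k + 1)) (2 ^ k - 1)
    fun n => (f n).toReal).2 h2
  have h4 := (summable_indicator_mod_iff (fun a b hab => ENNReal.toReal_mono (hne a) (hf hab)) _).1 h3
  refine h4.tsum_ofReal_ne_top ?_
  rw [← h]
  exact tsum_congr fun n => ENNReal.ofReal_toReal (hne n)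

open ProbabilityTheory

/-! ### Extremal product laws. -/

section product

variable {M : Set (Measure ℝ)} (hM : ∀ μ ∈ M, IsProbabilityMeasure μ) {μ : ℕ → Measure ℝ}
  (hμ : ∀ i, μ i ∈ M)

theorem iIndepFun_eval (μ : ℕ → Measure ℝ) [∀ i, IsProbabilityMeasure (μ i)] :
    iIndepFun (fun i (x : ℕ → ℝ) => x i) (Measure.infinitePi μ) :=
  iIndepFun_infinitePi (X := fun _ x => x) fun _ => measurable_id

theorem infinitePi_eval_mem (μ : ℕ → Measure ℝ) [∀ i, IsProbabilityMeasure (μ i)] (i : ℕ)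
    {A : Set ℝ} (hA : MeasurableSet A) : Measure.infinitePi μ {x | x i ∈ A} = μ i A := by
  rw [← Measure.infinitePi_map_eval μ i, Measure.map_apply (by fun_prop) hA]
  rfl

include hM hμ

theorem ae_tendsto_eval_div_lilNorm (hT : TailIntegrable M) :
    ∀ᵐ x ∂(Measure.infinitePi μ), Tendsto (fun n => x n / lilNorm (n + 1)) atTop (𝓝 0) := by
  have := fun i => hM _ (hμ i)
  have h1 : ∀ k : ℕ, ∀ᵐ x ∂(Measure.infinitePi μ), ∀ᶠ n in atTop,
      |x n| < 1 / ((k : ℝ) + 1) * lilNorm (n + 1) := fun k => by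
    have hk : (0 : ℝ) < 1 / ((k : ℝ) + 1) := by positivity
    have hsum : ∑' n : ℕ, Measure.infinitePi μ
        {x | x n ∈ {y | 1 / ((k : ℝ) + 1) * lilNorm (n + 1) ≤ |y|}} ≠ ⊤ := by
      refine ne_top_of_le_ne_top (hT.tsum_lilNorm_lt_top hk).ne (ENNReal.tsum_le_tsum fun n => ?_)
      rw [infinitePi_eval_mem μ n (measurableSet_le measurable_const (by fun_prop))]
      exact measure_le_tailSup (hμ n) _
    filter_upwards [ae_eventually_notMem hsum] with x hx
    filter_upwards [hx] with n hn
    exact not_le.1 hn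
  filter_upwards [ae_all_iff.2 h1] with x hx
  rw [Metric.tendsto_atTop']
  intro ε hε
  obtain ⟨k, hk⟩ := exists_nat_one_div_lt hε
  obtain ⟨N, hN⟩ := eventually_atTop.1 (hx k)
  refine ⟨N, fun n hn => ?_⟩
  have hd := lilNorm_pos n.succ_pos
  rw [Real.dist_eq, sub_zero, abs_div, abs_of_pos hd, div_lt_iff₀ hd]
  exact (hN n hn.le).trans (mul_lt_mul_of_pos_right hk hd)

/-- At time `n` a law is chosen that has at least half of the maximal tail at the level prescribed
by the class of `n`. The tail series diverges along each class, so all levels are exceeded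
infinitely often. -/
theorem exists_ae_frequently_of_tsum_eq_top
    (h : ∀ c : ℝ, 0 < c → ∑' n : ℕ, tailSup M (c * lilNorm n) = ⊤) :
    ∃ ν : ℕ → Measure ℝ, (∀ i, ν i ∈ M) ∧ ∀ᵐ x ∂(Measure.infinitePi ν), ∀ k : ℕ,
      ∃ᶠ n in atTop, ((k : ℝ) + 1) * lilNorm n ≤ |x n| := by
  have hex : ∀ n : ℕ, ∃ ν ∈ M, tailSup M (((indexClass n : ℝ) + 1) * lilNorm n) / 2 ≤
      ν {x | ((indexClass n : ℝ) + 1) * lilNorm n ≤ |x|} := fun n => by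
    rcases eq_or_ne (tailSup M (((indexClass n : ℝ) + 1) * lilNorm n)) 0 with h0 | h0
    · exact ⟨μ 0, hμ 0, by simp [h0]⟩
    · have hlt := ENNReal.half_lt_self h0
        ((tailSup_le_one hM _).trans_lt ENNReal.one_lt_top).ne
      conv_rhs at hlt => rw [tailSup]
      simp only [lt_iSup_iff, exists_prop] at hlt
      obtain ⟨ν, hν, hlt⟩ := hlt
      exact ⟨ν, hν, hlt.le⟩
  choose ν hν hle using hex
  have := fun i => hM _ (hν i)
  refine ⟨ν, hν, ae_all_iff.2 fun k => ?_⟩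
  set B : ℕ → Set ℝ := fun n =>
    if indexClass n = k then {y | ((k : ℝ) + 1) * lilNorm n ≤ |y|} else ∅ with hB
  have hBm : ∀ n, MeasurableSet (B n) := fun n => by
    simp only [hB]
    split_ifs
    exacts [measurableSet_le measurable_const (by fun_prop), .empty]
  have hk : (0 : ℝ) < (k : ℝ) + 1 := by positivity
  have hdiv := tsum_indexClass_eq_top_of_antitone
    (f := fun n : ℕ => tailSup M (((k : ℝ) + 1) * lilNorm n))
    (fun a b hab => tailSup_anti M (mul_le_mul_of_nonneg_left (lilNorm_mono hab) hk.le))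
    (fun n => ((tailSup_le_one hM _).trans_lt ENNReal.one_lt_top).ne) (h _ hk) k
  have hsum : ∑' n, Measure.infinitePi ν {x | ∑ i ∈ Finset.Ico n (n + 1), x i ∈ B n} = ⊤ := by
    rw [eq_top_iff]
    calc ⊤ = ∑' n, (if indexClass n = k then
          tailSup M (((k : ℝ) + 1) * lilNorm n) else 0) / 2 := by
          simp only [div_eq_mul_inv]
          rw [ENNReal.tsum_mul_right, hdiv, ENNReal.top_mul (by simp)]
      _ ≤ _ := ENNReal.tsum_le_tsum fun n => by
          simp only [Nat.Ico_succ_singleton, Finset.sum_singleton]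
          rw [infinitePi_eval_mem ν n (hBm n)]
          simp only [hB]
          split_ifs with hn
          · have := hle n
            rwa [hn] at this
          · simp
  filter_upwards [ae_frequently_sum_Ico (iIndepFun_eval ν) (fun i => by fun_prop) (a := fun n => n)
    (b := fun n => n + 1) (fun i j hij => hij) hBm hsum] with x hx
  refine hx.mono fun n hn => ?_
  simp only [Nat.Ico_succ_singleton, Finset.sum_singleton, hB] at hn
  split_ifs at hn
  · exact hn
  · exact hn.elim

/-- Along a suitable product of laws of the family, the normalized walk is infinitely often beyond
any level below the largest standard deviation, in both directions. -/
theorem exists_ae_frequently_of_lt {C : ℝ} (hC : 0 ≤ C) (hT : TailIntegrable M)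
    (h : ∀ μ ∈ M, ∫⁻ x, ENNReal.ofReal (x ^ 2 / llog |x|) ∂μ ≤ ENNReal.ofReal C)
    (hmean : ∀ μ ∈ M, ∫ x, x ∂μ = 0) {σ : ℝ≥0∞}
    (hσ : σ ^ 2 = ⨆ μ ∈ M, ∫⁻ x, ENNReal.ofReal (x ^ 2) ∂μ) :
    ∃ ν : ℕ → Measure ℝ, (∀ i, ν i ∈ M) ∧ ∀ᵐ x ∂(Measure.infinitePi ν),
      ∀ K : ℝ, 0 ≤ K → ENNReal.ofReal K < σ →
        (∃ᶠ n in atTop, K * lilNorm n ≤ ∑ i ∈ Finset.range n, x i) ∧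
          ∃ᶠ n in atTop, ∑ i ∈ Finset.range n, x i ≤ -K * lilNorm n := by
  rcases eq_or_ne σ 0 with rfl | hσ0
  · exact ⟨μ, hμ, Eventually.of_forall fun x K _ hK => absurd hK not_lt_zero⟩
  -- The index classes enumerate the pairs of a rational level below `σ` and a sign.
  let T := {q : ℚ // 0 < (q : ℝ) ∧ ENNReal.ofReal q < σ}
  have hbtw : ∀ K : ℝ, ENNReal.ofReal K < σ → ∃ q : T, K < (q : ℚ) := fun K hK => by
    obtain ⟨q, hq0, hq1, hq2⟩ := ENNReal.lt_iff_exists_rat_btwn.1 hK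
    have hq : (0 : ℝ) < q := ENNReal.ofReal_pos.1 (bot_le.trans_lt hq1)
    exact ⟨⟨q, hq, hq2⟩, (ENNReal.ofReal_lt_ofReal_iff hq).1 hq1⟩
  obtain ⟨q₀, -⟩ := hbtw 0 (by simpa using pos_iff_ne_zero.2 hσ0)
  have : Nonempty (T × Bool) := ⟨(q₀, true)⟩
  obtain ⟨e, he⟩ := exists_surjective_nat (T × Bool)
  have hlaw : ∀ q : T, ∃ ν ∈ M,
      ENNReal.ofReal (((q : ℚ) : ℝ) ^ 2) < ∫⁻ x, ENNReal.ofReal (x ^ 2) ∂ν := fun q => by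
    have h1 : ENNReal.ofReal (((q : ℚ) : ℝ) ^ 2) < σ ^ 2 := by
      rw [ENNReal.ofReal_pow q.2.1.le]
      exact ENNReal.pow_right_strictMono two_ne_zero q.2.2
    rw [hσ] at h1
    simpa only [lt_iSup_iff, exists_prop] using h1
  choose ν hν hνq using hlaw
  have := fun i => hM _ (hν (e (indexClass (blockIndex i))).1)
  refine ⟨fun i => ν (e (indexClass (blockIndex i))).1, fun i => hν _, ?_⟩
  have hmain := ae_frequently_mul_lilNorm_le
    (iIndepFun_eval fun i => ν (e (indexClass (blockIndex i))).1) (fun i => by fun_prop) hC hM hT h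
    hmean (μ := fun k => ν (e k).1) (K := fun k => ((e k).1 : ℚ))
    (s := fun k => if (e k).2 then 1 else -1) (fun k => hν _)
    (fun k => by rcases (e k).2 <;> simp) (fun k => (e k).1.2.1) (fun k => hνq _)
    (fun i => Measure.infinitePi_map_eval _ i)
  filter_upwards [hmain] with x hx K hK0 hK
  obtain ⟨q, hq⟩ := hbtw K hK
  obtain ⟨k, hk⟩ := he (q, true)
  obtain ⟨l, hl⟩ := he (q, false)
  constructor
  · have := hx k K (by rw [hk]; exact hq)
    simpa [hk] using this
  · have := hx l K (by rw [hl]; exact hq)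
    refine this.mono fun n hn => ?_
    simp only [hl] at hn
    simp at hn
    linarith

end product

/-! ### The two halves and the converse. -/

namespace SublinearExpectationSpace

variable {Ω : Type*} [MeasurableSpace Ω] {S : SublinearExpectationSpace Ω}
  {Pfam : Set (@Measure Ω S.sigmaH)} (hCC : S.CC Pfam) {Y : ℕ → Ω → ℝ} (hY : ∀ n, Y n ∈ S.H)
  (hind : S.IndepSeq Y) (hid : S.IdentDist Y)
include hCC hY hind hid

/-- A single product law suffices for full capacity. Since `p` need not be measurable, a measurable
null set containing its complement is removed. -/
theorem one_le_envCap_of_ae {μ : ℕ → Measure ℝ} (hμ : ∀ i, μ i ∈ S.marginalLaws (Y 0))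
    {p : (ℕ → ℝ) → Prop} (h : ∀ᵐ x ∂(Measure.infinitePi μ), p x) :
    1 ≤ S.envCap Pfam {ω | p fun i => Y i ω} := by
  have := fun i => (hμ i).1
  obtain ⟨t, hpt, ht, ht0⟩ := exists_measurable_superset_of_null (ae_iff.1 h)
  calc 1 = Measure.infinitePi μ tᶜ := ((prob_compl_eq_one_iff ht).2 ht0).symm
    _ ≤ S.envCap Pfam {ω | (fun i => Y i ω) ∈ tᶜ} :=
        measure_le_envCap hCC hY (fun d φ hφ => integral_infinitePi_le hY hind hid hμ hφ) ht.compl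
    _ ≤ _ := iSup₂_mono fun P _ => measure_mono fun ω hω => not_not.1 fun hn => hω (hpt hn)

/-- Product laws are dominated by `envCap` and hence by `outCap`, so the upper half holds almost
surely under each of them. -/
theorem ae_eventually_abs_sum_le {w : ℝ} (hw : 0 ≤ w)
    (hM : CenteredFamily (S.marginalLaws (Y 0)) w) (hT : TailIntegrable (S.marginalLaws (Y 0)))
    {s : ℝ} (hs : 0 < s) (hws : w < s ^ 2) {μ : ℕ → Measure ℝ}
    (hμ : ∀ i, μ i ∈ S.marginalLaws (Y 0)) :
    ∀ᵐ x ∂(Measure.infinitePi μ), ∀ᶠ n in atTop,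
      |∑ i ∈ Finset.range n, x i| ≤ s * lilNorm n := by
  have := fun i => (hμ i).1
  set A : Set (ℕ → ℝ) := limsup (fun n => {x | s * lilNorm n ≤ |∑ i ∈ Finset.range n, x i|}) atTop
    with hA
  have hmem : ∀ x, x ∈ A ↔ ∃ᶠ n in atTop, s * lilNorm n ≤ |∑ i ∈ Finset.range n, x i| :=
    fun x => by simp [hA, mem_limsup_iff_frequently_mem]
  have hAm : MeasurableSet A := MeasurableSet.measurableSet_limsup fun n =>
    measurableSet_le measurable_const (by fun_prop)
  have h0 : Measure.infinitePi μ A = 0 := by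
    refine le_antisymm ?_ zero_le
    calc _ ≤ S.envCap Pfam {ω | (fun i => Y i ω) ∈ A} :=
          measure_le_envCap hCC hY (fun d φ hφ => integral_infinitePi_le hY hind hid hμ hφ) hAm
      _ ≤ S.outCap {ω | (fun i => Y i ω) ∈ A} :=
          (envCap_le_starCap hCC _).trans (starCap_le_outCap _)
      _ = 0 := by
          simp only [hmem]
          exact outCap_frequently_eq_zero hCC hY hind hid hw hM hT hs hws
  filter_upwards [measure_eq_zero_iff_ae_notMem.1 h0] with x hx
  rw [hmem, not_frequently] at hx
  filter_upwards [hx] with n hn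
  exact (not_le.1 hn).le

omit hCC hind hid in
theorem centeredFamily_sigmaBar (hσ : S.sigmaBar (Y 0) ≠ ⊤)
    (hmean : ∀ μ ∈ S.marginalLaws (Y 0), ∫ x, x ∂μ = 0) :
    CenteredFamily (S.marginalLaws (Y 0)) ((S.sigmaBar (Y 0)).toReal ^ 2) where
  prob := prob_of_mem_marginalLaws
  sq μ hμ := by
    rw [ENNReal.ofReal_pow ENNReal.toReal_nonneg, ENNReal.ofReal_toReal hσ]
    exact lintegral_sq_le_sigmaBar_sq hY hμ
  mean := hmean

theorem outCap_sigmaBar_lt_limsup_eq_zero (hT : TailIntegrable (S.marginalLaws (Y 0)))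
    (hmean : ∀ μ ∈ S.marginalLaws (Y 0), ∫ x, x ∂μ = 0) :
    S.outCap {ω | (S.sigmaBar (Y 0) : EReal) <
      limsup (fun n => ((|lilRatio Y ω n| : ℝ) : EReal)) atTop} = 0 := by
  rcases eq_or_ne (S.sigmaBar (Y 0)) ⊤ with hσ | hσ
  · refine outCap_eq_zero_of_subset fun ε hε => ⟨fun _ => ∅, fun _ => .empty, fun ω hω => ?_, ?_⟩
    · rw [mem_ofPred_eq, hσ] at hω
      exact absurd hω not_top_lt
    · simp [upCap_empty]
  set σ := (S.sigmaBar (Y 0)).toReal with hσr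
  have hσ0 : 0 ≤ σ := ENNReal.toReal_nonneg
  have hk : ∀ k : ℕ, 0 < 1 / ((k : ℝ) + 1) := fun k => by positivity
  have h1 := outCap_iUnion_eq_zero fun k : ℕ =>
    outCap_frequently_eq_zero hCC hY hind hid (sq_nonneg σ) (centeredFamily_sigmaBar hY hσ hmean) hT
      (s := σ + 1 / ((k : ℝ) + 1)) (by have := hk k; positivity)
      (by have := hk k; exact pow_lt_pow_left₀ (by linarith) hσ0 two_ne_zero)
  refine le_antisymm ((outCap_mono fun ω hω => ?_).trans_eq h1) zero_le
  obtain ⟨r, hr1, hr2⟩ := EReal.lt_iff_exists_real_btwn.1 (show _ < _ from hω)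
  have hσr' : (S.sigmaBar (Y 0) : EReal) = (σ : EReal) := by
    rw [EReal.coe_ennreal_toReal hσ]
  rw [hσr', EReal.coe_lt_coe_iff] at hr1
  obtain ⟨k, hk⟩ := exists_nat_one_div_lt (sub_pos.2 hr1)
  refine mem_iUnion.2 ⟨k, ?_⟩
  have h2 := (frequently_lt_of_lt_limsup (by isBoundedDefault) hr2).and_eventually
    (eventually_gt_atTop 0)
  refine h2.mono fun n hn => ?_
  have hd := lilNorm_pos hn.2
  have h3 := EReal.coe_lt_coe_iff.1 hn.1
  rw [lilRatio, abs_div, abs_of_pos hd, lt_div_iff₀ hd] at h3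
  nlinarith

theorem one_le_envCap_clusterSet_eq {C : ℝ} (hC : 0 ≤ C)
    (h : ∀ μ ∈ S.marginalLaws (Y 0),
      ∫⁻ x, ENNReal.ofReal (x ^ 2 / llog |x|) ∂μ ≤ ENNReal.ofReal C)
    (hT : TailIntegrable (S.marginalLaws (Y 0)))
    (hmean : ∀ μ ∈ S.marginalLaws (Y 0), ∫ x, x ∂μ = 0) :
    1 ≤ S.envCap Pfam {ω | clusterSet (lilRatio Y ω)
      = Icc (-(S.sigmaBar (Y 0) : EReal)) (S.sigmaBar (Y 0) : EReal)} := by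
  obtain ⟨μ₀, hμ₀⟩ := nonempty_marginalLaws hCC hY
  obtain ⟨ν, hν, hlow⟩ := exists_ae_frequently_of_lt prob_of_mem_marginalLaws (fun _ : ℕ => hμ₀) hC
    hT h hmean (sigmaBar_sq_eq hCC hY)
  have hstep := ae_tendsto_eval_div_lilNorm prob_of_mem_marginalLaws hν hT
  have hup : ∀ᵐ x ∂(Measure.infinitePi ν), ∀ s : ℝ, S.sigmaBar (Y 0) < ENNReal.ofReal s →
      ∀ᶠ n in atTop, |∑ i ∈ Finset.range n, x i| ≤ s * lilNorm n := by
    rcases eq_or_ne (S.sigmaBar (Y 0)) ⊤ with hσ | hσ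
    · exact Eventually.of_forall fun x s hs => absurd hs (by rw [hσ]; exact not_top_lt)
    set σ := (S.sigmaBar (Y 0)).toReal with hσr
    have hσ0 : 0 ≤ σ := ENNReal.toReal_nonneg
    have hk : ∀ k : ℕ, 0 < 1 / ((k : ℝ) + 1) := fun k => by positivity
    have h1 := fun k : ℕ => ae_eventually_abs_sum_le hCC hY hind hid (sq_nonneg σ)
      (centeredFamily_sigmaBar hY hσ hmean) hT (s := σ + 1 / ((k : ℝ) + 1))
      (by have := hk k; positivity)
      (by have := hk k; exact pow_lt_pow_left₀ (by linarith) hσ0 two_ne_zero) hν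
    filter_upwards [ae_all_iff.2 h1] with x hx s hs
    rw [← ENNReal.ofReal_toReal hσ] at hs
    obtain ⟨k, hk⟩ := exists_nat_one_div_lt (sub_pos.2 (ENNReal.ofReal_lt_ofReal_iff'.1 hs).1)
    filter_upwards [hx k] with n hn
    refine hn.trans (mul_le_mul_of_nonneg_right ?_ (Real.sqrt_nonneg _))
    linarith
  refine one_le_envCap_of_ae hCC hY hind hid hν
    (p := fun x => clusterSet (fun n => (∑ i ∈ Finset.range n, x i) / lilNorm n) =
      Icc (-(S.sigmaBar (Y 0) : EReal)) (S.sigmaBar (Y 0) : EReal)) ?_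
  filter_upwards [hlow, hstep, hup] with x hlow hstep hup
  refine clusterSet_eq_Icc (tendsto_lilRatio_step hstep) (fun s hs => ?_) fun K hK0 hK => ⟨?_, ?_⟩
  · filter_upwards [hup s hs, eventually_gt_atTop 0] with n hn hn0
    rwa [abs_div, abs_of_pos (lilNorm_pos hn0), div_le_iff₀ (lilNorm_pos hn0)]
  · refine ((hlow K hK0 hK).1.and_eventually (eventually_gt_atTop 0)).mono fun n hn => ?_
    exact (le_div_iff₀ (lilNorm_pos hn.2)).2 hn.1
  · refine ((hlow K hK0 hK).2.and_eventually (eventually_gt_atTop 0)).mono fun n hn => ?_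
    exact (div_le_iff₀ (lilNorm_pos hn.2)).2 hn.1

theorem one_le_envCap_limsup_eq_top {μ : ℕ → Measure ℝ} (hμ : ∀ i, μ i ∈ S.marginalLaws (Y 0))
    (h : ∀ᵐ x ∂(Measure.infinitePi μ), ∀ K : ℕ,
      ∃ᶠ n in atTop, (K : ℝ) * lilNorm n ≤ |∑ i ∈ Finset.range n, x i|) :
    1 ≤ S.envCap Pfam
      {ω | limsup (fun n => ((|lilRatio Y ω n| : ℝ) : EReal)) atTop = ⊤} := by
  refine one_le_envCap_of_ae hCC hY hind hid hμ
    (p := fun x => limsup (fun n =>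
      ((|(∑ i ∈ Finset.range n, x i) / lilNorm n| : ℝ) : EReal)) atTop = ⊤) ?_
  filter_upwards [h] with x hx
  refine limsup_abs_eq_top fun K => ?_
  refine ((hx K).and_eventually (eventually_gt_atTop 0)).mono fun n hn => ?_
  rw [abs_div, abs_of_pos (lilNorm_pos hn.2), le_div_iff₀ (lilNorm_pos hn.2)]
  exact hn.1

/-- Without (M) the tail series diverges at every multiple of `lilNorm`, and some product law has
jumps beyond all of them infinitely often. -/
theorem momentCond_of_envCap_lt_one {𝕍 : Set Ω → ℝ≥0∞} (hcap : IsCapacity 𝕍)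
    (hdom : S.Dominates 𝕍)
    (h : S.envCap Pfam
      {ω | limsup (fun n => ((|lilRatio Y ω n| : ℝ) : EReal)) atTop = ⊤} < 1) :
    MomentCond 𝕍 (Y 0) := by
  by_contra hmom
  obtain ⟨μ₀, hμ₀⟩ := nonempty_marginalLaws hCC hY
  obtain ⟨ν, hν, hfr⟩ := exists_ae_frequently_of_tsum_eq_top prob_of_mem_marginalLaws
    (fun _ : ℕ => hμ₀) fun c hc => by
      by_contra hne
      exact hmom (momentCond_of_tsum_lt_top hCC hY hcap hdom hc (lt_top_iff_ne_top.2 hne))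
  refine absurd h (not_lt.2 (one_le_envCap_limsup_eq_top hCC hY hind hid hν ?_))
  filter_upwards [hfr] with x hx
  exact frequently_abs_sum_of_frequently_abs hx

/-- By the strong law, a nonzero mean makes the walk grow linearly under the i.i.d. product, which
is faster than `lilNorm`. -/
theorem integral_eq_zero_of_envCap_lt_one
    (h : S.envCap Pfam
      {ω | limsup (fun n => ((|lilRatio Y ω n| : ℝ) : EReal)) atTop = ⊤} < 1)
    {μ : Measure ℝ} (hμ : μ ∈ S.marginalLaws (Y 0)) (hint : Integrable (fun x => x) μ) :
    ∫ x, x ∂μ = 0 := by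
  by_contra hne
  have := hμ.1
  have hev : ∀ i : ℕ, Measurable fun x : ℕ → ℝ => x i := fun i => by fun_prop
  have hmap := fun i : ℕ => Measure.infinitePi_map_eval (fun _ : ℕ => μ) i
  have hint0 : Integrable (fun x : ℕ → ℝ => x 0) (Measure.infinitePi fun _ => μ) := by
    have : Integrable (fun x => x) ((Measure.infinitePi fun _ : ℕ => μ).map fun x => x 0) := by
      rwa [hmap 0]
    exact this.comp_measurable (hev 0)
  have hmean0 : ∫ x : ℕ → ℝ, x 0 ∂(Measure.infinitePi fun _ => μ) = ∫ x, x ∂μ := by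
    rw [← integral_map (f := fun x => x) (hev 0).aemeasurable (by fun_prop), hmap 0]
  have hlln := strong_law_ae_real (fun i (x : ℕ → ℝ) => x i) hint0
    (fun i j hij => (iIndepFun_eval fun _ => μ).indepFun hij)
    (fun i => ⟨(hev i).aemeasurable, (hev 0).aemeasurable, by rw [hmap i, hmap 0]⟩)
  refine absurd h (not_lt.2 (one_le_envCap_limsup_eq_top hCC hY hind hid (fun _ => hμ) ?_))
  filter_upwards [hlln] with x hx
  rw [hmean0] at hx
  exact frequently_abs_sum_of_tendsto_ne_zero hne hx

theorem sigmaBar_lt_top_of_envCap_lt_one {C : ℝ} (hC : 0 ≤ C)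
    (hb : ∀ μ ∈ S.marginalLaws (Y 0),
      ∫⁻ x, ENNReal.ofReal (x ^ 2 / llog |x|) ∂μ ≤ ENNReal.ofReal C)
    (hT : TailIntegrable (S.marginalLaws (Y 0)))
    (hmean : ∀ μ ∈ S.marginalLaws (Y 0), ∫ x, x ∂μ = 0)
    (h : S.envCap Pfam
      {ω | limsup (fun n => ((|lilRatio Y ω n| : ℝ) : EReal)) atTop = ⊤} < 1) :
    S.sigmaBar (Y 0) < ⊤ := by
  by_contra hσ
  rw [not_lt_top_iff] at hσ
  obtain ⟨μ₀, hμ₀⟩ := nonempty_marginalLaws hCC hY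
  obtain ⟨ν, hν, hlow⟩ := exists_ae_frequently_of_lt prob_of_mem_marginalLaws (fun _ : ℕ => hμ₀) hC
    hT hb hmean (sigmaBar_sq_eq hCC hY)
  refine absurd h (not_lt.2 (one_le_envCap_limsup_eq_top hCC hY hind hid hν ?_))
  filter_upwards [hlow] with x hx K
  refine (hx K (Nat.cast_nonneg K) (by rw [hσ]; exact ENNReal.ofReal_lt_top)).1.mono fun n hn => ?_
  exact hn.trans (le_abs_self _)

end SublinearExpectationSpace

theorem TailIntegrable.exists_lintegral_sq_div_llog_le {M : Set (Measure ℝ)}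
    (hT : TailIntegrable M) : ∃ C : ℝ, 0 ≤ C ∧
      ∀ μ ∈ M, ∫⁻ x, ENNReal.ofReal (x ^ 2 / llog |x|) ∂μ ≤ ENNReal.ofReal C := by
  refine ⟨(∫⁻ t in Ioi (0 : ℝ), tailSup M (1 / 2 * lilScale t)).toReal, ENNReal.toReal_nonneg,
    fun μ hμ => (lintegral_sq_div_llog_le hμ).trans ?_⟩
  rw [ENNReal.ofReal_toReal (hT (1 / 2) (by norm_num)).ne]

open SublinearExpectationSpace in
theorem mainTheorem7 {Ω : Type*} [MeasurableSpace Ω] (S : SublinearExpectationSpace Ω)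
    (Pfam : Set (@Measure Ω S.sigmaH)) (hCC : S.CC Pfam)
    (𝕍 : Set Ω → ℝ≥0∞) (hcap : IsCapacity 𝕍) (hdom : S.Dominates 𝕍)
    (Y : ℕ → Ω → ℝ) (hY : ∀ n, Y n ∈ S.H) (hind : S.IndepSeq Y) (hid : S.IdentDist Y)
    (V : Set Ω → ℝ≥0∞) (hV : V = S.envCap Pfam ∨ V = S.starCap ∨ V = S.outCap) :
    (SublinearExpectationSpace.MomentCond 𝕍 (Y 0) → S.MeanZero (Y 0) →
      V {ω | (S.sigmaBar (Y 0) : EReal)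
          < limsup (fun n => ((|lilRatio Y ω n| : ℝ) : EReal)) atTop} = 0 ∧
      V {ω | clusterSet (lilRatio Y ω)
          = Icc (-(S.sigmaBar (Y 0) : EReal)) (S.sigmaBar (Y 0) : EReal)} = 1) ∧
    (V {ω | limsup (fun n => ((|lilRatio Y ω n| : ℝ) : EReal)) atTop = ⊤} < 1 →
      SublinearExpectationSpace.MomentCond 𝕍 (Y 0) ∧ S.MeanZero (Y 0) ∧
        S.sigmaBar (Y 0) < ⊤) := by
  refine ⟨fun hmom hmz => ?_, fun h => ?_⟩
  · have hT := tailIntegrable_of_momentCond hcap hdom (hY 0) hmom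
    obtain ⟨C, hC, hb⟩ := hT.exists_lintegral_sq_div_llog_le
    have hmean := (meanZero_iff hCC hY hC hb).1 hmz
    refine ⟨le_antisymm ((le_outCap_of_mem hCC hV _).trans_eq
      (outCap_sigmaBar_lt_limsup_eq_zero hCC hY hind hid hT hmean)) zero_le,
      le_antisymm ((le_outCap_of_mem hCC hV _).trans (outCap_le_one _)) ?_⟩
    exact (one_le_envCap_clusterSet_eq hCC hY hind hid hC hb hT hmean).trans
      (envCap_le_of_mem hCC hV _)
  -- The order matters: (M) makes the means exist, and the argument for `σ̄ < ∞` needs both (M) and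
  -- the vanishing of the means.
  · have henv := (envCap_le_of_mem hCC hV _).trans_lt h
    have hmom := momentCond_of_envCap_lt_one hCC hY hind hid hcap hdom henv
    have hT := tailIntegrable_of_momentCond hcap hdom (hY 0) hmom
    obtain ⟨C, hC, hb⟩ := hT.exists_lintegral_sq_div_llog_le
    have hmean : ∀ μ ∈ S.marginalLaws (Y 0), ∫ x, x ∂μ = 0 := fun μ hμ =>
      have := hμ.1
      integral_eq_zero_of_envCap_lt_one hCC hY hind hid henv hμ
        (integrable_id_of_sq_div_llog (hb μ hμ))
    exact ⟨hmom, (meanZero_iff hCC hY hC hb).2 hmean,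
      sigmaBar_lt_top_of_envCap_lt_one hCC hY hind hid hC hb hT hmean henv⟩
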